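/- Let $F$ be a nonarchimedean local field with ring of integers $\mathcal O$, maximal ideal $\mathfrak p$, and absolute value $|\cdot|$ normalized by $|\varpi|=N(\mathfrak p)^{-1}$ for a prime element $\varpi$, where $N(\mathfrak a)=\#(\mathcal O/\mathfrak a)$. Let $\psi:F\to\mathbb C^\times$ be a continuous additive character with conductor $\mathcal O$ (that is, $\psi$ is trivial on $x\mathcal O$ if and only if $x\in\mathcal O$). Let $U_n\subset \mathrm{GL}_n$ be the group of upper triangular matrices with ones on the diagonal, put $\psi(u)=\prod_{i=1}^{n-1}\psi(u_{i,i+1})$ for $u\in U_n(F)$, and let $I_n\subset\mathrm{GL}_n(\mathcal O)$ be the Iwahori subgroup of matrices that are upper triangular modulo $\mathfrak p$. A $\psi$-Whittaker function on $\mathrm{GL}_n(F)$ is a function $w:\mathrm{GL}_n(F)\to\mathbb C$ with $w(ug)=\psi(u)w(g)$ for all $u\in U_n(F)$, $g\in\mathrm{GL}_n(F)$; it is Iwahori invariant if $w(gk)=w(g)$ for all $k\in I_n$. Let $n\ge 0$, let $w$ be an Iwahori invariant $\psi$-Whittaker function on $\mathrm{GL}_{n+1}(F)$ and $v$ an Iwahori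 invariant $\psi^{-1}$-Whittaker function on $\mathrm{GL}_n(F)$. Let $\chi:F^\times\to\mathbb C^\times$ be a quasi-character (continuous homomorphism) with nontrivial conductor $\mathfrak f=f\mathcal O\neq\mathcal O$, $0\ne f\in\mathcal O$ (the largest ideal such that $\chi$ is trivial on $\mathcal O^\times\cap(1+\mathfrak f)$), with Gauss sum $G(\chi)=\sum_{x\in(\mathcal O/\mathfrak f)^\times}\chi(x)\psi(x/f)$. Put $j(g)=\begin{pmatrix}g&0\\0&1\end{pmatrix}$ for $g\in \mathrm{GL}_n(F)$ and $$h^{(f)}=t^{-1}\begin{pmatrix}w_n&\mathbf 1\\0&1\end{pmatrix}t,\qquad t=\mathrm{diag}(f^n,f^{n-1},\dots,f,1),$$ where $w_n$ is the $n\times n$ matrix with ones on the antidiagonal and zeros elsewhere, and $\mathbf 1$ is the column of $n$ ones. Let $dg$ be the invariant measure on $U_n(F)\backslash\mathrm{GL}_n(F)$ that is the quotient of the Haar measures giving $\mathrm{GL}_n(\mathcal O)$ and $U_n(\mathcal O)$ measure $1$. Then for every $s\in\mathbb C$ $$\int_{U_n(F)\backslash\mathrm{GL}_n(F)} w\bigl(j(g)h^{(f)}\bigr)\,v(g)\,\chi(\det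 g)\,|\det g|^{s-\frac12}\,dg=\prod_{\nu=1}^n\bigl(1-N(\mathfrak p)^{-\nu}\bigr)^{-1}\cdot N(\mathfrak f)^{-\sum_{k=1}^n k(n+1-k)}\cdot G(\chi)^{\frac{n(n+1)}2}\cdot w(1_{n+1})\cdot v(1_n).$$ Here the integral is understood as follows. For every $k\in\mathbb Z$ the integral over the set of $g$ with $|\det g|=N(\mathfrak p)^{-k}$ converges absolutely, and the sum over all $k\in\mathbb Z$ of these integrals converges unconditionally to the right-hand side; moreover, whenever the integral over all of $U_n(F)\backslash\mathrm{GL}_n(F)$ converges absolutely, its value is the right-hand side. -/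

import Mathlib

open ValuativeRel MeasureTheory Matrix
open scoped NNReal ENNReal

noncomputable section

namespace BirchLemma

variable {F : Type*} [Field F] [ValuativeRel F] [TopologicalSpace F] [IsNonarchimedeanLocalField F]

/-- The absolute norm `N(𝔭)`, the number of elements of the residue field. -/
def residueCard (F : Type*) [Field F] [ValuativeRel F] : ℕ := Nat.card 𝓀[F]

/-- The absolute norm `N(𝔣)` of an ideal of `𝒪`, the number of elements of `𝒪/𝔣`. -/
def idealNorm (I : Ideal 𝒪[F]) : ℕ := Nat.card (𝒪[F] ⧸ I)

lemma residueCard_ne_zero : (residueCard F : ℝ≥0) ≠ 0 := by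
  have : Finite 𝓀[F] := inferInstance
  exact Nat.cast_ne_zero.mpr Nat.card_pos.ne'

/-- The normalized absolute value of `F`: a uniformizer has absolute value `N(𝔭)⁻¹`.
The isomorphism of the value group with `ℤᵐ⁰` preserves the order, so a uniformizer corresponds to
`exp (-1)`, which is sent to `N(𝔭)⁻¹`. -/
def normAbs (x : F) : ℝ :=
  (WithZeroMulInt.toNNReal (residueCard_ne_zero (F := F))
    (IsNonarchimedeanLocalField.valueGroupWithZeroIsoInt F (valuation F x)) : ℝ≥0)

/-- The additive character `ψ` has conductor `𝒪`: the elements `x` such that `ψ` is trivial on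
`x𝒪` are exactly those of `𝒪`. -/
def AddCharConductorOne (ψ : AddChar F ℂ) : Prop :=
  ∀ x : F, (∀ y ∈ 𝒪[F], ψ (x * y) = 1) ↔ x ∈ 𝒪[F]

/-- The ideal `𝔣` is the conductor of `χ`: it is the largest ideal such that `χ` is trivial
on the units of `𝒪` that are congruent to `1` modulo that ideal. -/
def IsCondOf (χ : Fˣ →* ℂˣ) (𝔣 : Ideal 𝒪[F]) : Prop :=
  IsGreatest {I : Ideal 𝒪[F] |
    ∀ u : 𝒪[F]ˣ, (u : 𝒪[F]) - 1 ∈ I → χ (Units.map (algebraMap 𝒪[F] F).toMonoidHom u) = 1} 𝔣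

open Classical in
/-- Extension of a quasi-character by zero to `F`. -/
def extendZero (χ : Fˣ →* ℂˣ) (x : F) : ℂ :=
  if hx : x = 0 then 0 else (χ (Units.mk0 x hx) : ℂ)

/-- The Gauss sum `∑ χ(x) ψ(x/f)` over the finite group `(𝒪/f𝒪)ˣ`, evaluated on representatives
(for `f𝒪` the conductor of `χ` the terms do not depend on their choice). -/
def gaussSum (χ : Fˣ →* ℂˣ) (ψ : AddChar F ℂ) (f : 𝒪[F]) : ℂ :=
  ∑ᶠ x : (𝒪[F] ⧸ Ideal.span {f})ˣ,
    extendZero χ ((Quotient.out (x : 𝒪[F] ⧸ Ideal.span {f}) : 𝒪[F]) : F) *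
      ψ (((Quotient.out (x : 𝒪[F] ⧸ Ideal.span {f}) : 𝒪[F]) : F) / (f : F))

/-- The maximal compact subgroup `GL_n(𝒪)` of `GL_n(F)`. -/
def maxCompact (n : ℕ) (F : Type*) [Field F] [ValuativeRel F] : Subgroup (GL (Fin n) F) :=
  (Matrix.GeneralLinearGroup.map (n := Fin n) (algebraMap 𝒪[F] F)).range

/-- Invariance under right translation by the Iwahori subgroup, i.e. by the matrices in `GL_n(𝒪)`
that are upper triangular modulo `𝔭`. -/
def IsIwahoriInvariant {n : ℕ} (w : GL (Fin n) F → ℂ) : Prop :=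
  ∀ (g : GL (Fin n) F) (k : GL (Fin n) 𝒪[F]), (∀ i j : Fin n, j < i → k i j ∈ 𝓂[F]) →
    w (g * Matrix.GeneralLinearGroup.map (algebraMap 𝒪[F] F) k) = w g

/-- The group `U_n(F)` of upper triangular matrices with all diagonal entries `1`. -/
def unipotent (n : ℕ) (F : Type*) [Field F] : Subgroup (GL (Fin n) F) where
  carrier := {u | (∀ i j : Fin n, j < i → u i j = 0) ∧ ∀ i : Fin n, u i i = 1}
  one_mem' := by
    refine ⟨fun i j h => ?_, fun i => ?_⟩
    · simp [h.ne']
    · simp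
  mul_mem' := by
    rintro a b ⟨ha, ha1⟩ ⟨hb, hb1⟩
    have key : (a.val * b.val).BlockTriangular id :=
      Matrix.BlockTriangular.mul (M := a.val) (N := b.val)
        (fun i j h => ha i j h) (fun i j h => hb i j h)
    refine ⟨fun i j h => key h, fun i => ?_⟩
    change (a.val * b.val) i i = 1
    rw [Matrix.mul_apply, Finset.sum_eq_single i]
    · rw [ha1, hb1, one_mul]
    · intro k _ hk
      rcases lt_or_gt_of_ne hk with h | h
      · rw [ha i k h, zero_mul]
      · rw [hb k i h, mul_zero]
    · simp
  inv_mem' := by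
    rintro a ⟨ha, ha1⟩
    have hT : a.val.BlockTriangular id := fun i j h => ha i j h
    have hI : (a⁻¹).val.BlockTriangular id := by
      have : Invertible a.val := a.invertible
      rw [Matrix.coe_units_inv]
      exact Matrix.blockTriangular_inv_of_blockTriangular hT
    refine ⟨fun i j h => hI h, fun i => ?_⟩
    have h1 : ((a⁻¹).val * a.val) i i = 1 := by
      rw [← Units.val_mul]; simp
    rw [Matrix.mul_apply, Finset.sum_eq_single i] at h1
    · rwa [ha1, mul_one] at h1
    · intro k _ hk
      rcases lt_or_gt_of_ne hk with h | h
      · rw [hI h, zero_mul]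
      · rw [ha k i h, mul_zero]
    · simp

/-- The value `∏ ψ(u_{i,i+1})`, where `i` runs over all indices but the last. -/
def unipotentChar {n : ℕ} (ψ : AddChar F ℂ) (u : GL (Fin n) F) : ℂ :=
  ∏ i : Fin n, if h : (i : ℕ) + 1 < n then ψ (u i ⟨(i : ℕ) + 1, h⟩) else 1

/-- A `ψ`-Whittaker function on `GL_n(F)`. -/
def IsWhittaker {n : ℕ} (ψ : AddChar F ℂ) (w : GL (Fin n) F → ℂ) : Prop :=
  ∀ u ∈ unipotent n F, ∀ g : GL (Fin n) F, w (u * g) = unipotentChar ψ u * w g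

/-- The inclusion `GL_n → GL_{n+1}`, `g ↦ diag(g, 1)`. -/
def embed {n : ℕ} (g : GL (Fin n) F) : GL (Fin (n + 1)) F :=
  Matrix.GeneralLinearGroup.mkOfDetNeZero
    (Matrix.reindex finSumFinEquiv finSumFinEquiv
      (Matrix.fromBlocks (g : Matrix (Fin n) (Fin n) F) 0 0 (1 : Matrix (Fin 1) (Fin 1) F))) <| by
    rw [Matrix.det_reindex_self, Matrix.det_fromBlocks_zero₂₁, Matrix.det_one, mul_one]
    exact Matrix.GeneralLinearGroup.det_ne_zero g

/-- The matrix of the longest Weyl element, with ones on the antidiagonal. -/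
def longestWeyl (n : ℕ) (F : Type*) [Field F] : Matrix (Fin n) (Fin n) F :=
  Matrix.of fun i k => if k = Fin.rev i then 1 else 0

lemma det_longestWeyl_ne_zero (n : ℕ) (F : Type*) [Field F] : (longestWeyl n F).det ≠ 0 := by
  have h : longestWeyl n F * longestWeyl n F = 1 := by
    ext i k
    rw [Matrix.mul_apply, Finset.sum_eq_single (Fin.rev i)]
    · simp [longestWeyl, Matrix.one_apply, eq_comm]
    · intro j _ hj
      simp [longestWeyl, hj]
    · simp
  intro h0
  have := congrArg Matrix.det h
  simp [h0] at this

/-- The matrix `h` with blocks `w_n` and `0` in the first `n` columns and ones in the last. -/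
def hMat (n : ℕ) (F : Type*) [Field F] : GL (Fin (n + 1)) F :=
  Matrix.GeneralLinearGroup.mkOfDetNeZero
    (Matrix.reindex finSumFinEquiv finSumFinEquiv
      (Matrix.fromBlocks (longestWeyl n F) (Matrix.of fun _ _ => 1) 0
        (1 : Matrix (Fin 1) (Fin 1) F))) <| by
    rw [Matrix.det_reindex_self, Matrix.det_fromBlocks_zero₂₁, Matrix.det_one, mul_one]
    exact det_longestWeyl_ne_zero n F

/-- The diagonal matrix `t = diag(f^n, …, f, 1)`. -/
def tMat (n : ℕ) (f : Fˣ) : GL (Fin (n + 1)) F :=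
  Matrix.GeneralLinearGroup.mkOfDetNeZero
    (Matrix.diagonal fun i : Fin (n + 1) => (f : F) ^ (n - (i : ℕ))) <| by
    simp [Matrix.det_diagonal, Finset.prod_ne_zero_iff]

/-- The matrix `h^{(f)} = t⁻¹ h t`. -/
def hConj (n : ℕ) (f : Fˣ) : GL (Fin (n + 1)) F := (tMat n f)⁻¹ * hMat n F * tMat n f

/-- The space `U_n(F) \ GL_n(F)` of right cosets `U_n(F) g`, with the quotient `σ`-algebra. -/
abbrev UQuot (n : ℕ) (F : Type*) [Field F] : Type _ :=
  Quotient (QuotientGroup.rightRel (unipotent n F))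

/-- The set `A K` of products of an invertible diagonal matrix and an element of `K = GL_n(𝒪)`. -/
def diagK (n : ℕ) (F : Type*) [Field F] [ValuativeRel F] : Set (GL (Fin n) F) :=
  {g | ∃ a : GL (Fin n) F, (∀ i j : Fin n, i ≠ j → a i j = 0) ∧ ∃ k ∈ maxCompact n F, g = a * k}

/-- The invariant measure on `U_n(F) \ GL_n(F)` attached to Haar measures `μ` on `GL_n(F)` and `ν`
on `U_n(F)`, i.e. the measure `κ` determined by
`∫ φ dμ = ∫ (∫ φ(u g) dν(u)) dκ(g)` for all measurable `φ ≥ 0` on `GL_n(F)`.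

Construction: by the Iwasawa decomposition `GL_n(F) = U A K`, every coset `U g` meets `A K`, and
`{u ∈ U | u g ∈ A K}` has positive finite measure (it is compact and open). So the weight
`β(g) = 1_{A K}(g) / ν {u | u g ∈ A K}` satisfies `∫ β(u g) dν(u) = 1` for all `g`, and `κ` is the
image of `β dμ` under the projection. -/
def quotMeasure {n : ℕ} [MeasurableSpace (GL (Fin n) F)]
    (μ : Measure (GL (Fin n) F)) (ν : Measure (unipotent n F)) : Measure (UQuot n F) :=
  (μ.withDensity fun g => (diagK n F).indicator 1 g /
      ν {u : unipotent n F | (u : GL (Fin n) F) * g ∈ diagK n F}).map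
    (Quotient.mk (QuotientGroup.rightRel (unipotent n F)))

/-- The integrand `w(j(g) h^{(f)}) v(g) χ(det g) |det g|^{s - 1/2}`. -/
def integrand {n : ℕ} (w : GL (Fin (n + 1)) F → ℂ) (v : GL (Fin n) F → ℂ)
    (χ : Fˣ →* ℂˣ) (f : Fˣ) (s : ℂ) (g : GL (Fin n) F) : ℂ :=
  w (embed g * hConj n f) * v g * (χ (Matrix.GeneralLinearGroup.det g) : ℂ) *
    (normAbs (Matrix.GeneralLinearGroup.det g : F) : ℂ) ^ (s - 1 / 2)

/-- The integrand as a function on `U_n(F) \ GL_n(F)`. For `w` and `v` Whittaker functions for `ψ`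
and `ψ⁻¹` the integrand is left invariant under `U_n(F)`, so the representative is irrelevant. -/
def quotIntegrand {n : ℕ} (w : GL (Fin (n + 1)) F → ℂ) (v : GL (Fin n) F → ℂ)
    (χ : Fˣ →* ℂˣ) (f : Fˣ) (s : ℂ) (x : UQuot n F) : ℂ :=
  integrand w v χ f s x.out

/-- The set of cosets `U_n(F) g` with `|det g| = N(𝔭)^{-k}`. -/
def detShell (n : ℕ) (F : Type*) [Field F] [ValuativeRel F] [TopologicalSpace F]
    [IsNonarchimedeanLocalField F] (k : ℤ) : Set (UQuot n F) :=
  {x | normAbs (Matrix.GeneralLinearGroup.det x.out : F) = (residueCard F : ℝ) ^ (-k)}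

/-- The right hand side of the formula. -/
def birchConstant {n : ℕ} (w : GL (Fin (n + 1)) F → ℂ) (v : GL (Fin n) F → ℂ)
    (χ : Fˣ →* ℂˣ) (ψ : AddChar F ℂ) (f : 𝒪[F]) : ℂ :=
  (∏ ν ∈ Finset.Icc 1 n, (1 - ((residueCard F : ℂ) ^ ν)⁻¹)⁻¹) *
    ((idealNorm (Ideal.span {f}) : ℂ) ^ (∑ k ∈ Finset.Icc 1 n, k * (n + 1 - k)))⁻¹ *
    gaussSum χ ψ f ^ (n * (n + 1) / 2) * w 1 * v 1

end BirchLemma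

end

/-! Write `I` for the integrand and `K = GL_n(𝒪)`. By the Iwasawa decomposition the quotient is
covered by the images of the cells `p^e K`, where `p` is a uniformizer and `e ∈ ℤⁿ`. `I` is right
invariant under a principal congruence subgroup of level `f^M`, so its integral over a cell is a
weight times a finite average of `I(p^e κ)` over `κ ∈ K` (`cosetAvg`). Everything rests on
`exists_cosetAvg_integrand`: the average of `I(aκ)` for diagonal `a` is the asserted constant if all
entries of `a` are units, and is zero otherwise. The proof is an induction on the rank; entries are
numbered from `0`, and the step goes from `n` to `n + 1`.

Torus. A diagonal matrix passes through `h^{(f)}` at the cost of a unipotent column, so `I(g t)` is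
`I(g)` times `∏ χ(t_i) ψ(g_{n,i} (t_i - 1) f^{i-n-1})` for units `t_i` (`integrand_mul_diagGL`).
Averaging over `t_i` gives zero unless `g_{n,i} ∈ f^{n-i} 𝒪ˣ`, because `χ` has exact conductor `f`
(`cosetAvg_chi_psi_eq_zero`). For `g = aκ` this forces the last entry of `a` to be a unit, which can
be absorbed into `K`.

Recursion. A `κ` whose last row is `(f^{n-i} t_i)` is a mirabolic matrix times `L t`, where `L =
(f^{i-j})_{j ≤ i}` lies in the Iwahori subgroup. The identity `embedHom_lowerGL_mul_hConj` takes
`h^{(f)}` of one size to the next smaller size, so `I(j(g) L t)` is `∏ χ(t_i) ψ(t_i/f)` times the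
integrand of lower rank at `g`, formed with the restrictions of `w` and `v`
(`integrand_embedHom_mul_lowerGL`).

Gauss sums. The last row of `κ` is equidistributed among the primitive vectors modulo `f^M`
(`cosetAvg_lastRow`). Their number is `N(𝔣)^{M(n+1)} (1 - N(𝔭)^{-(n+1)})`, and coordinate `i`
contributes `N(𝔣)^{M-(n-i+1)} G(χ)`. The quotient is the factor by which the constant grows
(`cosetAvg_prod_gaussTerm`, `birchConstant_succ`).

Convergence. A Whittaker function invariant under a congruence subgroup is supported on a cone of
the torus, and the cone meets each determinant shell in finitely many cells (`finite_cone`). Hence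
each shell integral converges absolutely. Only the cell `e = 0`, of weight one, contributes, so the
shell `k = 0` carries the whole value. -/

set_option linter.unusedSectionVars false

noncomputable section

namespace BirchLemma

/-! ### Block, diagonal and unipotent matrices over a commutative ring -/

section Blocks

variable {A B : Type*} [CommRing A] [CommRing B] {n : ℕ}

/-- The block matrix `diag(g, 1)` in `GL_{n+1}`, as a group homomorphism. -/
def embedHom (n : ℕ) (A : Type*) [CommRing A] : GL (Fin n) A →* GL (Fin (n + 1)) A :=
  Units.map
    { toFun := fun g => Matrix.reindex finSumFinEquiv finSumFinEquiv
        (Matrix.fromBlocks g 0 0 (1 : Matrix (Fin 1) (Fin 1) A))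
      map_one' := by simp
      map_mul' := fun g h => by
        simp [Matrix.submatrix_mul_equiv, Matrix.fromBlocks_multiply] }

@[simp] lemma embedHom_castSucc_castSucc (g : GL (Fin n) A) (i j : Fin n) :
    embedHom n A g i.castSucc j.castSucc = g i j := by
  simp [embedHom]

@[simp] lemma embedHom_castSucc_last (g : GL (Fin n) A) (i : Fin n) :
    embedHom n A g i.castSucc (Fin.last n) = 0 := by
  simp [embedHom]

@[simp] lemma embedHom_last_castSucc (g : GL (Fin n) A) (j : Fin n) :
    embedHom n A g (Fin.last n) j.castSucc = 0 := by
  simp [embedHom]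

@[simp] lemma embedHom_last_last (g : GL (Fin n) A) :
    embedHom n A g (Fin.last n) (Fin.last n) = 1 := by
  simp [embedHom]

lemma map_embedHom (φ : A →+* B) (g : GL (Fin n) A) :
    GeneralLinearGroup.map φ (embedHom n A g) = embedHom n B (GeneralLinearGroup.map φ g) := by
  ext i j
  induction i using Fin.lastCases <;> induction j using Fin.lastCases <;> simp

lemma det_embedHom (g : GL (Fin n) A) :
    GeneralLinearGroup.det (embedHom n A g) = GeneralLinearGroup.det g := by
  ext
  simp [embedHom, Matrix.det_submatrix_equiv_self]

lemma embed_eq_embedHom {F : Type*} [Field F] (g : GL (Fin n) F) :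
    embed g = embedHom n F g := by
  ext i j
  rfl

/-- Two elements of `GL_{n+1}` agree if their columns do. -/
lemma gl_ext_succ {g h : GL (Fin (n + 1)) A}
    (h1 : ∀ i j : Fin n, g i.castSucc j.castSucc = h i.castSucc j.castSucc)
    (h2 : ∀ i : Fin n, g i.castSucc (Fin.last n) = h i.castSucc (Fin.last n))
    (h3 : ∀ j : Fin n, g (Fin.last n) j.castSucc = h (Fin.last n) j.castSucc)
    (h4 : g (Fin.last n) (Fin.last n) = h (Fin.last n) (Fin.last n)) : g = h := by
  ext i j
  induction i using Fin.lastCases <;> induction j using Fin.lastCases <;> simp_all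

/-- The unipotent matrix with blocks `1`, `y`, `0`, `1`. -/
def colUnip (y : Fin n → A) : GL (Fin (n + 1)) A where
  val := 1 + Matrix.of fun i j => Fin.lastCases 0 (fun i => if j = Fin.last n then y i else 0) i
  inv := 1 - Matrix.of fun i j => Fin.lastCases 0 (fun i => if j = Fin.last n then y i else 0) i
  val_inv := by
    have : (Matrix.of fun i j : Fin (n + 1) =>
        (Fin.lastCases 0 (fun i => if j = Fin.last n then y i else 0) i : A)) *
        (Matrix.of fun i j : Fin (n + 1) =>
        (Fin.lastCases 0 (fun i => if j = Fin.last n then y i else 0) i : A)) = 0 := by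
      ext i j
      induction i using Fin.lastCases <;> simp [Matrix.mul_apply]
    rw [add_mul, mul_sub, mul_sub, this]; simp
  inv_val := by
    have : (Matrix.of fun i j : Fin (n + 1) =>
        (Fin.lastCases 0 (fun i => if j = Fin.last n then y i else 0) i : A)) *
        (Matrix.of fun i j : Fin (n + 1) =>
        (Fin.lastCases 0 (fun i => if j = Fin.last n then y i else 0) i : A)) = 0 := by
      ext i j
      induction i using Fin.lastCases <;> simp [Matrix.mul_apply]
    rw [sub_mul, mul_add, mul_add, this]; simp

@[simp] lemma colUnip_castSucc_castSucc (y : Fin n → A) (i j : Fin n) :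
    colUnip y i.castSucc j.castSucc = (1 : Matrix (Fin n) (Fin n) A) i j := by
  simp [colUnip, Matrix.one_apply]

@[simp] lemma colUnip_castSucc_last (y : Fin n → A) (i : Fin n) :
    colUnip y i.castSucc (Fin.last n) = y i := by
  simp [colUnip]

@[simp] lemma colUnip_last_castSucc (y : Fin n → A) (j : Fin n) :
    colUnip y (Fin.last n) j.castSucc = 0 := by
  simp [colUnip, (Fin.castSucc_lt_last j).ne']

@[simp] lemma colUnip_last_last (y : Fin n → A) :
    colUnip y (Fin.last n) (Fin.last n) = 1 := by
  simp [colUnip]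

/-- The semidirect product structure of the mirabolic subgroup. It brings unipotent columns to the
far left, where Whittaker functions turn them into values of `ψ`. -/
lemma embedHom_mul_colUnip (g : GL (Fin n) A) (y : Fin n → A) :
    embedHom n A g * colUnip y = colUnip (g.val *ᵥ y) * embedHom n A g := by
  apply gl_ext_succ <;> intros <;>
    simp [Matrix.mul_apply, Fin.sum_univ_castSucc, Matrix.one_apply, Matrix.mulVec, dotProduct]

lemma map_colUnip (φ : A →+* B) (y : Fin n → A) :
    GeneralLinearGroup.map φ (colUnip y) = colUnip (fun i => φ (y i)) := by
  apply gl_ext_succ <;> intros <;> simp [Matrix.one_apply, apply_ite φ]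

/-- A matrix whose last row is `(0, …, 0, 1)` is a product of unipotent and block matrix. -/
lemma eq_colUnip_mul_embedHom (g : GL (Fin (n + 1)) A)
    (h0 : ∀ j : Fin n, g (Fin.last n) j.castSucc = 0) (h1 : g (Fin.last n) (Fin.last n) = 1) :
    ∃ (y : Fin n → A) (k : GL (Fin n) A), g = colUnip y * embedHom n A k := by
  let M : Matrix (Fin n) (Fin n) A := Matrix.of fun i j => g i.castSucc j.castSucc
  have hblk : g.val = Matrix.reindex finSumFinEquiv finSumFinEquiv
      (Matrix.fromBlocks M (Matrix.of fun i _ => g i.castSucc (Fin.last n)) 0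
        (1 : Matrix (Fin 1) (Fin 1) A)) := by
    ext i j
    induction i using Fin.lastCases <;> induction j using Fin.lastCases <;>
      simp [M, h0, h1]
  have hdet : IsUnit M.det := by
    have := (Matrix.isUnit_iff_isUnit_det _).mp g.isUnit
    rwa [hblk, Matrix.det_reindex_self, Matrix.det_fromBlocks_zero₂₁, Matrix.det_one, mul_one]
      at this
  refine ⟨fun i => g i.castSucc (Fin.last n), GeneralLinearGroup.mk'' M hdet, ?_⟩
  have hM : ∀ i j, GeneralLinearGroup.mk'' M hdet i j = g i.castSucc j.castSucc := fun i j => rfl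
  apply gl_ext_succ <;> intros <;>
    simp [Matrix.mul_apply, Fin.sum_univ_castSucc, Matrix.one_apply, h0, h1, hM]

/-- The diagonal matrices, as a group homomorphism. -/
def diagGL (n : ℕ) (A : Type*) [CommRing A] : (Fin n → Aˣ) →* GL (Fin n) A :=
  (Units.map (Matrix.diagonalRingHom (Fin n) A).toMonoidHom).comp
    (MulEquiv.piUnits (M := fun _ : Fin n => A)).symm.toMonoidHom

lemma diagGL_apply (t : Fin n → Aˣ) (i j : Fin n) :
    diagGL n A t i j = if i = j then (t i : A) else 0 := by
  change Matrix.diagonal _ i j = _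
  rw [Matrix.diagonal_apply]
  rfl

lemma diagGL_val (t : Fin n → Aˣ) : (diagGL n A t).val = Matrix.diagonal fun i => (t i : A) := by
  ext i j; rw [diagGL_apply, Matrix.diagonal_apply]

lemma map_diagGL (φ : A →+* B) (t : Fin n → Aˣ) :
    GeneralLinearGroup.map φ (diagGL n A t) =
      diagGL n B fun i => Units.map φ.toMonoidHom (t i) := by
  ext i j
  simp only [GeneralLinearGroup.map_apply, diagGL_apply]
  split_ifs <;> simp

lemma det_diagGL (t : Fin n → Aˣ) : GeneralLinearGroup.det (diagGL n A t) = ∏ i, t i := by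
  ext
  simp [diagGL_val]

lemma mul_diagGL_apply (g : GL (Fin n) A) (t : Fin n → Aˣ) (i j : Fin n) :
    (g * diagGL n A t) i j = g i j * t j := by
  rw [Units.val_mul, diagGL_val, Matrix.mul_diagonal]

lemma diagGL_mul_apply (g : GL (Fin n) A) (t : Fin n → Aˣ) (i j : Fin n) :
    (diagGL n A t * g) i j = t i * g i j := by
  rw [Units.val_mul, diagGL_val, Matrix.diagonal_mul]

/-- The lower triangular matrix with entries `f ^ (i - j)`, `j ≤ i`. -/
def lowerMat (n : ℕ) (f : A) : Matrix (Fin n) (Fin n) A :=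
  Matrix.of fun i j => if j ≤ i then f ^ ((i : ℕ) - j) else 0

lemma det_lowerMat (f : A) : (lowerMat n f).det = 1 := by
  rw [Matrix.det_of_isLowerTriangular]
  · simp [lowerMat]
  · intro i j hij
    simp only [lowerMat, of_apply, ite_eq_right_iff]
    intro h
    exact absurd (OrderDual.toDual_lt_toDual.mp hij) (not_lt.mpr h)

/-- The lower triangular matrix with entries `f ^ (i - j)`, as an element of `GL_n`. -/
def lowerGL (n : ℕ) (f : A) : GL (Fin n) A :=
  GeneralLinearGroup.mk'' (lowerMat n f) (by rw [det_lowerMat]; exact isUnit_one)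

lemma lowerGL_apply (f : A) (i j : Fin n) :
    lowerGL n f i j = if j ≤ i then f ^ ((i : ℕ) - j) else 0 := rfl

lemma det_lowerGL (f : A) : GeneralLinearGroup.det (lowerGL n f) = 1 := by
  ext
  exact det_lowerMat f

lemma map_lowerGL (φ : A →+* B) (f : A) :
    GeneralLinearGroup.map φ (lowerGL n f) = lowerGL n (φ f) := by
  ext i j
  simp only [GeneralLinearGroup.map_apply, lowerGL_apply]
  split_ifs <;> simp

end Blocks

/-! ### The matrix `h^{(f)}` -/

section HMatrix

variable {F : Type*} [Field F] {n : ℕ}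

/-- The sign matrix `diag(-1, …, -1, 1)`. -/
def signDiag (n : ℕ) (A : Type*) [CommRing A] : GL (Fin (n + 1)) A :=
  diagGL (n + 1) A fun i => if i = Fin.last n then 1 else -1

lemma tMat_eq (f : Fˣ) :
    tMat n f = diagGL (n + 1) F fun i => f ^ (n - (i : ℕ)) := by
  ext i j
  rw [diagGL_apply]
  simp [tMat, Matrix.diagonal_apply]

lemma hConj_apply (f : Fˣ) (i j : Fin (n + 1)) :
    hConj n f i j = ((f ^ (n - (i : ℕ)))⁻¹ : Fˣ) * hMat n F i j * (f ^ (n - (j : ℕ)) : Fˣ) := by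
  rw [hConj, tMat_eq, ← map_inv, mul_diagGL_apply, diagGL_mul_apply]
  rfl

@[simp] lemma hMat_castSucc_castSucc (i j : Fin n) :
    hMat n F i.castSucc j.castSucc = if j = Fin.rev i then 1 else 0 := by
  simp [hMat, longestWeyl]

@[simp] lemma hMat_castSucc_last (i : Fin n) : hMat n F i.castSucc (Fin.last n) = 1 := by
  simp [hMat]

@[simp] lemma hMat_last_castSucc (j : Fin n) : hMat n F (Fin.last n) j.castSucc = 0 := by
  simp [hMat]

@[simp] lemma hMat_last_last : hMat n F (Fin.last n) (Fin.last n) = 1 := by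
  simp [hMat]

/-- Conjugation by `t` scales the entry by `f^{i-j}`, and `j = n - 1 - i` on the antidiagonal. -/
lemma hConj_castSucc_castSucc (f : Fˣ) (i j : Fin n) :
    hConj n f i.castSucc j.castSucc =
      if j = Fin.rev i then (f : F) ^ (2 * (i : ℤ) + 1 - n) else 0 := by
  rw [hConj_apply, hMat_castSucc_castSucc]
  split_ifs with h
  · have h1 : ((j.castSucc : Fin (n + 1)) : ℕ) = n - (i + 1) := by rw [h]; simp [Fin.val_rev]
    have h2 : n - ((j.castSucc : Fin (n + 1)) : ℕ) = i + 1 := by have := i.2; omega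
    rw [h2, mul_one, Fin.val_castSucc, ← Units.val_mul, ← zpow_natCast, ← zpow_natCast,
      ← _root_.zpow_neg, ← _root_.zpow_add, Units.val_zpow_eq_zpow_val]
    congr 1
    have := i.2; push_cast [Nat.cast_sub this.le]; ring
  · simp

lemma hConj_castSucc_last (f : Fˣ) (i : Fin n) :
    hConj n f i.castSucc (Fin.last n) = (f : F) ^ ((i : ℤ) - n) := by
  rw [hConj_apply, hMat_castSucc_last]
  have := i.2
  simp only [Fin.val_castSucc, mul_one, Fin.val_last, Nat.sub_self, pow_zero, Units.val_one]
  simp only [← zpow_natCast, ← _root_.zpow_neg, Units.val_zpow_eq_zpow_val]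
  congr 1
  push_cast [Nat.cast_sub this.le]; ring

lemma hConj_last_castSucc (f : Fˣ) (j : Fin n) : hConj n f (Fin.last n) j.castSucc = 0 := by
  rw [hConj_apply, hMat_last_castSucc]; simp

lemma hConj_last_last (f : Fˣ) : hConj n f (Fin.last n) (Fin.last n) = 1 := by
  rw [hConj_apply, hMat_last_last]; simp

/-- The last column of `h^{(f)}` without its last entry. -/
def hCol (n : ℕ) (f : Fˣ) (i : Fin n) : F := (f : F) ^ ((i : ℤ) - n)

/-- A diagonal matrix moves through `h^{(f)}`. -/
lemma embedHom_diagGL_mul_hConj (f : Fˣ) (t : Fin n → Fˣ) :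
    embedHom n F (diagGL n F t) * hConj n f =
      colUnip (fun i => (t i - 1) * hCol n f i) * hConj n f *
        embedHom n F (diagGL n F fun i => t i.rev) := by
  apply gl_ext_succ <;> intros <;>
    simp only [hConj_castSucc_castSucc, hConj_castSucc_last, Units.val_mul,
      hConj_last_castSucc, hConj_last_last, Matrix.mul_apply, Fin.sum_univ_castSucc,
      embedHom_castSucc_castSucc, embedHom_castSucc_last, embedHom_last_castSucc,
      embedHom_last_last, diagGL_apply, colUnip_castSucc_castSucc, colUnip_castSucc_last,
      colUnip_last_castSucc, colUnip_last_last, mul_zero, zero_mul, add_zero, zero_add,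
      Finset.sum_const_zero, mul_one, Matrix.one_apply, ite_mul, mul_ite, Finset.sum_ite_eq,
      Finset.sum_ite_eq', Finset.mem_univ, if_true, one_mul, hCol]
  · rename_i i j
    by_cases h : j = i.rev
    · subst h
      simp [mul_comm]
    · rw [if_neg h, Finset.sum_eq_zero]
      intro x _
      split_ifs with h1 h2
      · exact absurd (h2 ▸ h1) h
      · rfl
      · rfl
  · ring
  · simp

/-- The recursion for `h^{(f)}`: the matrix `(f^{i-j})` moves `h^{(f)}` of size `n+2` to the one
of size `n+1`. -/
lemma embedHom_lowerGL_mul_hConj (f : Fˣ) :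
    embedHom (n + 1) F (lowerGL (n + 1) (f : F)) * hConj (n + 1) f =
      colUnip ((lowerGL (n + 1) (f : F)).val *ᵥ hCol (n + 1) f) * embedHom (n + 1) F (hConj n f) *
        embedHom (n + 1) F (signDiag n F * lowerGL (n + 1) (f : F)) := by
  have hf : (f : F) ≠ 0 := f.ne_zero
  apply gl_ext_succ <;> intros <;>
    simp only [Units.val_mul,
      hConj_last_castSucc, hConj_last_last, Matrix.mul_apply, Fin.sum_univ_castSucc (n := n + 1),
      embedHom_castSucc_castSucc, embedHom_castSucc_last, embedHom_last_castSucc,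
      embedHom_last_last, colUnip_castSucc_castSucc, colUnip_castSucc_last,
      colUnip_last_castSucc, colUnip_last_last, mul_zero, zero_mul, add_zero, zero_add,
      Finset.sum_const_zero, mul_one, Matrix.one_apply, ite_mul, Finset.sum_ite_eq,
      Finset.mem_univ, if_true, one_mul, signDiag, Matrix.mulVec, dotProduct,
      hConj_castSucc_last, hCol]
  rename_i i c
  have hL : ∀ k, (∑ x, diagGL (n + 1) F (fun i => if i = Fin.last n then 1 else -1) k x *
      lowerGL (n + 1) (f : F) x c) = (if k = Fin.last n then 1 else -1) *
      lowerGL (n + 1) (f : F) k c := by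
    intro k
    rw [← Matrix.mul_apply, ← Units.val_mul, diagGL_mul_apply]
    split_ifs <;> simp
  simp only [hL]
  have hA : ∀ x : Fin (n + 1), lowerGL (n + 1) (f : F) i x * hConj (n + 1) f x.castSucc c.castSucc
      = if x = c.rev then lowerGL (n + 1) (f : F) i x * (f : F) ^ (2 * (x : ℤ) + 1 - (n + 1 : ℕ))
        else 0 := by
    intro x
    rw [hConj_castSucc_castSucc]
    have : c = x.rev ↔ x = c.rev := by rw [← Fin.rev_inj, Fin.rev_rev]; exact eq_comm
    simp [this]
  simp only [hA, Finset.sum_ite_eq', Finset.mem_univ, if_true]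
  rw [Fin.sum_univ_castSucc]
  simp only [lowerGL_apply, if_true, one_mul]
  have hc := c.2
  have hi := i.2
  have h1 : ∀ k : ℤ, ∀ a : ℕ, (f : F) ^ a * (f : F) ^ k = (f : F) ^ (a + k) := fun k a => by
    rw [← zpow_natCast, ← zpow_add₀ hf]
  have h2 : ∀ k : ℤ, ∀ a : ℕ, (f : F) ^ k * (f : F) ^ a = (f : F) ^ (k + a) := fun k a => by
    rw [← zpow_natCast, ← zpow_add₀ hf]
  induction i using Fin.lastCases with
  | last =>
    simp only [hConj_last_castSucc, hConj_last_last, zero_mul, Finset.sum_const_zero, zero_add,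
      Fin.le_last, if_true, one_mul, Fin.val_rev, Fin.val_last]
    rw [h1, ← zpow_natCast]
    congr 1
    omega
  | cast i =>
    have hi' := i.2
    simp only [hConj_castSucc_castSucc, hConj_castSucc_last, ite_mul, zero_mul,
      Finset.sum_ite_eq', Finset.mem_univ, if_true, (Fin.castSucc_lt_last _).ne, if_false,
      Fin.le_def, Fin.val_castSucc, Fin.val_rev, Fin.val_last]
    -- For `n ≤ i + c` only the last column of the smaller `h^{(f)}` contributes to the right-hand
    -- side. Otherwise its antidiagonal also contributes `f^{i-c}`, with the opposite sign; this
    -- cancellation is the purpose of `signDiag`.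
    by_cases hic : n ≤ i + c
    · rw [if_pos (by omega), if_neg (by omega), if_pos (by omega), mul_zero, mul_zero, zero_add,
        h1, h2]
      congr 1
      omega
    · rw [if_neg (by omega), if_pos (by omega), if_pos (by omega), h2, neg_one_mul, mul_neg, h2]
      rw [eq_comm, neg_add_eq_zero]
      congr 1
      omega

end HMatrix

/-! ### Averages over a finite quotient -/

section CosetAvg

variable {Γ Δ : Type*} [Group Γ] [Group Δ]

/-- The average of `Φ` over representatives of `Γ ⧸ Λ`. -/
def cosetAvg (Λ : Subgroup Γ) (Φ : Γ → ℂ) : ℂ := (Λ.index : ℂ)⁻¹ * ∑ᶠ x : Γ ⧸ Λ, Φ x.out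

/-- Invariance of a function under right translation by `Λ`. -/
def IsRightInv (Λ : Subgroup Γ) (Φ : Γ → ℂ) : Prop := ∀ g, ∀ k ∈ Λ, Φ (g * k) = Φ g

lemma IsRightInv.eq {Λ : Subgroup Γ} {Φ : Γ → ℂ} (h : IsRightInv Λ Φ) {a b : Γ}
    (hab : a⁻¹ * b ∈ Λ) : Φ a = Φ b := by
  rw [← h a _ hab, mul_inv_cancel_left]

lemma IsRightInv.mul {Λ : Subgroup Γ} {Φ Ψ : Γ → ℂ} (h : IsRightInv Λ Φ) (h' : IsRightInv Λ Ψ) :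
    IsRightInv Λ fun g => Φ g * Ψ g := fun g k hk => by
  simp only [h g k hk, h' g k hk]

variable (Λ : Subgroup Γ)

lemma cosetAvg_eq_sum [Fintype (Γ ⧸ Λ)] (Φ : Γ → ℂ) :
    cosetAvg Λ Φ = (Λ.index : ℂ)⁻¹ * ∑ x : Γ ⧸ Λ, Φ x.out := by
  rw [cosetAvg, finsum_eq_sum_of_fintype]

variable [Λ.FiniteIndex]

lemma cosetAvg_const (c : ℂ) : cosetAvg Λ (fun _ => c) = c := by
  have := Λ.fintypeQuotientOfFiniteIndex
  have h : (Λ.index : ℂ) ≠ 0 := Nat.cast_ne_zero.mpr Subgroup.FiniteIndex.index_ne_zero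
  rw [cosetAvg_eq_sum, Finset.sum_const, Finset.card_univ, nsmul_eq_mul,
    ← Nat.card_eq_fintype_card, ← Subgroup.index, inv_mul_cancel_left₀ h]

lemma cosetAvg_mul_left (c : ℂ) (Φ : Γ → ℂ) :
    cosetAvg Λ (fun g => c * Φ g) = c * cosetAvg Λ Φ := by
  have := Λ.fintypeQuotientOfFiniteIndex
  rw [cosetAvg_eq_sum, cosetAvg_eq_sum, ← Finset.mul_sum, mul_left_comm]

lemma cosetAvg_add (Φ Ψ : Γ → ℂ) :
    cosetAvg Λ (fun g => Φ g + Ψ g) = cosetAvg Λ Φ + cosetAvg Λ Ψ := by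
  have := Λ.fintypeQuotientOfFiniteIndex
  rw [cosetAvg_eq_sum, cosetAvg_eq_sum, cosetAvg_eq_sum, Finset.sum_add_distrib, mul_add]

lemma cosetAvg_sum {ι : Type*} (s : Finset ι) (Φ : ι → Γ → ℂ) :
    cosetAvg Λ (fun g => ∑ i ∈ s, Φ i g) = ∑ i ∈ s, cosetAvg Λ (Φ i) := by
  have := Λ.fintypeQuotientOfFiniteIndex
  simp only [cosetAvg_eq_sum]
  rw [Finset.sum_comm, Finset.mul_sum]

lemma cosetAvg_comm (Λ' : Subgroup Δ) [Λ'.FiniteIndex] (Φ : Γ → Δ → ℂ) :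
    cosetAvg Λ (fun g => cosetAvg Λ' (Φ g)) = cosetAvg Λ' fun d => cosetAvg Λ fun g => Φ g d := by
  have := Λ.fintypeQuotientOfFiniteIndex
  have := Λ'.fintypeQuotientOfFiniteIndex
  simp only [cosetAvg_eq_sum, ← Finset.mul_sum]
  rw [Finset.sum_comm, mul_left_comm]

variable {Λ}

/-- Such a bijection permutes the cosets. It need not be a translation in the group: additive shifts
of units are also used. -/
lemma cosetAvg_comp_equiv {Φ : Γ → ℂ} (hΦ : IsRightInv Λ Φ) (e : Γ ≃ Γ)
    (he : ∀ g h, g⁻¹ * h ∈ Λ ↔ (e g)⁻¹ * e h ∈ Λ) :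
    cosetAvg Λ (fun g => Φ (e g)) = cosetAvg Λ Φ := by
  have := Λ.fintypeQuotientOfFiniteIndex
  rw [cosetAvg_eq_sum, cosetAvg_eq_sum]
  congr 1
  let e' : Γ ⧸ Λ ≃ Γ ⧸ Λ := Quotient.congr e fun g h => by
    rw [QuotientGroup.leftRel_apply, QuotientGroup.leftRel_apply]; exact he g h
  refine Fintype.sum_equiv e' _ _ fun x => hΦ.eq ?_
  rw [← QuotientGroup.eq, QuotientGroup.out_eq']
  conv_rhs => rw [← QuotientGroup.out_eq' x]
  rfl

lemma cosetAvg_left {Φ : Γ → ℂ} (hΦ : IsRightInv Λ Φ) (a : Γ) :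
    cosetAvg Λ (fun g => Φ (a * g)) = cosetAvg Λ Φ :=
  cosetAvg_comp_equiv hΦ (Equiv.mulLeft a) fun g h => by simp [mul_assoc]

/-- Right translation acts on the left cosets of `Λ` because `Λ` is normal. -/
lemma cosetAvg_right [Λ.Normal] {Φ : Γ → ℂ} (hΦ : IsRightInv Λ Φ) (a : Γ) :
    cosetAvg Λ (fun g => Φ (g * a)) = cosetAvg Λ Φ :=
  cosetAvg_comp_equiv hΦ (Equiv.mulRight a) fun g h => by
    have : ((Equiv.mulRight a) g)⁻¹ * (Equiv.mulRight a) h = a⁻¹ * (g⁻¹ * h) * a⁻¹⁻¹ := by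
      simp [mul_assoc]
    rw [this]
    exact ⟨fun hx => Subgroup.Normal.conj_mem inferInstance _ hx _, fun hx => by
      simpa [mul_assoc] using Subgroup.Normal.conj_mem (H := Λ) inferInstance _ hx a⟩

/-- A function vanishes on average if it does so on average along the right translates by
`δ : Δ → Γ`. -/
lemma cosetAvg_eq_zero_of_right [Λ.Normal] {Φ : Γ → ℂ} (hΦ : IsRightInv Λ Φ) (δ : Δ → Γ)
    (Λ' : Subgroup Δ) [Λ'.FiniteIndex]
    (h : ∀ g, cosetAvg Λ' (fun d => Φ (g * δ d)) = 0) : cosetAvg Λ Φ = 0 := by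
  have h1 : cosetAvg Λ' (fun d => cosetAvg Λ fun g => Φ (g * δ d)) = cosetAvg Λ Φ := by
    rw [← cosetAvg_const Λ' (cosetAvg Λ Φ)]
    congr 1; ext d
    rw [cosetAvg_right hΦ]
  rw [← h1, ← cosetAvg_comm]
  simp only [h, cosetAvg_const]

end CosetAvg

/-! ### The orbit of the last row -/

section Congruence

variable {A : Type*} [CommRing A]

/-- The principal congruence subgroup of level `I`. -/
def congSubgroup (n : ℕ) (I : Ideal A) : Subgroup (GL (Fin n) A) :=
  (GeneralLinearGroup.map (n := Fin n) (Ideal.Quotient.mk I)).ker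

instance (n : ℕ) (I : Ideal A) : (congSubgroup n I).Normal := by
  unfold congSubgroup; infer_instance

instance (n : ℕ) (I : Ideal A) [Finite (A ⧸ I)] : (congSubgroup n I).FiniteIndex := by
  unfold congSubgroup; infer_instance

lemma mem_congSubgroup {n : ℕ} {I : Ideal A} {k : GL (Fin n) A} :
    k ∈ congSubgroup n I ↔ ∀ i j, k i j - (1 : Matrix (Fin n) (Fin n) A) i j ∈ I := by
  rw [congSubgroup, MonoidHom.mem_ker, GeneralLinearGroup.ext_iff]
  refine forall₂_congr fun i j => ?_
  rw [GeneralLinearGroup.map_apply, ← Ideal.Quotient.eq]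
  simp [Matrix.one_apply, apply_ite (Ideal.Quotient.mk I)]

lemma congSubgroup_mono {n : ℕ} {I J : Ideal A} (h : I ≤ J) :
    congSubgroup n I ≤ congSubgroup n J := fun k hk => by
  rw [mem_congSubgroup] at hk ⊢
  exact fun i j => h (hk i j)

lemma mul_mem_congSubgroup_sub {n : ℕ} {I : Ideal A} (g : GL (Fin n) A) {k : GL (Fin n) A}
    (hk : k ∈ congSubgroup n I) (i j : Fin n) : (g * k) i j - g i j ∈ I := by
  have : (g * k) i j - g i j = ∑ l, g i l * (k l j - (1 : Matrix (Fin n) (Fin n) A) l j) := by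
    simp only [mul_sub, Finset.sum_sub_distrib, Units.val_mul, Matrix.mul_apply]
    congr 1
    rw [← Matrix.mul_apply, Matrix.mul_one]
  rw [this]
  exact Ideal.sum_mem _ fun l _ => I.mul_mem_left _ (mem_congSubgroup.mp hk l j)

lemma embedHom_mem_congSubgroup {n : ℕ} {I : Ideal A} {k : GL (Fin n) A}
    (hk : k ∈ congSubgroup n I) : embedHom n A k ∈ congSubgroup (n + 1) I := by
  rw [congSubgroup, MonoidHom.mem_ker] at hk ⊢
  rw [map_embedHom, hk, map_one]

/-- The units congruent to `1` modulo `I`. -/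
def congUnits (I : Ideal A) : Subgroup Aˣ :=
  (Units.map (Ideal.Quotient.mk I).toMonoidHom).ker

instance (I : Ideal A) [Finite (A ⧸ I)] : (congUnits I).FiniteIndex := by
  unfold congUnits; infer_instance

lemma mem_congUnits {I : Ideal A} {u : Aˣ} : u ∈ congUnits I ↔ (u : A) - 1 ∈ I := by
  rw [congUnits, MonoidHom.mem_ker, ← Ideal.Quotient.eq, Units.ext_iff]
  simp

lemma diagGL_mem_congSubgroup {n : ℕ} {I : Ideal A} {t : Fin n → Aˣ}
    (ht : ∀ i, t i ∈ congUnits I) : diagGL n A t ∈ congSubgroup n I := by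
  rw [mem_congSubgroup]
  intro i j
  rw [diagGL_apply, Matrix.one_apply]
  split_ifs
  · exact mem_congUnits.mp (ht i)
  · simp

/-- The last row modulo `I`. -/
def lastRow {n : ℕ} (I : Ideal A) (g : GL (Fin (n + 1)) A) (j : Fin (n + 1)) : A ⧸ I :=
  Ideal.Quotient.mk I (g (Fin.last n) j)

lemma lastRow_mul {n : ℕ} (I : Ideal A) (g k : GL (Fin (n + 1)) A) :
    lastRow I (g * k) = lastRow I g ᵥ* (GeneralLinearGroup.map (Ideal.Quotient.mk I) k).val := by
  ext j
  simp [lastRow, Matrix.mul_apply, Matrix.vecMul, dotProduct]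

lemma lastRow_mul_congSubgroup {n : ℕ} {I : Ideal A} (g : GL (Fin (n + 1)) A)
    {k : GL (Fin (n + 1)) A} (hk : k ∈ congSubgroup (n + 1) I) :
    lastRow I (g * k) = lastRow I g := by
  rw [lastRow_mul, (MonoidHom.mem_ker).mp hk]
  simp

lemma vecMul_injective {n : ℕ} (k : GL (Fin n) A) : Function.Injective fun r => r ᵥ* k.val := by
  intro r s h
  have := congrArg (fun r => r ᵥ* (k⁻¹).val) h
  simpa only [Matrix.vecMul_vecMul, Units.mul_inv, Matrix.vecMul_one] using this

/-- Every vector with a unit among its coordinates is the last row of an invertible matrix. -/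
lemma exists_lastRow_eq [IsLocalRing A] {n : ℕ} (I : Ideal A) (r : Fin (n + 1) → A ⧸ I)
    (i : Fin (n + 1)) (x : Fin (n + 1) → A) (hx : ∀ j, Ideal.Quotient.mk I (x j) = r j)
    (hi : IsUnit (x i)) : ∃ g : GL (Fin (n + 1)) A, lastRow I g = r := by
  -- The swap moves the unit coordinate to the end. The identity matrix with its last row replaced
  -- is then lower triangular with determinant that unit, and permuting columns back changes only
  -- the sign.
  let σ := Equiv.swap i (Fin.last n)
  let M : Matrix (Fin (n + 1)) (Fin (n + 1)) A :=
    (1 : Matrix (Fin (n + 1)) (Fin (n + 1)) A).updateRow (Fin.last n) (x ∘ σ)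
  have hM : IsUnit (M.submatrix id σ).det := by
    rw [Matrix.det_permute', Matrix.det_of_isLowerTriangular, Fin.prod_univ_castSucc]
    · have h1 : ∀ j : Fin n, M j.castSucc j.castSucc = 1 := fun j => by
        simp [M, Matrix.updateRow_apply, (Fin.castSucc_lt_last j).ne]
      simp only [h1, Finset.prod_const_one, one_mul]
      have h2 : M (Fin.last n) (Fin.last n) = x i := by simp [M, σ]
      rw [h2]
      exact ((Equiv.Perm.sign σ).isUnit.map (Int.castRingHom A)).mul hi
    · intro a b hab
      have hab' : a < b := OrderDual.toDual_lt_toDual.mp hab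
      have : a ≠ Fin.last n := (hab'.trans_le (Fin.le_last b)).ne
      simp [M, Matrix.updateRow_apply, this, hab'.ne]
  refine ⟨GeneralLinearGroup.mk'' _ hM, ?_⟩
  ext j
  rw [← hx]
  change Ideal.Quotient.mk I (M (Fin.last n) (σ j)) = _
  simp [M, σ]

lemma exists_isUnit_lastRow [IsLocalRing A] {n : ℕ} (g : GL (Fin (n + 1)) A) :
    ∃ j, IsUnit (g (Fin.last n) j) := by
  by_contra! h
  have h1 : (∑ j, g (Fin.last n) j * (g⁻¹) j (Fin.last n)) = 1 := by
    rw [← Matrix.mul_apply, Units.mul_inv, Matrix.one_apply_eq]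
  have h2 : (1 : A) ∈ IsLocalRing.maximalIdeal A := by
    rw [← h1]
    exact Ideal.sum_mem _ fun j _ => Ideal.mul_mem_right _ _
      ((IsLocalRing.mem_maximalIdeal _).mpr (h j))
  exact (IsLocalRing.mem_maximalIdeal _).mp h2 isUnit_one

lemma isUnit_of_isUnit_mk [IsLocalRing A] {I : Ideal A} (hI : I ≠ ⊤) {x : A}
    (hx : IsUnit (Ideal.Quotient.mk I x)) : IsUnit x := by
  obtain ⟨y, hy⟩ := hx.exists_right_inv
  obtain ⟨y, rfl⟩ := Ideal.Quotient.mk_surjective y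
  rw [← map_mul, ← map_one (Ideal.Quotient.mk I), Ideal.Quotient.eq] at hy
  have h1 : IsUnit (x * y) := by
    by_contra h
    have h2 := (IsLocalRing.mem_maximalIdeal _).mpr h
    have h3 := Ideal.sub_mem _ h2 (IsLocalRing.le_maximalIdeal hI hy)
    rw [sub_sub_cancel] at h3
    exact (IsLocalRing.mem_maximalIdeal _).mp h3 isUnit_one
  exact isUnit_of_mul_isUnit_left h1

/-- The last row is equidistributed among the vectors with a unit among their coordinates. -/
lemma cosetAvg_lastRow [IsLocalRing A] {n : ℕ} {I : Ideal A} (hI : I ≠ ⊤) [Finite (A ⧸ I)]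
    (Θ : (Fin (n + 1) → A ⧸ I) → ℂ) (hΘ : ∀ r, (∀ i, ¬ IsUnit (r i)) → Θ r = 0) :
    cosetAvg (congSubgroup (n + 1) I) (fun g => Θ (lastRow I g)) =
      ((Nat.card {r : Fin (n + 1) → A ⧸ I // ∃ i, IsUnit (r i)} : ℂ))⁻¹ * ∑ᶠ r, Θ r := by
  classical
  have := Fintype.ofFinite (A ⧸ I)
  let p : (Fin (n + 1) → A ⧸ I) → ℂ := fun r =>
    cosetAvg (congSubgroup (n + 1) I) fun g => if lastRow I g = r then 1 else 0
  have hp_inv : ∀ r, IsRightInv (congSubgroup (n + 1) I)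
      fun g => if lastRow I g = r then (1 : ℂ) else 0 := fun r g k hk => by
    simp only [lastRow_mul_congSubgroup g hk]
  have hp0 : ∀ r, (∀ i, ¬ IsUnit (r i)) → p r = 0 := by
    intro r hr
    have h (g : GL (Fin (n + 1)) A) : ¬ lastRow I g = r := by
      rintro rfl
      obtain ⟨j, hj⟩ := exists_isUnit_lastRow g
      exact hr j (hj.map (Ideal.Quotient.mk I))
    simp only [p, h, if_false, cosetAvg_const]
  -- The group acts transitively on primitive rows by right multiplication and the average is right
  -- invariant, so all primitive rows are equally likely. The common value follows from total mass
  -- one.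
  have hp1 : ∀ r, (∃ i, IsUnit (r i)) → p r = p (lastRow I 1) := by
    rintro r ⟨i, hi⟩
    choose x hx using fun j => Ideal.Quotient.mk_surjective (r j)
    have hxi : IsUnit (x i) := isUnit_of_isUnit_mk hI (by rwa [hx])
    obtain ⟨k, rfl⟩ := exists_lastRow_eq I r i x hx hxi
    rw [← one_mul k, lastRow_mul]
    simp only [p]
    rw [← cosetAvg_right (hp_inv _) k]
    congr 1; ext g
    rw [lastRow_mul]
    congr 1
    exact propext (vecMul_injective _).eq_iff
  have hsum : ∀ Θ : (Fin (n + 1) → A ⧸ I) → ℂ,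
      cosetAvg (congSubgroup (n + 1) I) (fun g => Θ (lastRow I g)) = ∑ r, p r * Θ r := by
    intro Θ
    have : ∀ r, p r * Θ r = cosetAvg (congSubgroup (n + 1) I)
        fun g => Θ r * if lastRow I g = r then 1 else 0 := fun r => by
      rw [cosetAvg_mul_left, mul_comm]
    simp only [this]
    rw [← cosetAvg_sum]
    congr 1; ext g
    simp
  have htot := hsum fun _ => 1
  rw [cosetAvg_const] at htot
  set P : Finset (Fin (n + 1) → A ⧸ I) := Finset.univ.filter fun r => ∃ i, IsUnit (r i) with hP
  have hcard : Nat.card {r : Fin (n + 1) → A ⧸ I // ∃ i, IsUnit (r i)} = P.card := by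
    rw [Nat.card_eq_fintype_card, Fintype.card_subtype]
  have h1 : (P.card : ℂ) * p (lastRow I 1) = 1 := by
    rw [htot, ← nsmul_eq_mul, ← Finset.sum_const, hP, Finset.sum_filter]
    refine Finset.sum_congr rfl fun r _ => ?_
    split_ifs with h
    · rw [hp1 r h, mul_one]
    · rw [hp0 r (by simpa using h), zero_mul]
  rw [hsum, hcard, finsum_eq_sum_of_fintype, Finset.mul_sum]
  refine Finset.sum_congr rfl fun r _ => ?_
  by_cases h : ∃ i, IsUnit (r i)
  · rw [hp1 r h, eq_inv_of_mul_eq_one_right h1]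
  · rw [hΘ r (by simpa using h), mul_zero, mul_zero]

end Congruence

variable {F : Type*} [Field F] [ValuativeRel F] [TopologicalSpace F] [IsNonarchimedeanLocalField F]

/-! ### Arithmetic of the local field -/

lemma mem_integer_or_inv (x : F) : x ∈ 𝒪[F] ∨ ∃ y ∈ 𝓂[F], (y : F) = x⁻¹ := by
  by_cases hx : x ∈ 𝒪[F]
  · exact Or.inl hx
  · right
    have h1 : 1 < valuation F x := not_le.mp hx
    have h2 : valuation F x⁻¹ < 1 := by
      rw [map_inv₀]; exact inv_lt_one_of_one_lt₀ h1
    refine ⟨⟨x⁻¹, h2.le⟩, ?_, rfl⟩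
    rw [IsLocalRing.mem_maximalIdeal, mem_nonunits_iff]
    exact Valuation.Integer.not_isUnit_iff_valuation_lt_one.mpr h2

lemma finite_quotient_span {f : 𝒪[F]} (hf : f ≠ 0) : Finite (𝒪[F] ⧸ Ideal.span {f}) := by
  obtain ⟨ϖ, hϖ⟩ := IsDiscreteValuationRing.exists_irreducible 𝒪[F]
  obtain ⟨k, u, rfl⟩ := IsDiscreteValuationRing.eq_unit_mul_pow_irreducible hf hϖ
  have h1 : Ideal.span {(u : 𝒪[F]) * ϖ ^ k} = 𝓂[F] ^ k := by
    rw [Ideal.span_singleton_mul_left_unit u.isUnit, ← Ideal.span_singleton_pow,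
      hϖ.maximalIdeal_eq]
  rw [h1]
  have : Finite (𝒪[F] ⧸ 𝓂[F]) := inferInstanceAs (Finite 𝓀[F])
  exact Ideal.finite_quotient_pow (IsNoetherian.noetherian _) k

/-- The additive isomorphism of `𝒪/b` with the image of `a𝒪` in `𝒪/ab`, as an injection. -/
def mulQuot (a b : 𝒪[F]) :
    (𝒪[F] ⧸ Ideal.span {b}) →+ 𝒪[F] ⧸ Ideal.span {a * b} :=
  QuotientAddGroup.lift _ ((Ideal.Quotient.mk (Ideal.span {a * b})).toAddMonoidHom.comp
    (AddMonoidHom.mulLeft a)) <| by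
    intro x hx
    obtain ⟨y, rfl⟩ := Ideal.mem_span_singleton'.mp hx
    change Ideal.Quotient.mk _ (a * (y * b)) = 0
    rw [Ideal.Quotient.eq_zero_iff_mem]
    exact Ideal.mem_span_singleton'.mpr ⟨y, by ring⟩

lemma mulQuot_mk (a b x : 𝒪[F]) :
    mulQuot a b (Ideal.Quotient.mk _ x) = Ideal.Quotient.mk _ (a * x) := rfl

lemma mulQuot_injective {a : 𝒪[F]} (ha : a ≠ 0) (b : 𝒪[F]) :
    Function.Injective (mulQuot a b) := by
  rw [injective_iff_map_eq_zero]
  intro x hx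
  obtain ⟨x, rfl⟩ := Ideal.Quotient.mk_surjective x
  rw [mulQuot_mk, Ideal.Quotient.eq_zero_iff_mem, Ideal.mem_span_singleton'] at hx
  obtain ⟨y, hy⟩ := hx
  rw [Ideal.Quotient.eq_zero_iff_mem, Ideal.mem_span_singleton']
  exact ⟨y, mul_left_cancel₀ ha (by rw [← hy]; ring)⟩

/-- The projection `𝒪/ab → 𝒪/a`. -/
def projQuot (a b : 𝒪[F]) : (𝒪[F] ⧸ Ideal.span {a * b}) →+* 𝒪[F] ⧸ Ideal.span {a} :=
  Ideal.Quotient.factor ((Ideal.span_singleton_le_span_singleton).mpr (dvd_mul_right a b))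

lemma projQuot_mk (a b x : 𝒪[F]) :
    projQuot a b (Ideal.Quotient.mk _ x) = Ideal.Quotient.mk _ x := rfl

lemma projQuot_surjective (a b : 𝒪[F]) : Function.Surjective (projQuot a b) :=
  Ideal.Quotient.factor_surjective _

/-- Exactness in the middle of `𝒪/b → 𝒪/ab → 𝒪/a`; fibre sizes and multiplicativity of the norm come
from it. -/
lemma range_mulQuot (a b : 𝒪[F]) :
    (mulQuot a b).range = (projQuot a b).toAddMonoidHom.ker := by
  ext x
  obtain ⟨x, rfl⟩ := Ideal.Quotient.mk_surjective x
  rw [AddMonoidHom.mem_ker]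
  change _ ↔ Ideal.Quotient.mk (Ideal.span {a}) x = 0
  rw [Ideal.Quotient.eq_zero_iff_mem, Ideal.mem_span_singleton']
  constructor
  · rintro ⟨y, hy⟩
    obtain ⟨y, rfl⟩ := Ideal.Quotient.mk_surjective y
    rw [mulQuot_mk, Ideal.Quotient.eq, Ideal.mem_span_singleton'] at hy
    obtain ⟨z, hz⟩ := hy
    exact ⟨y - z * b, by linear_combination -hz⟩
  · rintro ⟨y, rfl⟩
    exact ⟨Ideal.Quotient.mk _ y, by rw [mulQuot_mk, mul_comm a y]⟩

lemma card_fiber_projQuot {a : 𝒪[F]} (ha : a ≠ 0) (b : 𝒪[F]) (y : 𝒪[F] ⧸ Ideal.span {a}) :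
    Nat.card {x // projQuot a b x = y} = Nat.card (𝒪[F] ⧸ Ideal.span {b}) := by
  obtain ⟨y, rfl⟩ := projQuot_surjective a b y
  have h1 : Nat.card (𝒪[F] ⧸ Ideal.span {b}) = Nat.card (mulQuot a b).range :=
    Nat.card_congr ((AddMonoidHom.ofInjective (mulQuot_injective ha b)).toEquiv)
  rw [h1, range_mulQuot]
  refine Nat.card_congr ⟨fun x => ⟨x.1 - y, ?_⟩, fun x => ⟨x.1 + y, ?_⟩, ?_, ?_⟩
  · rw [AddMonoidHom.mem_ker]
    simp [x.2]
  · have := x.2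
    rw [AddMonoidHom.mem_ker] at this
    rw [map_add, show projQuot a b x.1 = 0 from this, zero_add]
  · intro x; simp
  · intro x; exact Subtype.ext (by simp)

lemma card_quotient_mul {a b : 𝒪[F]} (ha : a ≠ 0) (hb : b ≠ 0) :
    Nat.card (𝒪[F] ⧸ Ideal.span {a * b}) =
      Nat.card (𝒪[F] ⧸ Ideal.span {a}) * Nat.card (𝒪[F] ⧸ Ideal.span {b}) := by
  have := finite_quotient_span ha
  have := finite_quotient_span (mul_ne_zero ha hb)
  have := Fintype.ofFinite (𝒪[F] ⧸ Ideal.span {a})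
  rw [Nat.card_congr (Equiv.sigmaFiberEquiv (projQuot a b)).symm, Nat.card_sigma]
  simp [card_fiber_projQuot ha b]

lemma card_quotient_pow {f : 𝒪[F]} (hf : f ≠ 0) (M : ℕ) :
    Nat.card (𝒪[F] ⧸ Ideal.span {f ^ M}) = idealNorm (Ideal.span {f}) ^ M := by
  induction M with
  | zero =>
    rw [pow_zero, pow_zero, Ideal.span_singleton_one, Nat.card_eq_one_iff_unique]
    exact ⟨Ideal.Quotient.subsingleton_iff.mpr rfl, ⟨0⟩⟩
  | succ M ih => rw [pow_succ, card_quotient_mul (pow_ne_zero _ hf) hf, ih, pow_succ]; rfl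

lemma one_lt_residueCard : 1 < residueCard F := by
  have : Finite 𝓀[F] := inferInstance
  exact Finite.one_lt_card

lemma normAbs_mul (x y : F) : normAbs (x * y) = normAbs x * normAbs y := by
  simp [normAbs]

lemma normAbs_one : normAbs (1 : F) = 1 := by simp [normAbs]

lemma normAbs_pos {x : F} (hx : x ≠ 0) : 0 < normAbs x := by
  have : (0 : ℝ≥0) < WithZeroMulInt.toNNReal (residueCard_ne_zero (F := F))
      (IsNonarchimedeanLocalField.valueGroupWithZeroIsoInt F (valuation F x)) :=
    WithZeroMulInt.toNNReal_pos _ (by simpa using hx)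
  exact_mod_cast this

lemma one_lt_residueCard_nnreal : (1 : ℝ≥0) < residueCard F := by
  exact_mod_cast one_lt_residueCard

lemma normAbs_lt_one {x : F} (hx : valuation F x < 1) : normAbs x < 1 := by
  have : WithZeroMulInt.toNNReal (residueCard_ne_zero (F := F))
      (IsNonarchimedeanLocalField.valueGroupWithZeroIsoInt F (valuation F x)) < 1 := by
    rw [WithZeroMulInt.toNNReal_lt_one_iff one_lt_residueCard_nnreal]
    rwa [← map_one (IsNonarchimedeanLocalField.valueGroupWithZeroIsoInt F), map_lt_map_iff]
  exact_mod_cast this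

lemma exists_normAbs_eq {x : F} (hx : x ≠ 0) : ∃ k : ℤ, normAbs x = (residueCard F : ℝ) ^ (-k) := by
  have h : IsNonarchimedeanLocalField.valueGroupWithZeroIsoInt F (valuation F x) ≠ 0 := by
    simpa using hx
  refine ⟨-(WithZero.unzero h).toAdd, ?_⟩
  rw [normAbs, WithZeroMulInt.toNNReal_neg_apply _ h]
  simp

/-- The homomorphism `𝒪ˣ → Fˣ`. -/
abbrev intUnits : 𝒪[F]ˣ →* Fˣ := Units.map (algebraMap 𝒪[F] F).toMonoidHom

lemma normAbs_intUnits (u : 𝒪[F]ˣ) : normAbs ((intUnits u : Fˣ) : F) = 1 := by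
  have : valuation F ((u : 𝒪[F]) : F) = 1 :=
    (Valuation.integer.integers (valuation F)).valuation_unit u
  rw [normAbs]
  change ((WithZeroMulInt.toNNReal _ (IsNonarchimedeanLocalField.valueGroupWithZeroIsoInt F
    (valuation F ((u : 𝒪[F]) : F))) : ℝ≥0) : ℝ) = 1
  rw [this]; simp

/-- The homomorphism `GL_n(𝒪) → GL_n(F)`. -/
abbrev intGL (n : ℕ) : GL (Fin n) 𝒪[F] →* GL (Fin n) F :=
  GeneralLinearGroup.map (algebraMap 𝒪[F] F)

lemma intGL_apply {n : ℕ} (k : GL (Fin n) 𝒪[F]) (i j : Fin n) :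
    intGL n k i j = (k i j : F) := rfl

lemma det_intGL {n : ℕ} (k : GL (Fin n) 𝒪[F]) :
    GeneralLinearGroup.det (intGL n k) = intUnits (GeneralLinearGroup.det k) := by
  ext
  simp [RingHom.map_det]

lemma intGL_injective (n : ℕ) : Function.Injective (intGL (F := F) n) := by
  intro a b h
  ext i j
  exact congrArg Subtype.val (Subtype.val_injective ((GeneralLinearGroup.ext_iff _ _).mp h i j))

/-- An element of `GL_n(F)` with integral entries and unit determinant comes from `GL_n(𝒪)`. -/
lemma exists_intGL_eq {n : ℕ} (g : GL (Fin n) F) (hg : ∀ i j, g i j ∈ 𝒪[F]) (u : 𝒪[F]ˣ)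
    (hu : GeneralLinearGroup.det g = intUnits u) : ∃ k, intGL n k = g := by
  let M : Matrix (Fin n) (Fin n) 𝒪[F] := Matrix.of fun i j => ⟨g i j, hg i j⟩
  have hM : M.det = u := by
    apply Subtype.val_injective
    have h1 : ((M.det : 𝒪[F]) : F) = (M.map (algebraMap 𝒪[F] F)).det :=
      RingHom.map_det (algebraMap 𝒪[F] F) M
    have h2 : M.map (algebraMap 𝒪[F] F) = g.val := by ext i j; rfl
    rw [h1, h2]
    exact congrArg Units.val hu
  refine ⟨GeneralLinearGroup.mk'' M (hM ▸ u.isUnit), ?_⟩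
  ext i j
  rfl

lemma mem_maxCompact_iff {n : ℕ} (g : GL (Fin n) F) :
    g ∈ maxCompact n F ↔ (∀ i j, g i j ∈ 𝒪[F]) ∧ ∀ i j, g⁻¹ i j ∈ 𝒪[F] := by
  constructor
  · rintro ⟨k, rfl⟩
    refine ⟨fun i j => (k i j).2, fun i j => ?_⟩
    rw [← map_inv]
    exact (k⁻¹ i j).2
  · rintro ⟨h1, h2⟩
    let M : Matrix (Fin n) (Fin n) 𝒪[F] := Matrix.of fun i j => ⟨g i j, h1 i j⟩
    let N : Matrix (Fin n) (Fin n) 𝒪[F] := Matrix.of fun i j => ⟨g⁻¹ i j, h2 i j⟩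
    have hinj : Function.Injective ((algebraMap 𝒪[F] F).mapMatrix (m := Fin n)) :=
      Matrix.map_injective Subtype.val_injective
    have hM : (algebraMap 𝒪[F] F).mapMatrix M = g.val := by ext i j; rfl
    have hN : (algebraMap 𝒪[F] F).mapMatrix N = (g⁻¹).val := by ext i j; rfl
    refine ⟨⟨M, N, hinj ?_, hinj ?_⟩, ?_⟩
    · rw [map_mul, hM, hN, map_one, Units.mul_inv]
    · rw [map_mul, hM, hN, map_one, Units.inv_mul]
    · ext i j; rfl

/-- A non-unit `f` is divisible by a uniformizer, so its powers clear any denominator. The bound is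
stated for all large `M` so that several thresholds can be combined. -/
lemma exists_pow_mul_mem {f : 𝒪[F]} (hf1 : ¬ IsUnit f) (x : F) :
    ∃ c : ℕ, ∀ M ≥ c, (f : F) ^ M * x ∈ 𝒪[F] := by
  rcases mem_integer_or_inv x with hx | ⟨y, hy, hyx⟩
  · exact ⟨0, fun M _ => mul_mem (pow_mem f.2 M) hx⟩
  · by_cases hx : x = 0
    · exact ⟨0, fun M _ => by simp [hx, zero_mem]⟩
    have hy0 : y ≠ 0 := by rintro rfl; exact hx (by simpa using hyx.symm)
    obtain ⟨ϖ, hϖ⟩ := IsDiscreteValuationRing.exists_irreducible 𝒪[F]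
    obtain ⟨k, u, rfl⟩ := IsDiscreteValuationRing.eq_unit_mul_pow_irreducible hy0 hϖ
    have hfϖ : ϖ ∣ f := by
      rw [← Ideal.mem_span_singleton, ← hϖ.maximalIdeal_eq]
      exact (IsLocalRing.mem_maximalIdeal _).mpr hf1
    refine ⟨k, fun M hM => ?_⟩
    have h1 : (u : 𝒪[F]) * ϖ ^ k ∣ f ^ M :=
      (IsUnit.mul_left_dvd u.isUnit).mpr ((pow_dvd_pow_of_dvd hfϖ k).trans (pow_dvd_pow f hM))
    obtain ⟨z, hz⟩ := h1
    have h2 : (f : F) ^ M = x⁻¹ * z := by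
      rw [← hyx]; exact congrArg Subtype.val hz
    rw [h2, mul_comm, ← mul_assoc, mul_inv_cancel₀ hx, one_mul]
    exact z.2

/-- Conjugation by a fixed element takes small congruence subgroups into the one of level `f`. -/
lemma exists_conj_mem {m : ℕ} {f : 𝒪[F]} (hf1 : ¬ IsUnit f)
    (h : GL (Fin m) F) : ∃ M₀ : ℕ, ∀ M ≥ M₀, ∀ k ∈ congSubgroup m (Ideal.span {f ^ M}),
      ∃ k' ∈ congSubgroup m (Ideal.span {f}), h⁻¹ * intGL m k * h = intGL m k' := by
  have hex : ∀ i j a b, ∃ c : ℕ, ∀ M ≥ c, (f : F) ^ M * (h⁻¹ i j * h a b) ∈ 𝒪[F] :=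
    fun i j a b => exists_pow_mul_mem hf1 _
  choose c hc using hex
  let C := Finset.univ.sup fun p : (Fin m × Fin m) × (Fin m × Fin m) => c p.1.1 p.1.2 p.2.1 p.2.2
  -- `f^C` clears the denominators of all products `h⁻¹ i a * h b j`; the one remaining factor `f`
  -- leaves the conjugate congruent to `1` modulo `f`.
  refine ⟨C + 1, fun M hM k hk => ?_⟩
  obtain ⟨M, rfl⟩ : ∃ M', M = M' + 1 := ⟨M - 1, by omega⟩
  have hdiff : ∀ i j, ∃ z : 𝒪[F], (h⁻¹ * intGL m k * h) i j =
      (1 : Matrix (Fin m) (Fin m) F) i j + f * z := by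
    intro i j
    have h1 : (h⁻¹ * intGL m k * h) i j - (1 : Matrix (Fin m) (Fin m) F) i j =
        ∑ a, ∑ b, (h⁻¹ i a * h b j) * (intGL m k a b - (1 : Matrix (Fin m) (Fin m) F) a b) := by
      have h2 : (h⁻¹ * intGL m k * h).val - 1 = (h⁻¹).val * ((intGL m k).val - 1) * h.val := by
        rw [mul_sub, sub_mul, mul_one, Units.inv_mul]; rfl
      have h3 := congrFun (congrFun h2 i) j
      rw [Matrix.sub_apply] at h3
      rw [h3, Matrix.mul_assoc, Matrix.mul_apply]
      refine Finset.sum_congr rfl fun a _ => ?_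
      rw [Matrix.mul_apply, Finset.mul_sum]
      refine Finset.sum_congr rfl fun b _ => ?_
      rw [Matrix.sub_apply]; ring
    have h4 : ∀ a b, ∃ z : 𝒪[F], (h⁻¹ i a * h b j) *
        (intGL m k a b - (1 : Matrix (Fin m) (Fin m) F) a b) = f * z := by
      intro a b
      obtain ⟨y, hy⟩ := Ideal.mem_span_singleton'.mp (mem_congSubgroup.mp hk a b)
      have hy' : (y : F) * (f : F) ^ (M + 1) =
          intGL m k a b - (1 : Matrix (Fin m) (Fin m) F) a b := by
        have := congrArg (Subtype.val : 𝒪[F] → F) hy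
        simp only [Matrix.one_apply] at this ⊢
        rw [intGL_apply]
        split_ifs at this ⊢ <;> simpa using this
      have hcM : c i a b j ≤ M := by
        have : c i a b j ≤ C := Finset.le_sup (f := fun p : (Fin m × Fin m) × (Fin m × Fin m) =>
          c p.1.1 p.1.2 p.2.1 p.2.2) (Finset.mem_univ ((i, a), (b, j)))
        omega
      refine ⟨y * ⟨_, hc i a b j M hcM⟩, ?_⟩
      rw [← hy']
      change _ = (f : F) * ((y : F) * ((f : F) ^ M * (h⁻¹ i a * h b j)))
      ring
    choose z hz using h4
    refine ⟨∑ a, ∑ b, z a b, ?_⟩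
    rw [← sub_eq_iff_eq_add', h1]
    push_cast
    rw [Finset.mul_sum]
    refine Finset.sum_congr rfl fun a _ => ?_
    rw [Finset.mul_sum]
    refine Finset.sum_congr rfl fun b _ => ?_
    have := hz a b
    push_cast at this
    exact this
  have hint : ∀ i j, (h⁻¹ * intGL m k * h) i j ∈ 𝒪[F] := by
    intro i j
    obtain ⟨z, hz⟩ := hdiff i j
    rw [hz, Matrix.one_apply]
    exact add_mem (by split_ifs <;> simp [one_mem, zero_mem]) (mul_mem f.2 z.2)
  obtain ⟨k', hk'⟩ := exists_intGL_eq (h⁻¹ * intGL m k * h) hint (GeneralLinearGroup.det k) (by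
    rw [map_mul, map_mul, map_inv, mul_comm, mul_inv_cancel_left, det_intGL])
  refine ⟨k', mem_congSubgroup.mpr fun i j => ?_, hk'.symm⟩
  obtain ⟨z, hz⟩ := hdiff i j
  rw [← hk', intGL_apply] at hz
  rw [Ideal.mem_span_singleton']
  refine ⟨z, Subtype.val_injective ?_⟩
  simp only [Matrix.one_apply] at hz ⊢
  split_ifs at hz ⊢ <;> push_cast <;> linear_combination -hz

/-! ### Whittaker functions -/

section Whittaker

lemma addChar_sum {ι : Type*} (ψ : AddChar F ℂ) (s : Finset ι) (x : ι → F) :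
    ψ (∑ i ∈ s, x i) = ∏ i ∈ s, ψ (x i) := by
  classical
  induction s using Finset.induction_on with
  | empty => simp
  | insert a s ha ih =>
    rw [Finset.sum_insert ha, Finset.prod_insert ha, AddChar.map_add_eq_mul, ih]

variable {n : ℕ}

lemma colUnip_mem_unipotent (y : Fin n → F) : colUnip y ∈ unipotent (n + 1) F := by
  refine ⟨fun i j hij => ?_, fun i => ?_⟩
  · induction i using Fin.lastCases with
    | last =>
      induction j using Fin.lastCases with
      | last => exact absurd hij (lt_irrefl _)
      | cast j => simp
    | cast i =>
      induction j using Fin.lastCases with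
      | last => exact absurd hij (not_lt.mpr (Fin.le_last _))
      | cast j => simp [(Fin.castSucc_lt_castSucc_iff.mp hij).ne']
  · induction i using Fin.lastCases <;> simp

lemma unipotentChar_succ (ψ : AddChar F ℂ) (u : GL (Fin (n + 2)) F) :
    unipotentChar ψ u = ∏ i : Fin (n + 1), ψ (u i.castSucc i.succ) := by
  rw [unipotentChar, Fin.prod_univ_castSucc]
  simp only [Fin.val_last, lt_irrefl, dif_neg, not_false_eq_true, mul_one, Fin.val_castSucc]
  refine Finset.prod_congr rfl fun i _ => ?_
  rw [dif_pos (by omega)]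
  rfl

lemma unipotentChar_colUnip (ψ : AddChar F ℂ) (y : Fin (n + 1) → F) :
    unipotentChar ψ (colUnip y) = ψ (y (Fin.last n)) := by
  rw [unipotentChar_succ, Fin.prod_univ_castSucc]
  have : ∀ i : Fin n, colUnip y i.castSucc.castSucc i.castSucc.succ = 0 := fun i => by
    rw [← Fin.castSucc_succ, colUnip_castSucc_castSucc,
      Matrix.one_apply_ne (Fin.castSucc_lt_succ).ne]
  simp [this, Fin.succ_last]

lemma embedHom_mem_unipotent {u : GL (Fin n) F} (hu : u ∈ unipotent n F) :
    embedHom n F u ∈ unipotent (n + 1) F := by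
  refine ⟨fun i j hij => ?_, fun i => ?_⟩
  · induction i using Fin.lastCases with
    | last =>
      induction j using Fin.lastCases with
      | last => exact absurd hij (lt_irrefl _)
      | cast j => simp
    | cast i =>
      induction j using Fin.lastCases with
      | last => simp
      | cast j =>
        rw [embedHom_castSucc_castSucc]
        exact hu.1 i j (Fin.castSucc_lt_castSucc_iff.mp hij)
  · induction i using Fin.lastCases with
    | last => simp
    | cast i => rw [embedHom_castSucc_castSucc]; exact hu.2 i

/-- The only new superdiagonal entry is zero. Hence restricting along `embedHom` preserves Whittaker
functions, as the induction on the rank needs. -/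
lemma unipotentChar_embedHom (ψ : AddChar F ℂ) (u : GL (Fin n) F) :
    unipotentChar ψ (embedHom n F u) = unipotentChar ψ u := by
  cases n with
  | zero => simp [unipotentChar]
  | succ n =>
    rw [unipotentChar_succ, Fin.prod_univ_castSucc]
    cases n with
    | zero =>
      have : embedHom 1 F u 0 1 = 0 := embedHom_castSucc_last u 0
      simp [unipotentChar, this]
    | succ n =>
      rw [unipotentChar_succ]
      simp [← Fin.castSucc_succ, Fin.succ_last]

lemma unipotentChar_inv_mul (ψ : AddChar F ℂ) (u : GL (Fin n) F) :
    unipotentChar ψ⁻¹ u * unipotentChar ψ u = 1 := by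
  rw [unipotentChar, unipotentChar, ← Finset.prod_mul_distrib]
  refine Finset.prod_eq_one fun i _ => ?_
  split_ifs with h
  · rw [AddChar.inv_apply, ← AddChar.map_add_eq_mul, neg_add_cancel, AddChar.map_zero_eq_one]
  · rw [one_mul]

lemma det_unipotent {u : GL (Fin n) F} (hu : u ∈ unipotent n F) :
    GeneralLinearGroup.det u = 1 := by
  ext
  rw [GeneralLinearGroup.val_det_apply, Matrix.det_of_isUpperTriangular (fun i j h => hu.1 i j h)]
  simp [hu.2]

lemma IsWhittaker.embedHom {ψ : AddChar F ℂ} {w : GL (Fin (n + 1)) F → ℂ} (hw : IsWhittaker ψ w) :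
    IsWhittaker ψ fun g => w (embedHom n F g) := fun u hu g => by
  simp only [map_mul]
  rw [hw _ (embedHom_mem_unipotent hu), unipotentChar_embedHom]

lemma IsIwahoriInvariant.mul_intGL {w : GL (Fin n) F → ℂ} (hw : IsIwahoriInvariant w)
    (g : GL (Fin n) F) {k : GL (Fin n) 𝒪[F]} (hk : ∀ i j : Fin n, j < i → k i j ∈ 𝓂[F]) :
    w (g * intGL n k) = w g := hw g k hk

lemma embedHom_lower_mem {k : GL (Fin n) 𝒪[F]} (hk : ∀ i j : Fin n, j < i → k i j ∈ 𝓂[F])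
    (i j : Fin (n + 1)) (hij : j < i) : embedHom n 𝒪[F] k i j ∈ 𝓂[F] := by
  induction i using Fin.lastCases with
  | last =>
    induction j using Fin.lastCases with
    | last => exact absurd hij (lt_irrefl _)
    | cast j => simp
  | cast i =>
    induction j using Fin.lastCases with
    | last => simp
    | cast j =>
      rw [embedHom_castSucc_castSucc]
      exact hk i j (Fin.castSucc_lt_castSucc_iff.mp hij)

lemma IsIwahoriInvariant.embedHom {w : GL (Fin (n + 1)) F → ℂ} (hw : IsIwahoriInvariant w) :
    IsIwahoriInvariant fun g => w (embedHom n F g) := fun g k hk => by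
  simp only [map_mul, ← map_embedHom]
  exact hw _ _ (embedHom_lower_mem hk)

lemma mem_maximalIdeal_of_mem_congSubgroup {f : 𝒪[F]} (hf1 : ¬ IsUnit f) {k : GL (Fin n) 𝒪[F]}
    (hk : k ∈ congSubgroup n (Ideal.span {f})) (i j : Fin n) (hij : j < i) : k i j ∈ 𝓂[F] := by
  have := mem_congSubgroup.mp hk i j
  rw [Matrix.one_apply_ne hij.ne', sub_zero] at this
  exact (Ideal.span_singleton_le_iff_mem _).mpr ((IsLocalRing.mem_maximalIdeal _).mpr hf1) this

lemma diagGL_lower_mem (t : Fin n → 𝒪[F]ˣ) (i j : Fin n) (hij : j < i) :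
    diagGL n 𝒪[F] t i j ∈ 𝓂[F] := by
  rw [diagGL_apply, if_neg hij.ne']; exact zero_mem _

end Whittaker

/-! ### The integrand -/

section Integrand

variable {n : ℕ} {ψ : AddChar F ℂ} {w : GL (Fin (n + 1)) F → ℂ} {v : GL (Fin n) F → ℂ}
  {χ : Fˣ →* ℂˣ} {f : 𝒪[F]} (s : ℂ)

/-- The characters from `w` and `v` are mutually inverse, and unipotent matrices have determinant
one. -/
lemma integrand_unipotent_mul (hw : IsWhittaker ψ w) (hv : IsWhittaker ψ⁻¹ v) (f : Fˣ)
    {u : GL (Fin n) F} (hu : u ∈ unipotent n F) (g : GL (Fin n) F) :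
    integrand w v χ f s (u * g) = integrand w v χ f s g := by
  rw [integrand, integrand, embed_eq_embedHom, embed_eq_embedHom, map_mul, map_mul,
      mul_assoc (embedHom n F u),
    hw _ (embedHom_mem_unipotent hu), hv _ hu, unipotentChar_embedHom, map_mul, det_unipotent hu,
    one_mul, mul_mul_mul_comm, mul_comm (unipotentChar ψ u), unipotentChar_inv_mul, one_mul,
        map_one, one_mul]

lemma chi_det_eq_one (hf : IsCondOf χ (Ideal.span {f})) {k : GL (Fin n) 𝒪[F]}
    (hk : k ∈ congSubgroup n (Ideal.span {f})) :
    χ (GeneralLinearGroup.det (intGL n k)) = 1 := by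
  rw [det_intGL]
  apply hf.1
  rw [← Ideal.Quotient.eq, map_one, GeneralLinearGroup.val_det_apply, RingHom.map_det]
  have h1 := congrArg Units.val ((MonoidHom.mem_ker).mp hk)
  change (GeneralLinearGroup.map (Ideal.Quotient.mk (Ideal.span {f})) k).val.det = 1
  rw [h1]; simp

/-- The integrand is right invariant under a congruence subgroup. -/
lemma exists_integrand_mul_intGL (hwI : IsIwahoriInvariant w) (hvI : IsIwahoriInvariant v)
    (hf0 : (f : F) ≠ 0) (hf : IsCondOf χ (Ideal.span {f})) (hf1 : ¬ IsUnit f) :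
    ∃ M₀ : ℕ, ∀ M ≥ M₀, ∀ g, ∀ k ∈ congSubgroup n (Ideal.span {f ^ M}),
      integrand w v χ (Units.mk0 (f : F) hf0) s (g * intGL n k) =
        integrand w v χ (Units.mk0 (f : F) hf0) s g := by
  obtain ⟨M₀, hM₀⟩ := exists_conj_mem hf1 (hConj n (Units.mk0 (f : F) hf0))
  -- `M₀` controls the conjugate by `h^{(f)}` inside `w`. The additional `1` ensures `f ∣ f^M`,
  -- which is what `v` and `χ ∘ det` require.
  refine ⟨M₀ + 1, fun M hM g k hk => ?_⟩
  have hk1 : k ∈ congSubgroup n (Ideal.span {f}) :=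
    congSubgroup_mono (Ideal.span_singleton_le_span_singleton.mpr
      (dvd_pow_self f (by omega))) hk
  obtain ⟨k', hk', hkk'⟩ := hM₀ M (by omega) _ (embedHom_mem_congSubgroup hk)
  have h1 : embedHom n F (g * intGL n k) * hConj n (Units.mk0 (f : F) hf0) =
      embedHom n F g * hConj n (Units.mk0 (f : F) hf0) * intGL (n + 1) k' := by
    rw [← hkk', map_mul, ← map_embedHom]; group
  have h2 : normAbs ((GeneralLinearGroup.det (g * intGL n k) : Fˣ) : F) =
      normAbs ((GeneralLinearGroup.det g : Fˣ) : F) := by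
    rw [map_mul, det_intGL, Units.val_mul, normAbs_mul, normAbs_intUnits, mul_one]
  rw [integrand, integrand, embed_eq_embedHom, embed_eq_embedHom, h1, h2,
    hwI.mul_intGL _ (mem_maximalIdeal_of_mem_congSubgroup hf1 hk'),
    hvI.mul_intGL _ (mem_maximalIdeal_of_mem_congSubgroup hf1 hk1), map_mul, map_mul,
    chi_det_eq_one hf hk1, mul_one]

end Integrand

/-! ### Behaviour of the integrand under the integral torus and under the matrix `(f^{i-j})` -/

section Recursion

variable {n : ℕ} {ψ : AddChar F ℂ} {χ : Fˣ →* ℂˣ} (s : ℂ)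

/-- Right translation of the integrand by the integral torus. -/
lemma integrand_mul_diagGL {w : GL (Fin (n + 2)) F → ℂ} {v : GL (Fin (n + 1)) F → ℂ}
    (hw : IsWhittaker ψ w) (hwI : IsIwahoriInvariant w) (hvI : IsIwahoriInvariant v)
    (f : Fˣ) (g : GL (Fin (n + 1)) F) (t : Fin (n + 1) → 𝒪[F]ˣ) :
    integrand w v χ f s (g * intGL _ (diagGL (n + 1) 𝒪[F] t)) =
      (∏ i, (χ (intUnits (t i)) : ℂ)) *
        ψ (∑ i, g (Fin.last n) i * ((t i - 1 : F) * hCol (n + 1) f i)) *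
        integrand w v χ f s g := by
  -- The torus element leaves on the right with its entries reversed, where the Iwahori invariance
  -- of `w` absorbs it. The column leaves on the left, and `ψ` sees only its last entry, which
  -- involves only the last row of `g`.
  have h1 : embedHom (n + 1) F (g * intGL _ (diagGL (n + 1) 𝒪[F] t)) * hConj (n + 1) f =
      colUnip (g.val *ᵥ fun i => ((t i - 1 : F) * hCol (n + 1) f i)) *
        (embedHom (n + 1) F g * hConj (n + 1) f) *
        intGL _ (embedHom (n + 1) 𝒪[F] (diagGL (n + 1) 𝒪[F] fun i => t i.rev)) := by
    rw [map_mul, intGL, map_diagGL, mul_assoc, embedHom_diagGL_mul_hConj, ← mul_assoc, ← mul_assoc,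
      embedHom_mul_colUnip, map_embedHom, map_diagGL]
    simp only [mul_assoc]
    rfl
  have h2 : normAbs ((GeneralLinearGroup.det (g * intGL _ (diagGL (n + 1) 𝒪[F] t)) : Fˣ) : F) =
      normAbs ((GeneralLinearGroup.det g : Fˣ) : F) := by
    rw [map_mul, det_intGL, Units.val_mul, normAbs_mul, normAbs_intUnits, mul_one]
  rw [integrand, integrand, embed_eq_embedHom, embed_eq_embedHom, h1, h2,
    hwI.mul_intGL _ (embedHom_lower_mem (diagGL_lower_mem _)), hw _ (colUnip_mem_unipotent _),
        unipotentChar_colUnip,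
    hvI.mul_intGL _ (diagGL_lower_mem t), map_mul, map_mul, det_intGL, det_diagGL, map_prod,
    map_prod, Units.val_mul, Units.coe_prod]
  simp only [Matrix.mulVec, dotProduct]
  ring

/-- The recursion from `n + 1` to `n`. -/
lemma integrand_embedHom_mul_lowerGL {w : GL (Fin (n + 2)) F → ℂ} {v : GL (Fin (n + 1)) F → ℂ}
    (hw : IsWhittaker ψ w) (hwI : IsIwahoriInvariant w) (hvI : IsIwahoriInvariant v)
    {f : 𝒪[F]} (hf0 : (f : F) ≠ 0) (hf1 : ¬ IsUnit f) (g : GL (Fin n) F)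
    (t : Fin (n + 1) → 𝒪[F]ˣ) :
    integrand w v χ (Units.mk0 (f : F) hf0) s
        (embedHom n F g * intGL _ (lowerGL (n + 1) f * diagGL (n + 1) 𝒪[F] t)) =
      (∏ i, (χ (intUnits (t i)) : ℂ) * ψ ((t i : F) / f)) *
        integrand (fun g => w (embedHom (n + 1) F g)) (fun g => v (embedHom n F g)) χ
          (Units.mk0 (f : F) hf0) s g := by
  set f' := Units.mk0 (f : F) hf0 with hf'
  have hlow : ∀ i j, j < i → lowerGL (n + 1) f i j ∈ 𝓂[F] := by
    intro i j hij
    rw [lowerGL_apply, if_pos hij.le]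
    exact Ideal.pow_mem_of_mem _ ((IsLocalRing.mem_maximalIdeal _).mpr hf1) _
      (Nat.sub_pos_of_lt hij)
  have hL : intGL (n + 1) (lowerGL (n + 1) f) = lowerGL (n + 1) (f' : F) := map_lowerGL _ _
  -- The last row `f^{n-i}` of the lower triangular matrix against the column `f^{i-n-1}`: every
  -- product is `1/f`, the argument scale in the Gauss sum.
  have hrow : ∀ i, (embedHom n F g * lowerGL (n + 1) (f' : F)) (Fin.last n) i *
      hCol (n + 1) f' i = (f : F)⁻¹ := by
    intro i
    have : (embedHom n F g * lowerGL (n + 1) (f' : F)) (Fin.last n) i =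
        (f : F) ^ (n - (i : ℕ)) := by
      rw [Units.val_mul, Matrix.mul_apply, Fin.sum_univ_castSucc]
      simp [lowerGL_apply, Fin.le_last, hf']
    rw [this, hCol, ← zpow_natCast]
    change (f : F) ^ _ * (f : F) ^ _ = _
    rw [← zpow_add₀ hf0, ← _root_.zpow_neg_one]
    congr 1
    have := i.2
    omega
  rw [map_mul, ← mul_assoc, integrand_mul_diagGL s hw hwI hvI, hL]
  have h1 : ∀ i, (embedHom n F g * lowerGL (n + 1) (f' : F)) (Fin.last n) i *
      ((t i - 1 : F) * hCol (n + 1) f' i) = (t i : F) / f - 1 / f := by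
    intro i
    rw [mul_left_comm, hrow]; ring
  have h2 : embedHom (n + 1) F (embedHom n F g * lowerGL (n + 1) (f' : F)) * hConj (n + 1) f' =
      colUnip ((embedHom n F g * lowerGL (n + 1) (f' : F)).val *ᵥ hCol (n + 1) f') *
        embedHom (n + 1) F (embedHom n F g * hConj n f') *
        intGL _ (embedHom (n + 1) 𝒪[F] (signDiag n 𝒪[F] * lowerGL (n + 1) f)) := by
    have h3 : intGL (n + 1) (signDiag n 𝒪[F]) = signDiag n F := by
      rw [signDiag, intGL, map_diagGL, signDiag]
      congr 1; ext i
      split_ifs <;> simp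
    rw [map_mul, mul_assoc, embedHom_lowerGL_mul_hConj, map_embedHom,
      map_mul (intGL (n + 1)), h3, hL, ← mul_assoc, ← mul_assoc, embedHom_mul_colUnip,
          Matrix.mulVec_mulVec,
      map_mul, ← Units.val_mul]
    simp only [mul_assoc, map_mul]
  have h4 : ∀ i j, j < i → (signDiag n 𝒪[F] * lowerGL (n + 1) f) i j ∈ 𝓂[F] := by
    intro i j hij
    rw [signDiag, diagGL_mul_apply]
    exact Ideal.mul_mem_left _ _ (hlow i j hij)
  -- The torus formula gives `ψ((t_i - 1)/f)`, and the column split off by the recursion for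
  -- `h^{(f)}` supplies the missing `ψ(1/f)`.
  have h5 : ψ (∑ i : Fin (n + 1), ((t i : F) / f - 1 / f)) * ψ (∑ _i : Fin (n + 1), 1 / (f : F)) =
      ∏ i, ψ ((t i : F) / f) := by
    rw [← AddChar.map_add_eq_mul, ← Finset.sum_add_distrib, addChar_sum]
    simp
  have h6 : (∏ i, (χ (intUnits (t i)) : ℂ) * ψ ((t i : F) / f)) =
      (∏ i, (χ (intUnits (t i)) : ℂ)) * (ψ (∑ i : Fin (n + 1), ((t i : F) / f - 1 / f)) *
        ψ (∑ _i : Fin (n + 1), 1 / (f : F))) := by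
    rw [h5, Finset.prod_mul_distrib]
  have h7 : ((embedHom n F g * lowerGL (n + 1) (f' : F)).val *ᵥ hCol (n + 1) f') (Fin.last n) =
      ∑ _i : Fin (n + 1), 1 / (f : F) := by
    simp only [Matrix.mulVec, dotProduct, hrow, one_div]
  have h8 : v (embedHom n F g * lowerGL (n + 1) (f' : F)) = v (embedHom n F g) := by
    rw [← hL]; exact hvI.mul_intGL _ hlow
  simp only [h1]
  rw [integrand, integrand, embed_eq_embedHom, embed_eq_embedHom, h2,
      hwI.mul_intGL _ (embedHom_lower_mem h4),
    hw _ (colUnip_mem_unipotent _), unipotentChar_colUnip, h6, h7, h8,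
    map_mul GeneralLinearGroup.det, det_lowerGL, det_embedHom, mul_one]
  ring

end Recursion

/-! ### Vanishing of averages along the torus -/

lemma addChar_eq_one {ψ : AddChar F ℂ} (hψ1 : AddCharConductorOne ψ) {x : F} (hx : x ∈ 𝒪[F]) :
    ψ x = 1 := by
  have := (hψ1 1).mpr (one_mem _) x hx
  rwa [one_mul] at this

lemma isUnit_add_of_mem {x y : 𝒪[F]} (hx : IsUnit x) (hy : y ∈ 𝓂[F]) : IsUnit (x + y) := by
  by_contra h
  have := Ideal.sub_mem _ ((IsLocalRing.mem_maximalIdeal _).mpr h) hy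
  rw [add_sub_cancel_right] at this
  exact (IsLocalRing.mem_maximalIdeal _).mp this hx

/-- Translation of units by an element of the maximal ideal. -/
def unitsShift (z : 𝒪[F]) (hz : z ∈ 𝓂[F]) : 𝒪[F]ˣ ≃ 𝒪[F]ˣ where
  toFun τ := (isUnit_add_of_mem τ.isUnit hz).unit
  invFun τ := (isUnit_add_of_mem τ.isUnit (neg_mem hz)).unit
  left_inv τ := by ext; simp
  right_inv τ := by ext; simp

lemma unitsShift_val (z : 𝒪[F]) (hz : z ∈ 𝓂[F]) (τ : 𝒪[F]ˣ) :
    ((unitsShift z hz τ : 𝒪[F]ˣ) : 𝒪[F]) = τ + z := rfl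

lemma inv_mul_mem_congUnits {I : Ideal 𝒪[F]} (a b : 𝒪[F]ˣ) :
    a⁻¹ * b ∈ congUnits I ↔ (b : 𝒪[F]) - a ∈ I := by
  rw [mem_congUnits]
  have h : (b : 𝒪[F]) - a = a * ((a⁻¹ * b : 𝒪[F]ˣ) - 1) := by
    rw [mul_sub, ← Units.val_mul, mul_inv_cancel_left, mul_one]
  rw [h]
  exact (Ideal.unit_mul_mem_iff_mem _ a.isUnit).symm

/-- If `χ` has conductor `f𝒪` and `cf` is not a unit then `τ ↦ χ(τ) ψ(cτ)` averages to zero. -/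
lemma cosetAvg_chi_psi_eq_zero {ψ : AddChar F ℂ} (hψ1 : AddCharConductorOne ψ) {χ : Fˣ →* ℂˣ}
    {f : 𝒪[F]} (hf0 : (f : F) ≠ 0) (hf : IsCondOf χ (Ideal.span {f})) (hf1 : ¬ IsUnit f)
    (Λ : Subgroup 𝒪[F]ˣ) [Λ.FiniteIndex] {I : Ideal 𝒪[F]} (hΛ : Λ = congUnits I)
    {G : 𝒪[F]ˣ → ℂ} (hG : IsRightInv Λ G) {c : F} {C : ℂ}
    (hGc : ∀ τ, G τ = (χ (intUnits τ) : ℂ) * ψ (c * (τ - 1)) * C)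
    (hc : ∀ u : 𝒪[F]ˣ, c * f ≠ u) : cosetAvg Λ G = 0 := by
  have hfm : f ∈ 𝓂[F] := (IsLocalRing.mem_maximalIdeal _).mpr hf1
  -- If `cf` is integral it lies in `𝔭`; then `ψ(cτ)` has a smaller period than `χ` and a
  -- multiplicative shift detects the conductor of `χ`. If `cf` is not integral, an additive shift
  -- by a multiple of `f` fixes `χ` but not `ψ`.
  by_cases hcf : c * f ∈ 𝒪[F]
  · have hcfm : (⟨c * f, hcf⟩ : 𝒪[F]) ∈ 𝓂[F] := by
      rw [IsLocalRing.mem_maximalIdeal, mem_nonunits_iff]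
      rintro ⟨u, hu⟩
      exact hc u (congrArg Subtype.val hu).symm
    obtain ⟨ϖ, hϖ⟩ := IsDiscreteValuationRing.exists_irreducible 𝒪[F]
    rw [hϖ.maximalIdeal_eq, Ideal.mem_span_singleton'] at hfm hcfm
    obtain ⟨f', hf'⟩ := hfm
    obtain ⟨c', hc'⟩ := hcfm
    have hϖ0 : (ϖ : F) ≠ 0 := fun h => hϖ.ne_zero (Subtype.val_injective h)
    have hcf' : c * f' = c' := by
      have h1 : (f' : F) * ϖ = f := congrArg Subtype.val hf'
      have h2 : (c' : F) * ϖ = c * f := congrArg Subtype.val hc'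
      apply mul_right_cancel₀ hϖ0
      rw [h2, ← h1]; ring
    -- Here `f = f'ϖ`, so `f'𝒪` strictly contains the conductor, and maximality of the conductor
    -- provides `η`. Since `cf'` is integral, replacing `τ` by `τη` leaves the `ψ` factor unchanged.
    obtain ⟨η, hη, hχη⟩ : ∃ η : 𝒪[F]ˣ, (η : 𝒪[F]) - 1 ∈ Ideal.span {f'} ∧
        χ (intUnits η) ≠ 1 := by
      by_contra! h
      have h1 : Ideal.span {f'} ≤ Ideal.span {f} := hf.2 h
      have h2 : f' ∈ Ideal.span {f} := h1 (Ideal.mem_span_singleton_self f')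
      obtain ⟨y, hy⟩ := Ideal.mem_span_singleton'.mp h2
      have hf'0 : f' ≠ 0 := by
        rintro rfl
        apply hf0
        rw [← hf']; simp
      have : y * ϖ = 1 := mul_left_cancel₀ hf'0 (by linear_combination hy + y * hf')
      exact hϖ.not_isUnit (IsUnit.of_mul_eq_one_right _ this)
    obtain ⟨z, hz⟩ := Ideal.mem_span_singleton'.mp hη
    have h1 : ∀ τ, G (τ * η) = (χ (intUnits η) : ℂ) * G τ := by
      intro τ
      have h3 : c * (((τ * η : 𝒪[F]ˣ) : 𝒪[F]) - 1 : F) =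
          c * (τ - 1) + ((τ * z * c' : 𝒪[F]) : F) := by
        have h4 : (z : F) * f' = ((η : 𝒪[F]) : F) - 1 := congrArg Subtype.val hz
        push_cast [Units.val_mul]
        linear_combination (-c * (τ : F)) * h4 + ((τ : F) * z) * hcf'
      rw [hGc, hGc, h3, AddChar.map_add_eq_mul, addChar_eq_one hψ1 (SetLike.coe_mem _), map_mul,
        map_mul, Units.val_mul]
      ring
    have hn : Λ.Normal := inferInstance
    have h2 := cosetAvg_right hG η
    simp only [h1, cosetAvg_mul_left] at h2
    have h3 : ((χ (intUnits η) : ℂ) - 1) * cosetAvg Λ G = 0 := by linear_combination h2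
    rcases mul_eq_zero.mp h3 with h4 | h4
    · exact absurd (Units.ext (sub_eq_zero.mp h4)) hχη
    · exact h4
  · obtain ⟨y, hy, hψy⟩ : ∃ y ∈ 𝒪[F], ψ (c * f * y) ≠ 1 := by
      by_contra! h
      exact hcf ((hψ1 _).mp h)
    have hz : f * ⟨y, hy⟩ ∈ 𝓂[F] := Ideal.mul_mem_right _ _ hfm
    have h1 : ∀ τ, G (unitsShift _ hz τ) = ψ (c * f * y) * G τ := by
      intro τ
      have h3 : c * ((unitsShift _ hz τ : 𝒪[F]) - 1 : F) = c * f * y + c * (τ - 1) := by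
        rw [unitsShift_val]
        push_cast
        ring
      have h4 : χ (intUnits (unitsShift _ hz τ)) = χ (intUnits τ) := by
        rw [← mul_inv_cancel_left τ (unitsShift _ hz τ), map_mul, map_mul]
        rw [hf.1 (τ⁻¹ * unitsShift _ hz τ), mul_one]
        rw [← mem_congUnits, inv_mul_mem_congUnits, unitsShift_val, add_sub_cancel_left]
        exact Ideal.mul_mem_right _ _ (Ideal.mem_span_singleton_self f)
      rw [hGc, hGc, h3, h4, AddChar.map_add_eq_mul]
      ring
    have h2 := cosetAvg_comp_equiv hG (unitsShift _ hz) fun g h => by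
      rw [hΛ, inv_mul_mem_congUnits, inv_mul_mem_congUnits, unitsShift_val, unitsShift_val,
        add_sub_add_right_eq_sub]
    simp only [h1, cosetAvg_mul_left] at h2
    have h3 : (ψ (c * f * y) - 1) * cosetAvg Λ G = 0 := by linear_combination h2
    rcases mul_eq_zero.mp h3 with h4 | h4
    · exact absurd (sub_eq_zero.mp h4) hψy
    · exact h4

/-! ### Restriction to matrices with prescribed valuations in the last row -/

section RowCondition

variable {n : ℕ}

/-- The condition that the `i`-th entry of the last row of `a κ` is `f^{n-i}` up to a unit, where
`α` is the last diagonal entry of `a`. -/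
def RowCond (f : 𝒪[F]) (α : F) (i : Fin (n + 1)) (κ : GL (Fin (n + 1)) 𝒪[F]) : Prop :=
  ∃ u : 𝒪[F]ˣ, α * κ (Fin.last n) i = (f : F) ^ (n - (i : ℕ)) * u

open Classical in
/-- The indicator function of `RowCond`. -/
def rowInd (f : 𝒪[F]) (α : F) (i : Fin (n + 1)) (κ : GL (Fin (n + 1)) 𝒪[F]) : ℂ :=
  if RowCond f α i κ then 1 else 0

lemma RowCond.mul_diagGL {f : 𝒪[F]} {α : F} {i : Fin (n + 1)} {κ : GL (Fin (n + 1)) 𝒪[F]}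
    (h : RowCond f α i κ) (t : Fin (n + 1) → 𝒪[F]ˣ) :
    RowCond f α i (κ * diagGL (n + 1) 𝒪[F] t) := by
  obtain ⟨u, hu⟩ := h
  refine ⟨u * t i, ?_⟩
  rw [mul_diagGL_apply]
  push_cast [Units.val_mul]
  rw [← mul_assoc, hu, mul_assoc]

lemma rowInd_mul_diagGL (f : 𝒪[F]) (α : F) (i : Fin (n + 1)) (κ : GL (Fin (n + 1)) 𝒪[F])
    (t : Fin (n + 1) → 𝒪[F]ˣ) :
    rowInd f α i (κ * diagGL (n + 1) 𝒪[F] t) = rowInd f α i κ := by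
  have : RowCond f α i (κ * diagGL (n + 1) 𝒪[F] t) ↔ RowCond f α i κ := by
    refine ⟨fun h => ?_, fun h => h.mul_diagGL t⟩
    have := h.mul_diagGL t⁻¹
    rwa [map_inv, mul_inv_cancel_right] at this
  by_cases h : RowCond f α i κ
  · rw [rowInd, rowInd, if_pos h, if_pos (this.mpr h)]
  · rw [rowInd, rowInd, if_neg h, if_neg (mt this.mp h)]

/-- By `hz`, a change of the entry by a multiple of `f^M` moves `α κ_{n,i}` by a multiple of
`f^{n+1} = f^{n-i} f^{i+1}`. The unit is thus shifted by an element of the maximal ideal, since `i +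
1 > 0`. -/
lemma RowCond.mul_cong {f : 𝒪[F]} (hf1 : ¬ IsUnit f) {α : F} {M : ℕ} {z : 𝒪[F]}
    (hz : α * (f : F) ^ M = (f : F) ^ (n + 1) * z) {i : Fin (n + 1)} {κ : GL (Fin (n + 1)) 𝒪[F]}
    (h : RowCond f α i κ) {k : GL (Fin (n + 1)) 𝒪[F]}
    (hk : k ∈ congSubgroup (n + 1) (Ideal.span {f ^ M})) : RowCond f α i (κ * k) := by
  obtain ⟨u, hu⟩ := h
  obtain ⟨y, hy⟩ := Ideal.mem_span_singleton'.mp (mul_mem_congSubgroup_sub κ hk (Fin.last n) i)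
  have hy' : (y : F) * (f : F) ^ M = (κ * k) (Fin.last n) i - κ (Fin.last n) i :=
    congrArg Subtype.val hy
  have hm : f ^ ((i : ℕ) + 1) * (z * y) ∈ 𝓂[F] :=
    Ideal.mul_mem_right _ _ (Ideal.pow_mem_of_mem _ ((IsLocalRing.mem_maximalIdeal _).mpr hf1) _
      (Nat.succ_pos _))
  refine ⟨unitsShift _ hm u, ?_⟩
  have h3 : ((unitsShift _ hm u : 𝒪[F]) : F) = u + (f : F) ^ ((i : ℕ) + 1) * (z * y) := by
    rw [unitsShift_val]
    push_cast
    rfl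
  rw [h3]
  have h1 : (f : F) ^ (n + 1) = (f : F) ^ (n - (i : ℕ)) * (f : F) ^ ((i : ℕ) + 1) := by
    rw [← pow_add]; congr 1; have := i.2; omega
  have h2 : ((κ * k) (Fin.last n) i : F) = κ (Fin.last n) i + y * (f : F) ^ M := by
    rw [hy']; ring
  rw [h2, mul_add, hu, mul_left_comm, hz, h1]
  ring

lemma isRightInv_rowInd {f : 𝒪[F]} (hf1 : ¬ IsUnit f) {α : F} {M : ℕ} {z : 𝒪[F]}
    (hz : α * (f : F) ^ M = (f : F) ^ (n + 1) * z) (i : Fin (n + 1)) :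
    IsRightInv (congSubgroup (n + 1) (Ideal.span {f ^ M})) (rowInd f α i) := by
  intro κ k hk
  have : RowCond f α i (κ * k) ↔ RowCond f α i κ := by
    refine ⟨fun h => ?_, fun h => h.mul_cong hf1 hz hk⟩
    have := h.mul_cong hf1 hz (inv_mem hk)
    rwa [mul_inv_cancel_right] at this
  by_cases h : RowCond f α i κ
  · rw [rowInd, rowInd, if_pos h, if_pos (this.mpr h)]
  · rw [rowInd, rowInd, if_neg h, if_neg (mt this.mp h)]

lemma isRightInv_prod {Γ ι : Type*} [Group Γ] {Λ : Subgroup Γ} (s : Finset ι) {Φ : ι → Γ → ℂ}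
    (h : ∀ i, IsRightInv Λ (Φ i)) : IsRightInv Λ fun g => ∏ i ∈ s, Φ i g :=
  fun g k hk => Finset.prod_congr rfl fun i _ => h i g k hk

/-- The average of the integrand is not changed by the restriction to the matrices with last row
in `∏ f^{n-i} 𝒪ˣ`. -/
lemma cosetAvg_mul_rowInd {ψ : AddChar F ℂ} (hψ1 : AddCharConductorOne ψ) {χ : Fˣ →* ℂˣ}
    {f : 𝒪[F]} (hf0 : (f : F) ≠ 0) (hf : IsCondOf χ (Ideal.span {f})) (hf1 : ¬ IsUnit f)
    {M : ℕ} (hfin : Finite (𝒪[F] ⧸ Ideal.span {f ^ M})) {α : F} {z : 𝒪[F]}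
    (hz : α * (f : F) ^ M = (f : F) ^ (n + 1) * z)
    {Φ : GL (Fin (n + 1)) 𝒪[F] → ℂ}
    (hΦ : IsRightInv (congSubgroup (n + 1) (Ideal.span {f ^ M})) Φ)
    (hΦt : ∀ κ (t : Fin (n + 1) → 𝒪[F]ˣ), Φ (κ * diagGL (n + 1) 𝒪[F] t) =
      (∏ i, (χ (intUnits (t i)) : ℂ)) *
        ψ (∑ i, α * κ (Fin.last n) i * ((t i - 1 : F) * (f : F) ^ ((i : ℤ) - (n + 1 : ℕ)))) * Φ κ) :
    cosetAvg (congSubgroup (n + 1) (Ideal.span {f ^ M}))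
      (fun κ => (∏ i, rowInd f α i κ) * Φ κ) =
      cosetAvg (congSubgroup (n + 1) (Ideal.span {f ^ M})) Φ := by
  classical
  -- The conditions are imposed one coordinate at a time; the part failing the new condition
  -- averages to zero.
  suffices h : ∀ S : Finset (Fin (n + 1)), cosetAvg (congSubgroup (n + 1) (Ideal.span {f ^ M}))
      (fun κ => (∏ i ∈ S, rowInd f α i κ) * Φ κ) =
      cosetAvg (congSubgroup (n + 1) (Ideal.span {f ^ M})) Φ from h Finset.univ
  intro S
  induction S using Finset.induction_on with
  | empty => simp
  | insert i S hi ih =>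
    have hzero : cosetAvg (congSubgroup (n + 1) (Ideal.span {f ^ M}))
        (fun κ => (1 - rowInd f α i κ) * ((∏ i ∈ S, rowInd f α i κ) * Φ κ)) = 0 := by
      have hS := isRightInv_prod S (isRightInv_rowInd (n := n) hf1 hz)
      have hδ : IsRightInv (congSubgroup (n + 1) (Ideal.span {f ^ M}))
          (fun κ => (1 - rowInd f α i κ) * ((∏ i ∈ S, rowInd f α i κ) * Φ κ)) :=
        IsRightInv.mul (fun g k hk => by rw [isRightInv_rowInd hf1 hz i g k hk]) (hS.mul hΦ)
      -- Average along the torus in coordinate `i` alone. The indicator functions are constant along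
      -- it and factor out, leaving a twisted sum of `χ(τ) ψ(cτ)`.
      refine cosetAvg_eq_zero_of_right hδ
        (fun τ : 𝒪[F]ˣ => diagGL (n + 1) 𝒪[F] (Pi.mulSingle i τ))
        (congUnits (Ideal.span {f ^ M})) fun κ => ?_
      simp only [rowInd_mul_diagGL]
      rw [cosetAvg_mul_left, cosetAvg_mul_left]
      by_cases hrow : RowCond f α i κ
      · rw [rowInd, if_pos hrow, sub_self, zero_mul]
      rw [cosetAvg_chi_psi_eq_zero hψ1 hf0 hf hf1 _ rfl (C := Φ κ)
        (c := α * κ (Fin.last n) i * (f : F) ^ ((i : ℤ) - (n + 1 : ℕ))), mul_zero, mul_zero]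
      · intro τ u hu
        simp only [Pi.mulSingle_mul, map_mul, ← mul_assoc]
        refine hΦ _ _ (diagGL_mem_congSubgroup fun j => ?_)
        by_cases hj : j = i
        · subst hj; simpa using hu
        · simp [hj, one_mem]
      · intro τ
        rw [hΦt]
        congr 2
        · rw [Finset.prod_eq_single i]
          · simp
          · intro j _ hj; simp [hj]
          · simp
        · congr 1
          rw [Finset.sum_eq_single i]
          · simp; ring
          · intro j _ hj; simp [hj]
          · simp
      · intro u hu
        refine hrow ⟨u, ?_⟩
        have h1 : (f : F) ^ ((i : ℤ) - (n + 1 : ℕ)) * f * (f : F) ^ (n - (i : ℕ)) = 1 := by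
          rw [← zpow_natCast, ← zpow_add_one₀ hf0, ← zpow_add₀ hf0]
          rw [← zpow_zero (f : F)]
          congr 1
          have := i.2; omega
        rw [← hu]
        linear_combination (-α * κ (Fin.last n) i) * h1
    have hsplit : cosetAvg (congSubgroup (n + 1) (Ideal.span {f ^ M}))
        (fun κ => (∏ i ∈ S, rowInd f α i κ) * Φ κ) =
        cosetAvg (congSubgroup (n + 1) (Ideal.span {f ^ M}))
          (fun κ => (∏ i ∈ insert i S, rowInd f α i κ) * Φ κ) +
        cosetAvg (congSubgroup (n + 1) (Ideal.span {f ^ M}))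
        (fun κ => (1 - rowInd f α i κ) * ((∏ i ∈ S, rowInd f α i κ) * Φ κ)) := by
      rw [← cosetAvg_add]
      congr 1; ext κ
      rw [Finset.prod_insert hi]; ring
    rw [← ih, hsplit, hzero, add_zero]

end RowCondition

/-! ### The Gauss sums -/

open Classical in
/-- The function `f^l u ↦ χ(u) ψ(u/f)` on `f^l 𝒪ˣ`, extended by zero to `𝒪`. -/
def gaussTerm (χ : Fˣ →* ℂˣ) (ψ : AddChar F ℂ) (f : 𝒪[F]) (l : ℕ) (x : 𝒪[F]) : ℂ :=
  if h : ∃ u : 𝒪[F]ˣ, x = f ^ l * u then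
    (χ (intUnits h.choose) : ℂ) * ψ ((h.choose : F) / f) else 0

section GaussTerm

variable {χ : Fˣ →* ℂˣ} {ψ : AddChar F ℂ} {f : 𝒪[F]} {l : ℕ}

lemma gaussTerm_eq (hf0 : (f : F) ≠ 0) (u : 𝒪[F]ˣ) :
    gaussTerm χ ψ f l (f ^ l * u) = (χ (intUnits u) : ℂ) * ψ ((u : F) / f) := by
  have h : ∃ u' : 𝒪[F]ˣ, f ^ l * (u : 𝒪[F]) = f ^ l * u' := ⟨u, rfl⟩
  have h1 : f ^ l ≠ 0 := pow_ne_zero _ fun h => hf0 (by rw [h]; rfl)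
  have h2 : h.choose = u := Units.ext (mul_left_cancel₀ h1 h.choose_spec).symm
  rw [gaussTerm, dif_pos h, h2]

lemma gaussTerm_eq_zero {x : 𝒪[F]} (hx : ¬ ∃ u : 𝒪[F]ˣ, x = f ^ l * u) :
    gaussTerm χ ψ f l x = 0 := by
  rw [gaussTerm, dif_neg hx]

lemma gaussTerm_pow_mul (hf0 : (f : F) ≠ 0) (x : 𝒪[F]) :
    gaussTerm χ ψ f l (f ^ l * x) = gaussTerm χ ψ f 0 x := by
  have h1 : f ^ l ≠ 0 := pow_ne_zero _ fun h => hf0 (by rw [h]; rfl)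
  by_cases hx : IsUnit x
  · obtain ⟨u, rfl⟩ := hx
    rw [gaussTerm_eq hf0, ← gaussTerm_eq (l := 0) hf0 u, pow_zero, one_mul]
  · rw [gaussTerm_eq_zero, gaussTerm_eq_zero]
    · rintro ⟨u, rfl⟩
      exact hx (by simp)
    · rintro ⟨u, hu⟩
      exact hx (mul_left_cancel₀ h1 hu ▸ u.isUnit)

/-- The function `gaussTerm` only depends on the residue class modulo `f^{l+1}`. -/
lemma gaussTerm_congr (hψ1 : AddCharConductorOne ψ) (hf0 : (f : F) ≠ 0)
    (hf : IsCondOf χ (Ideal.span {f})) (hf1 : ¬ IsUnit f) {b x y : 𝒪[F]}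
    (hxy : x - y ∈ Ideal.span {f ^ l * (f * b)}) :
    gaussTerm χ ψ f l x = gaussTerm χ ψ f l y := by
  have key : ∀ x y : 𝒪[F], x - y ∈ Ideal.span {f ^ l * (f * b)} →
      (∃ u : 𝒪[F]ˣ, y = f ^ l * u) → gaussTerm χ ψ f l x = gaussTerm χ ψ f l y := by
    rintro x y hxy ⟨u, rfl⟩
    obtain ⟨z, hz⟩ := Ideal.mem_span_singleton'.mp hxy
    have hm : f * (b * z) ∈ 𝓂[F] :=
      Ideal.mul_mem_right _ _ ((IsLocalRing.mem_maximalIdeal _).mpr hf1)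
    have hx : x = f ^ l * (unitsShift _ hm u : 𝒪[F]ˣ) := by
      rw [unitsShift_val]; linear_combination -hz
    rw [hx, gaussTerm_eq hf0, gaussTerm_eq hf0]
    congr 1
    · rw [← mul_inv_cancel_left u (unitsShift _ hm u), map_mul, map_mul,
        hf.1 (u⁻¹ * unitsShift _ hm u), mul_one]
      rw [← mem_congUnits, inv_mul_mem_congUnits, unitsShift_val, add_sub_cancel_left]
      exact Ideal.mul_mem_right _ _ (Ideal.mem_span_singleton_self f)
    · have : ((unitsShift _ hm u : 𝒪[F]) : F) / f = u / f + ((b * z : 𝒪[F]) : F) := by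
        rw [unitsShift_val]
        push_cast
        field_simp
      rw [this, AddChar.map_add_eq_mul, addChar_eq_one hψ1 (SetLike.coe_mem _), mul_one]
  by_cases hy : ∃ u : 𝒪[F]ˣ, y = f ^ l * u
  · exact key x y hxy hy
  by_cases hx : ∃ u : 𝒪[F]ˣ, x = f ^ l * u
  · exact (key y x (by rw [← neg_sub]; exact neg_mem hxy) hx).symm
  · rw [gaussTerm_eq_zero hx, gaussTerm_eq_zero hy]

/-- Terms at non-unit classes vanish, and a representative of a unit class is itself a unit because
`𝒪` is local. -/
lemma sum_gaussTerm_zero (hf0 : (f : F) ≠ 0) (hf1 : ¬ IsUnit f) :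
    ∑ᶠ x : 𝒪[F] ⧸ Ideal.span {f}, gaussTerm χ ψ f 0 x.out = gaussSum χ ψ f := by
  have hf0' : f ≠ 0 := fun h => hf0 (by rw [h]; rfl)
  have := finite_quotient_span hf0'
  have := Fintype.ofFinite (𝒪[F] ⧸ Ideal.span {f})
  have := Fintype.ofFinite (𝒪[F] ⧸ Ideal.span {f})ˣ
  rw [gaussSum, finsum_eq_sum_of_fintype, finsum_eq_sum_of_fintype]
  have htop : Ideal.span {f} ≠ ⊤ := by rwa [Ne, Ideal.span_singleton_eq_top]
  symm
  refine Fintype.sum_of_injective (fun u : (𝒪[F] ⧸ Ideal.span {f})ˣ => u.val) Units.val_injective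
    _ _
    ?_ ?_
  · intro x hx
    refine gaussTerm_eq_zero ?_
    rintro ⟨u, hu⟩
    rw [pow_zero, one_mul] at hu
    refine hx ⟨Units.map (Ideal.Quotient.mk (Ideal.span {f})).toMonoidHom u, ?_⟩
    change Ideal.Quotient.mk _ (u : 𝒪[F]) = x
    rw [← hu, Ideal.Quotient.mk_out]
  · intro x
    obtain ⟨u, hu⟩ : IsUnit (Quotient.out (x : 𝒪[F] ⧸ Ideal.span {f})) :=
      isUnit_of_isUnit_mk htop (by rw [Ideal.Quotient.mk_out]; exact x.isUnit)
    have h1 := gaussTerm_eq (χ := χ) (ψ := ψ) (l := 0) hf0 u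
    rw [pow_zero, one_mul] at h1
    rw [← hu, h1, extendZero, dif_neg]
    · congr 3
      ext
      rfl
    · exact (intUnits u).ne_zero

/-- The terms are supported on the image of multiplication by `f^l` from `𝒪/fb`; there they factor
through `𝒪/f`, with fibres of `N(b)` elements. -/
lemma sum_gaussTerm (hψ1 : AddCharConductorOne ψ) (hf0 : (f : F) ≠ 0)
    (hf : IsCondOf χ (Ideal.span {f})) (hf1 : ¬ IsUnit f) {b c : 𝒪[F]} (hb : b ≠ 0)
    (hc : c = f ^ l * (f * b)) :
    ∑ᶠ x : 𝒪[F] ⧸ Ideal.span {c}, gaussTerm χ ψ f l x.out =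
      Nat.card (𝒪[F] ⧸ Ideal.span {b}) * gaussSum χ ψ f := by
  classical
  subst hc
  have hf0' : f ≠ 0 := fun h => hf0 (by rw [h]; rfl)
  have := finite_quotient_span (mul_ne_zero (pow_ne_zero l hf0') (mul_ne_zero hf0' hb))
  have := finite_quotient_span (mul_ne_zero hf0' hb)
  have := finite_quotient_span hf0'
  have := Fintype.ofFinite (𝒪[F] ⧸ Ideal.span {f ^ l * (f * b)})
  have := Fintype.ofFinite (𝒪[F] ⧸ Ideal.span {f * b})
  have := Fintype.ofFinite (𝒪[F] ⧸ Ideal.span {f})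
  rw [← sum_gaussTerm_zero hf0 hf1, finsum_eq_sum_of_fintype, finsum_eq_sum_of_fintype]
  have h1 : ∑ x : 𝒪[F] ⧸ Ideal.span {f ^ l * (f * b)}, gaussTerm χ ψ f l x.out =
      ∑ x : 𝒪[F] ⧸ Ideal.span {f * b}, gaussTerm χ ψ f 0 x.out := by
    symm
    refine Fintype.sum_of_injective (mulQuot (f ^ l) (f * b))
      (mulQuot_injective (pow_ne_zero l hf0') _) _ _ ?_ ?_
    · intro x hx
      refine gaussTerm_eq_zero ?_
      rintro ⟨u, hu⟩
      refine hx ⟨Ideal.Quotient.mk _ (u : 𝒪[F]), ?_⟩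
      rw [mulQuot_mk, ← hu, Ideal.Quotient.mk_out]
    · intro x
      rw [← gaussTerm_pow_mul (l := l) hf0]
      refine gaussTerm_congr hψ1 hf0 hf hf1 (b := b) ?_
      rw [← Ideal.Quotient.eq, Ideal.Quotient.mk_out, ← mulQuot_mk, Ideal.Quotient.mk_out]
  have h2 : ∀ x : 𝒪[F] ⧸ Ideal.span {f * b}, gaussTerm χ ψ f 0 x.out =
      gaussTerm χ ψ f 0 (projQuot f b x).out := by
    intro x
    refine gaussTerm_congr hψ1 hf0 hf hf1 (b := 1) ?_
    rw [pow_zero, one_mul, mul_one, ← Ideal.Quotient.eq, Ideal.Quotient.mk_out, ← projQuot_mk f b,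
      Ideal.Quotient.mk_out]
  rw [h1, Finset.sum_congr rfl fun x _ => h2 x, Finset.mul_sum,
    ← Finset.sum_fiberwise Finset.univ (projQuot f b)]
  refine Finset.sum_congr rfl fun y _ => ?_
  rw [← card_fiber_projQuot hf0' b y]
  rw [Finset.sum_congr rfl (g := fun _ => gaussTerm χ ψ f 0 y.out), Finset.sum_const,
    nsmul_eq_mul, Nat.card_eq_fintype_card, Fintype.card_subtype]
  intro x hx
  rw [(Finset.mem_filter.mp hx).2]

end GaussTerm

/-! ### Vectors with a unit among their coordinates -/

/-- The non-units form the kernel of the reduction `𝒪/c → 𝒪/𝔭`. -/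
lemma card_nonunit_mul {c : 𝒪[F]} (hc0 : c ≠ 0) (hc1 : ¬ IsUnit c) :
    residueCard F * Nat.card {x : 𝒪[F] ⧸ Ideal.span {c} // ¬ IsUnit x} =
      Nat.card (𝒪[F] ⧸ Ideal.span {c}) := by
  obtain ⟨ϖ, hϖ⟩ := IsDiscreteValuationRing.exists_irreducible 𝒪[F]
  obtain ⟨b, rfl⟩ : ϖ ∣ c := by
    rw [← Ideal.mem_span_singleton, ← hϖ.maximalIdeal_eq]
    exact (IsLocalRing.mem_maximalIdeal _).mpr hc1
  have hq : residueCard F = Nat.card (𝒪[F] ⧸ Ideal.span {ϖ}) := by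
    rw [← hϖ.maximalIdeal_eq]; rfl
  have htop : Ideal.span {ϖ * b} ≠ ⊤ := by rwa [Ne, Ideal.span_singleton_eq_top]
  have h1 : ∀ x : 𝒪[F] ⧸ Ideal.span {ϖ * b}, ¬ IsUnit x ↔ projQuot ϖ b x = 0 := by
    intro x
    obtain ⟨x, rfl⟩ := Ideal.Quotient.mk_surjective x
    rw [projQuot_mk, Ideal.Quotient.eq_zero_iff_mem, ← hϖ.maximalIdeal_eq,
      IsLocalRing.mem_maximalIdeal, mem_nonunits_iff]
    exact not_congr ⟨isUnit_of_isUnit_mk htop, fun h => h.map _⟩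
  rw [Nat.card_congr (Equiv.subtypeEquivRight h1), card_fiber_projQuot hϖ.ne_zero, hq,
    ← card_quotient_mul hϖ.ne_zero (right_ne_zero_of_mul hc0)]

/-- The complement consists of the vectors with all coordinates non-units, a fraction `N(𝔭)^{-m}` of
the total. This produces the Euler-type factors of the formula. -/
lemma card_primitive {c : 𝒪[F]} (hc0 : c ≠ 0) (hc1 : ¬ IsUnit c) (m : ℕ) :
    (Nat.card {r : Fin m → 𝒪[F] ⧸ Ideal.span {c} // ∃ i, IsUnit (r i)} : ℂ) =
      (Nat.card (𝒪[F] ⧸ Ideal.span {c}) : ℂ) ^ m * (1 - ((residueCard F : ℂ) ^ m)⁻¹) := by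
  classical
  have := finite_quotient_span hc0
  have h1 : Nat.card {r : Fin m → 𝒪[F] ⧸ Ideal.span {c} // ∃ i, IsUnit (r i)} +
      Nat.card {r : Fin m → 𝒪[F] ⧸ Ideal.span {c} // ¬ ∃ i, IsUnit (r i)} =
      Nat.card (𝒪[F] ⧸ Ideal.span {c}) ^ m := by
    rw [← Nat.card_sum, Nat.card_congr (Equiv.sumCompl _), Nat.card_fun, Nat.card_fin]
  have h2 : Nat.card {r : Fin m → 𝒪[F] ⧸ Ideal.span {c} // ¬ ∃ i, IsUnit (r i)} =
      Nat.card {x : 𝒪[F] ⧸ Ideal.span {c} // ¬ IsUnit x} ^ m := by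
    simp only [not_exists]
    rw [Nat.card_congr (Equiv.subtypePiEquivPi (p := fun _ x => ¬ IsUnit x)), Nat.card_fun,
      Nat.card_fin]
  have hq : (residueCard F : ℂ) ≠ 0 :=
    Nat.cast_ne_zero.mpr (zero_lt_one.trans one_lt_residueCard).ne'
  rw [h2, ← card_nonunit_mul hc0 hc1] at h1
  have h3 := congrArg (Nat.cast : ℕ → ℂ) h1
  rw [Nat.cast_add] at h3
  rw [← card_nonunit_mul hc0 hc1, eq_sub_of_add_eq h3]
  push_cast
  rw [mul_sub, mul_one, mul_pow, mul_right_comm, mul_inv_cancel₀ (pow_ne_zero _ hq), one_mul]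

/-- The contribution of the last row of a matrix of size `n + 1`. -/
lemma cosetAvg_prod_gaussTerm {χ : Fˣ →* ℂˣ} {ψ : AddChar F ℂ} (hψ1 : AddCharConductorOne ψ)
    {f : 𝒪[F]} (hf0 : (f : F) ≠ 0) (hf : IsCondOf χ (Ideal.span {f})) (hf1 : ¬ IsUnit f)
    {n M : ℕ} (hM : n < M) :
    cosetAvg (congSubgroup (n + 1) (Ideal.span {f ^ M}))
      (fun κ => ∏ i : Fin (n + 1), gaussTerm χ ψ f (n - i) (κ (Fin.last n) i)) =
      (1 - ((residueCard F : ℂ) ^ (n + 1))⁻¹)⁻¹ *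
        ((idealNorm (Ideal.span {f}) : ℂ) ^ (∑ i : Fin (n + 1), (n - (i : ℕ) + 1)))⁻¹ *
        gaussSum χ ψ f ^ (n + 1) := by
  classical
  have hf0' : f ≠ 0 := fun h => hf0 (by rw [h]; rfl)
  have hfM : f ^ M ≠ 0 := pow_ne_zero _ hf0'
  have hfM1 : ¬ IsUnit (f ^ M) := by rwa [isUnit_pow_iff (by omega)]
  have hfin := finite_quotient_span hfM
  have hfin' := finite_quotient_span hf0'
  have := Fintype.ofFinite (𝒪[F] ⧸ Ideal.span {f ^ M})
  have htop : Ideal.span {f ^ M} ≠ ⊤ := by rwa [Ne, Ideal.span_singleton_eq_top]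
  have hpow : ∀ i : Fin (n + 1), f ^ M = f ^ (n - (i : ℕ)) * (f * f ^ (M - (n - (i : ℕ) + 1))) := by
    intro i
    rw [← pow_succ', ← pow_add]
    congr 1; omega
  have hres : ∀ κ : GL (Fin (n + 1)) 𝒪[F],
      ∏ i : Fin (n + 1), gaussTerm χ ψ f (n - i) (κ (Fin.last n) i) =
      ∏ i : Fin (n + 1), gaussTerm χ ψ f (n - i) (lastRow (Ideal.span {f ^ M}) κ i).out := by
    intro κ
    refine Finset.prod_congr rfl fun i _ => gaussTerm_congr hψ1 hf0 hf hf1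
      (b := f ^ (M - (n - (i : ℕ) + 1))) ?_
    rw [← hpow i, ← Ideal.Quotient.eq, Ideal.Quotient.mk_out]
    rfl
  simp only [hres]
  rw [cosetAvg_lastRow htop (fun r => ∏ i : Fin (n + 1), gaussTerm χ ψ f (n - i) (r i).out),
    finsum_eq_sum_of_fintype, card_primitive hfM hfM1, card_quotient_pow hf0']
  · have h1 := Finset.prod_univ_sum (fun _ : Fin (n + 1) => (Finset.univ :
      Finset (𝒪[F] ⧸ Ideal.span {f ^ M})))
      (fun i x => gaussTerm χ ψ f (n - i) x.out)
    rw [Fintype.piFinset_univ] at h1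
    rw [← h1]
    have h2 : ∀ i : Fin (n + 1), ∑ x : 𝒪[F] ⧸ Ideal.span {f ^ M}, gaussTerm χ ψ f (n - i) x.out =
        (idealNorm (Ideal.span {f}) : ℂ) ^ (M - (n - (i : ℕ) + 1)) * gaussSum χ ψ f := by
      intro i
      rw [← finsum_eq_sum_of_fintype, sum_gaussTerm hψ1 hf0 hf hf1 (pow_ne_zero _ hf0') (hpow i),
        card_quotient_pow hf0', Nat.cast_pow]
    simp only [h2]
    have hN : (idealNorm (Ideal.span {f}) : ℂ) ≠ 0 := Nat.cast_ne_zero.mpr Nat.card_pos.ne'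
    rw [Finset.prod_mul_distrib, Finset.prod_const, Finset.card_univ, Fintype.card_fin,
      Finset.prod_pow_eq_pow_sum]
    have h3 : ∑ i : Fin (n + 1), (M - (n - (i : ℕ) + 1)) + ∑ i : Fin (n + 1), (n - (i : ℕ) + 1) =
        M * (n + 1) := by
      rw [← Finset.sum_add_distrib, Finset.sum_congr rfl (g := fun _ => M)]
      · simp [mul_comm]
      · intro i _; omega
    rw [Nat.cast_pow, ← pow_mul, ← h3, pow_add]
    field_simp
  · intro r hr
    -- The exponent `n - i` is zero at the last coordinate, so a nonzero product requires a unit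
    -- there and the support lies in the primitive vectors.
    refine Finset.prod_eq_zero (Finset.mem_univ (Fin.last n)) (gaussTerm_eq_zero ?_)
    rintro ⟨u, hu⟩
    refine hr (Fin.last n) ?_
    rw [← Ideal.Quotient.mk_out (r (Fin.last n)), hu]
    simp only [Fin.val_last, Nat.sub_self, pow_zero, one_mul]
    exact u.isUnit.map _

/-! ### The average of the integrand over `GL_n(𝒪)` -/

section Recursion

variable {n : ℕ} {ψ : AddChar F ℂ} {χ : Fˣ →* ℂˣ} {f : 𝒪[F]}

/-- Averages of the integrand are supported on the matrices with last row in `∏ f^{n-i} 𝒪ˣ`. -/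
lemma cosetAvg_integrand_mul_rowInd (hψ1 : AddCharConductorOne ψ) (s : ℂ)
    {w : GL (Fin (n + 2)) F → ℂ} {v : GL (Fin (n + 1)) F → ℂ}
    (hw : IsWhittaker ψ w) (hwI : IsIwahoriInvariant w) (hvI : IsIwahoriInvariant v)
    (hf0 : (f : F) ≠ 0) (hf : IsCondOf χ (Ideal.span {f})) (hf1 : ¬ IsUnit f)
    {M : ℕ} (hfin : Finite (𝒪[F] ⧸ Ideal.span {f ^ M})) {α : F} {z : 𝒪[F]}
    (hz : α * (f : F) ^ M = (f : F) ^ (n + 1) * z)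
    (hM : ∀ g, ∀ k ∈ congSubgroup (n + 1) (Ideal.span {f ^ M}),
      integrand w v χ (Units.mk0 (f : F) hf0) s (g * intGL _ k) =
        integrand w v χ (Units.mk0 (f : F) hf0) s g)
    (a : GL (Fin (n + 1)) F) (ha : ∀ j, a (Fin.last n) j = if j = Fin.last n then α else 0) :
    cosetAvg (congSubgroup (n + 1) (Ideal.span {f ^ M}))
      (fun κ => (∏ i, rowInd f α i κ) *
        integrand w v χ (Units.mk0 (f : F) hf0) s (a * intGL _ κ)) =
      cosetAvg (congSubgroup (n + 1) (Ideal.span {f ^ M}))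
        (fun κ => integrand w v χ (Units.mk0 (f : F) hf0) s (a * intGL _ κ)) := by
  refine cosetAvg_mul_rowInd hψ1 hf0 hf hf1 hfin hz (fun κ k hk => ?_) (fun κ t => ?_)
  · simp only [map_mul, ← mul_assoc]
    exact hM _ k hk
  · rw [map_mul, ← mul_assoc, integrand_mul_diagGL s hw hwI hvI]
    congr 3
    refine Finset.sum_congr rfl fun i _ => ?_
    have : (a * intGL _ κ) (Fin.last n) i = α * κ (Fin.last n) i := by
      rw [Units.val_mul, Matrix.mul_apply, Finset.sum_eq_single (Fin.last n)]
      · rw [ha, if_pos rfl]; rfl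
      · intro j _ hj; rw [ha, if_neg hj, zero_mul]
      · simp
    rw [this]
    rfl

/-- Some entry of the last row of `κ` is a unit, and the condition there makes `α` integral. The
condition at the last coordinate says that `α` times an integer is a unit. -/
lemma exists_unit_of_rowCond {α : F} {κ : GL (Fin (n + 1)) 𝒪[F]}
    (h : ∀ i, RowCond f α i κ) : ∃ u : 𝒪[F]ˣ, α = u := by
  obtain ⟨j, ⟨e, he⟩⟩ := exists_isUnit_lastRow κ
  have hα : α ∈ 𝒪[F] := by
    obtain ⟨u, hu⟩ := h j
    have h1 : ((e : 𝒪[F]) : F) * ((e⁻¹ : 𝒪[F]ˣ) : 𝒪[F]) = 1 :=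
      congrArg Subtype.val (Units.mul_inv e)
    have h2 : α = (f : F) ^ (n - (j : ℕ)) * u * ((e⁻¹ : 𝒪[F]ˣ) : 𝒪[F]) := by
      rw [← hu, ← he, mul_assoc, h1, mul_one]
    rw [h2]
    exact mul_mem (mul_mem (pow_mem f.2 _) (SetLike.coe_mem _)) (SetLike.coe_mem _)
  obtain ⟨u, hu⟩ := h (Fin.last n)
  have h3 : (⟨α, hα⟩ : 𝒪[F]) * κ (Fin.last n) (Fin.last n) = u := by
    apply Subtype.val_injective
    change α * (κ (Fin.last n) (Fin.last n) : F) = _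
    rw [hu]; simp
  obtain ⟨u', hu'⟩ := isUnit_of_mul_isUnit_left (h3 ▸ u.isUnit)
  exact ⟨u', congrArg Subtype.val hu'.symm⟩

/-- A matrix with last row in `∏ f^{n-i} 𝒪ˣ` is a product of the matrix `(f^{i-j})` with a diagonal
one, up to an element of the mirabolic subgroup. -/
lemma exists_eq_of_rowCond {κ : GL (Fin (n + 1)) 𝒪[F]} (h : ∀ i, RowCond f 1 i κ) :
    ∃ (t : Fin (n + 1) → 𝒪[F]ˣ) (x : Fin n → 𝒪[F]) (k : GL (Fin n) 𝒪[F]),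
      (∀ i : Fin (n + 1), κ (Fin.last n) i = f ^ (n - (i : ℕ)) * t i) ∧
      κ = colUnip x * embedHom n 𝒪[F] k * (lowerGL (n + 1) f * diagGL (n + 1) 𝒪[F] t) := by
  choose t ht using h
  have ht' : ∀ i : Fin (n + 1), κ (Fin.last n) i = f ^ (n - (i : ℕ)) * t i := by
    intro i
    apply Subtype.val_injective
    have := ht i
    rw [one_mul] at this
    rw [this]; push_cast; rfl
  let q := lowerGL (n + 1) f * diagGL (n + 1) 𝒪[F] t
  have hq : ∀ i : Fin (n + 1), q (Fin.last n) i = κ (Fin.last n) i := by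
    intro i
    rw [mul_diagGL_apply, lowerGL_apply, if_pos (Fin.le_last i), ht' i, Fin.val_last]
  -- `κ` and `q` have the same last row, so `κ q⁻¹` lies in the mirabolic subgroup.
  have hrow : ∀ j, (κ * q⁻¹) (Fin.last n) j = (1 : Matrix _ _ 𝒪[F]) (Fin.last n) j := by
    intro j
    have h1 : (κ * q⁻¹) (Fin.last n) j = (q * q⁻¹) (Fin.last n) j := by
      rw [Units.val_mul, Units.val_mul, Matrix.mul_apply, Matrix.mul_apply]
      exact Finset.sum_congr rfl fun i _ => by rw [hq]
    rw [h1, mul_inv_cancel]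
    rfl
  obtain ⟨x, k, hxk⟩ := eq_colUnip_mul_embedHom (κ * q⁻¹)
    (fun j => by rw [hrow, Matrix.one_apply_ne (Fin.castSucc_lt_last j).ne'])
    (by rw [hrow, Matrix.one_apply_eq])
  exact ⟨t, x, k, ht', by rw [← hxk, inv_mul_cancel_right]⟩

lemma embedHom_mul_last (k : GL (Fin n) 𝒪[F]) (κ : GL (Fin (n + 1)) 𝒪[F]) (i : Fin (n + 1)) :
    (embedHom n 𝒪[F] k * κ) (Fin.last n) i = κ (Fin.last n) i := by
  rw [Units.val_mul, Matrix.mul_apply, Fin.sum_univ_castSucc]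
  simp

/-- The recursion for the averages of the integrand. -/
lemma cosetAvg_integrand_succ (hψ1 : AddCharConductorOne ψ) (s : ℂ)
    {w : GL (Fin (n + 2)) F → ℂ} {v : GL (Fin (n + 1)) F → ℂ}
    (hw : IsWhittaker ψ w) (hwI : IsIwahoriInvariant w)
    (hv : IsWhittaker ψ⁻¹ v) (hvI : IsIwahoriInvariant v)
    (hf0 : (f : F) ≠ 0) (hf : IsCondOf χ (Ideal.span {f})) (hf1 : ¬ IsUnit f)
    {M : ℕ} (hnM : n < M)
    (hM : ∀ g, ∀ k ∈ congSubgroup (n + 1) (Ideal.span {f ^ M}),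
      integrand w v χ (Units.mk0 (f : F) hf0) s (g * intGL _ k) =
        integrand w v χ (Units.mk0 (f : F) hf0) s g)
    (hM' : ∀ g, ∀ k ∈ congSubgroup n (Ideal.span {f ^ M}),
      integrand (fun g => w (embedHom (n + 1) F g)) (fun g => v (embedHom n F g)) χ
        (Units.mk0 (f : F) hf0) s (g * intGL _ k) =
      integrand (fun g => w (embedHom (n + 1) F g)) (fun g => v (embedHom n F g)) χ
        (Units.mk0 (f : F) hf0) s g) (a : GL (Fin n) F) :
    cosetAvg (congSubgroup (n + 1) (Ideal.span {f ^ M}))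
        (fun κ => integrand w v χ (Units.mk0 (f : F) hf0) s (embedHom n F a * intGL _ κ)) =
      cosetAvg (congSubgroup n (Ideal.span {f ^ M}))
        (fun κ => integrand (fun g => w (embedHom (n + 1) F g)) (fun g => v (embedHom n F g)) χ
          (Units.mk0 (f : F) hf0) s (a * intGL _ κ)) *
      ((1 - ((residueCard F : ℂ) ^ (n + 1))⁻¹)⁻¹ *
        ((idealNorm (Ideal.span {f}) : ℂ) ^ (∑ i : Fin (n + 1), (n - (i : ℕ) + 1)))⁻¹ *
        gaussSum χ ψ f ^ (n + 1)) := by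
  have hf0' : f ≠ 0 := fun h => hf0 (by rw [h]; rfl)
  have hfin := finite_quotient_span (pow_ne_zero M hf0')
  have hz : (1 : F) * (f : F) ^ M = (f : F) ^ (n + 1) * ((f ^ (M - (n + 1)) : 𝒪[F]) : F) := by
    push_cast
    rw [one_mul, ← pow_add]; congr 1; omega
  rw [← cosetAvg_integrand_mul_rowInd hψ1 s hw hwI hvI hf0 hf hf1 hfin hz hM]
  swap
  · intro j
    induction j using Fin.lastCases with
    | last => simp
    | cast j => simp [(Fin.castSucc_lt_last j).ne]
  set Ψ : GL (Fin (n + 1)) 𝒪[F] → ℂ := fun κ => (∏ i, rowInd f 1 i κ) *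
        integrand w v χ (Units.mk0 (f : F) hf0) s (embedHom n F a * intGL _ κ) with hΨ
  set Φ' : GL (Fin n) 𝒪[F] → ℂ := fun κ => integrand (fun g => w (embedHom (n + 1) F g))
    (fun g => v (embedHom n F g)) χ (Units.mk0 (f : F) hf0) s (a * intGL _ κ) with hΦ'
  have hΨinv : IsRightInv (congSubgroup (n + 1) (Ideal.span {f ^ M})) Ψ := by
    refine (isRightInv_prod Finset.univ (isRightInv_rowInd (n := n) hf1 hz)).mul
      fun κ k hk => ?_
    simp only [map_mul, ← mul_assoc]
    exact hM _ k hk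
  have hΦ'inv : IsRightInv (congSubgroup n (Ideal.span {f ^ M})) Φ' := by
    intro κ k hk
    simp only [hΦ', map_mul, ← mul_assoc]
    exact hM' _ k hk
  -- An extra average over left translates by `GL_n(𝒪)` costs nothing. After exchanging the
  -- averages, `κ` is fixed and the inner one becomes the average of rank `n`.
  have h1 : cosetAvg (congSubgroup n (Ideal.span {f ^ M})) (fun k =>
      cosetAvg (congSubgroup (n + 1) (Ideal.span {f ^ M})) fun κ =>
        Ψ (embedHom n 𝒪[F] k * κ)) = cosetAvg (congSubgroup (n + 1) (Ideal.span {f ^ M})) Ψ := by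
    simp only [cosetAvg_left hΨinv, cosetAvg_const]
  rw [← h1, ← cosetAvg_comm, ← cosetAvg_prod_gaussTerm hψ1 hf0 hf hf1 hnM, ← cosetAvg_mul_left]
  congr 1
  ext κ
  have hind : ∀ k, ∏ i, rowInd f (1 : F) i (embedHom n 𝒪[F] k * κ) = ∏ i, rowInd f (1 : F) i κ := by
    intro k
    refine Finset.prod_congr rfl fun i _ => ?_
    unfold rowInd RowCond
    rw [embedHom_mul_last]
  by_cases hκ : ∀ i, RowCond f (1 : F) i κ
  · obtain ⟨t, x, k₁, ht, hκt⟩ := exists_eq_of_rowCond hκ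
    -- With `κ = x j(k₁) L t`, the column `x` moves to the left and disappears by unipotent
    -- invariance. The Gauss factors depend only on the last row of `κ`, which left multiplication
    -- by `j(k)` does not alter.
    have h2 : ∀ k, Ψ (embedHom n 𝒪[F] k * κ) =
        (∏ i : Fin (n + 1), gaussTerm χ ψ f (n - i) (κ (Fin.last n) i)) * Φ' (k * k₁) := by
      intro k
      have h3 : ∏ i, rowInd f (1 : F) i κ = 1 :=
        Finset.prod_eq_one fun i _ => by rw [rowInd, if_pos (hκ i)]
      have h4 : embedHom n F a * intGL _ (embedHom n 𝒪[F] k * κ) =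
          colUnip ((a * intGL n k).val *ᵥ fun i => (x i : F)) *
            (embedHom n F (a * intGL n (k * k₁)) *
              intGL _ (lowerGL (n + 1) f * diagGL (n + 1) 𝒪[F] t)) := by
        have hE := embedHom_mul_colUnip (a * intGL n k) (fun i => (x i : F))
        have h5 : intGL (n + 1) (colUnip x) = colUnip (fun i => (x i : F)) := by
          rw [intGL, map_colUnip]; rfl
        have h6 : ∀ k, intGL (n + 1) (embedHom n 𝒪[F] k) = embedHom n F (intGL n k) := by
          intro k; rw [intGL, map_embedHom]
        rw [hκt]
        simp only [map_mul, h5, h6, ← mul_assoc] at hE ⊢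
        rw [hE]
      simp only [hΨ]
      rw [hind, h3, one_mul, h4, integrand_unipotent_mul s hw hv _ (colUnip_mem_unipotent _),
        integrand_embedHom_mul_lowerGL s hw hwI hvI hf0 hf1]
      congr 1
      refine Finset.prod_congr rfl fun i _ => ?_
      rw [ht, gaussTerm_eq hf0]
    simp only [h2]
    -- The unknown block `k₁` is removed by right invariance of the average over `k`.
    rw [cosetAvg_mul_left, cosetAvg_right hΦ'inv, mul_comm]
  · obtain ⟨i, hi⟩ := not_forall.mp hκ
    have h3 : ∏ i, rowInd f (1 : F) i κ = 0 :=
      Finset.prod_eq_zero (Finset.mem_univ i) (by rw [rowInd, if_neg hi])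
    have h4 : ∏ i : Fin (n + 1), gaussTerm χ ψ f (n - i) (κ (Fin.last n) i) = 0 := by
      refine Finset.prod_eq_zero (Finset.mem_univ i) (gaussTerm_eq_zero ?_)
      rintro ⟨u, hu⟩
      refine hi ⟨u, ?_⟩
      rw [one_mul, hu]; push_cast; rfl
    simp only [hΨ, hind, h3, h4, zero_mul, mul_zero, cosetAvg_const]

/-- Both `∑ k(n+1-k)` and `n(n+1)/2` are accumulated sums: passing to `n + 1` adds `1 + ⋯ + (n+1)`
to the first and `n + 1` to the second. -/
lemma birchConstant_succ (w : GL (Fin (n + 2)) F → ℂ) (v : GL (Fin (n + 1)) F → ℂ) :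
    birchConstant w v χ ψ f =
      birchConstant (fun g => w (embedHom (n + 1) F g)) (fun g => v (embedHom n F g)) χ ψ f *
      ((1 - ((residueCard F : ℂ) ^ (n + 1))⁻¹)⁻¹ *
        ((idealNorm (Ideal.span {f}) : ℂ) ^ (∑ i : Fin (n + 1), (n - (i : ℕ) + 1)))⁻¹ *
        gaussSum χ ψ f ^ (n + 1)) := by
  have h1 : ∑ k ∈ Finset.Icc 1 (n + 1), k * (n + 1 + 1 - k) =
      ∑ k ∈ Finset.Icc 1 n, k * (n + 1 - k) + ∑ i : Fin (n + 1), (n - (i : ℕ) + 1) := by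
    have h2 : ∑ i : Fin (n + 1), (n - (i : ℕ) + 1) = ∑ k ∈ Finset.Icc 1 (n + 1), k := by
      have h4 : ∀ m : ℕ, ∑ k ∈ Finset.Icc 1 m, k = ∑ j ∈ Finset.range m, (j + 1) := by
        intro m
        induction m with
        | zero => simp
        | succ m ih => rw [Finset.sum_Icc_succ_top (by omega), ih, Finset.sum_range_succ]
      rw [Fin.sum_univ_eq_sum_range (fun i => n - i + 1), h4,
        ← Finset.sum_range_reflect (fun j => j + 1)]
      rfl
    rw [h2, Finset.sum_Icc_succ_top (by omega), Finset.sum_Icc_succ_top (by omega), ← add_assoc,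
      ← Finset.sum_add_distrib]
    congr 1
    · refine Finset.sum_congr rfl fun k hk => ?_
      have := (Finset.mem_Icc.mp hk).2
      rw [show n + 1 + 1 - k = (n + 1 - k) + 1 by omega, mul_add, mul_one]
    · rw [Nat.add_sub_cancel_left, mul_one]
  have h3 : (n + 1) * (n + 1 + 1) / 2 = n * (n + 1) / 2 + (n + 1) := by
    rw [show (n + 1) * (n + 1 + 1) = n * (n + 1) + 2 * (n + 1) by ring,
      Nat.add_mul_div_left _ _ (by norm_num)]
  rw [birchConstant, birchConstant, h1, h3, Finset.prod_Icc_succ_top (by omega), pow_add, pow_add,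
    mul_inv, map_one, map_one]
  ring

end Recursion

/-- The average over `GL_n(𝒪)` of the translates of the integrand by diagonal matrices. -/
theorem exists_cosetAvg_integrand {ψ : AddChar F ℂ} (hψ1 : AddCharConductorOne ψ) (s : ℂ)
    {χ : Fˣ →* ℂˣ} {f : 𝒪[F]} (hf0 : (f : F) ≠ 0) (hf : IsCondOf χ (Ideal.span {f}))
    (hf1 : ¬ IsUnit f) (n : ℕ) :
    ∀ {w : GL (Fin (n + 1)) F → ℂ} {v : GL (Fin n) F → ℂ}
      (_ : IsWhittaker ψ w) (_ : IsIwahoriInvariant w)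
      (_ : IsWhittaker ψ⁻¹ v) (_ : IsIwahoriInvariant v) (a : Fin n → Fˣ),
      ∃ M₀ : ℕ, ∀ M ≥ M₀,
        ((∀ i, ∃ u : 𝒪[F]ˣ, (a i : F) = u) →
          cosetAvg (congSubgroup n (Ideal.span {f ^ M})) (fun κ => integrand w v χ
            (Units.mk0 (f : F) hf0) s (diagGL n F a * intGL _ κ)) = birchConstant w v χ ψ f) ∧
        ((¬ ∀ i, ∃ u : 𝒪[F]ˣ, (a i : F) = u) →
          cosetAvg (congSubgroup n (Ideal.span {f ^ M})) (fun κ => integrand w v χ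
            (Units.mk0 (f : F) hf0) s (diagGL n F a * intGL _ κ)) = 0) := by
  have hf0' : f ≠ 0 := fun h => hf0 (by rw [h]; rfl)
  induction n with
  | zero =>
    intro w v hw hwI hv hvI a
    refine ⟨0, fun M _ => ⟨fun _ => ?_, fun h => absurd (fun i => i.elim0) h⟩⟩
    have := finite_quotient_span (pow_ne_zero M hf0')
    have h1 : ∀ κ : GL (Fin 0) 𝒪[F], integrand w v χ (Units.mk0 (f : F) hf0) s
        (diagGL 0 F a * intGL _ κ) = birchConstant w v χ ψ f := by
      intro κ
      have h2 : diagGL 0 F a * intGL _ κ = 1 := Subsingleton.elim _ _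
      have h3 : hConj 0 (Units.mk0 (f : F) hf0) = 1 := by
        have : Subsingleton (Fin (0 + 1)) := inferInstanceAs (Subsingleton (Fin 1))
        ext i j
        rw [Subsingleton.elim i (Fin.last 0), Subsingleton.elim j (Fin.last 0), hConj_last_last]
        simp
      rw [h2, integrand, h3, embed_eq_embedHom, map_one, mul_one, map_one, map_one, birchConstant]
      simp [normAbs_one]
    simp only [h1, cosetAvg_const]
  | succ n ih =>
    intro w v hw hwI hv hvI a
    obtain ⟨M₁, hM₁⟩ := ih hw.embedHom hwI.embedHom hv.embedHom hvI.embedHom (fun i => a i.castSucc)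
    obtain ⟨M₂, hM₂⟩ := exists_integrand_mul_intGL s hwI hvI hf0 hf hf1
    obtain ⟨M₃, hM₃⟩ := exists_integrand_mul_intGL s hwI.embedHom hvI.embedHom hf0 hf hf1
    -- This threshold makes `α f^M` divisible by `f^{n+1}` for the last entry `α` of `a`, so the row
    -- conditions are visible at level `f^M`. It depends on `a`, hence so does `M₀`.
    obtain ⟨M₄, hM₄⟩ := exists_pow_mul_mem hf1 ((a (Fin.last n) : F) * ((f : F) ^ (n + 1))⁻¹)
    refine ⟨M₁ + M₂ + M₃ + M₄ + (n + 1), fun M hM => ?_⟩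
    have hfin := finite_quotient_span (pow_ne_zero M hf0')
    by_cases hα : ∃ u : 𝒪[F]ˣ, (a (Fin.last n) : F) = u
    · obtain ⟨u, hu⟩ := hα
      have hdiag : diagGL (n + 1) F a = embedHom n F (diagGL n F fun i => a i.castSucc) *
          intGL _ (diagGL (n + 1) 𝒪[F] (Pi.mulSingle (Fin.last n) u)) := by
        rw [intGL, map_diagGL]
        ext i j
        rw [mul_diagGL_apply]
        induction i using Fin.lastCases with
        | last =>
          induction j using Fin.lastCases with
          | last =>
            simp [diagGL_apply, hu]
            rfl
          | cast j => simp [diagGL_apply, (Fin.castSucc_lt_last j).ne']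
        | cast i =>
          induction j using Fin.lastCases with
          | last => simp [diagGL_apply, (Fin.castSucc_lt_last i).ne]
          | cast j => simp [diagGL_apply, (Fin.castSucc_lt_last j).ne]
      -- A unit in the last diagonal place belongs to `GL_{n+1}(𝒪)` and is absorbed by left
      -- invariance of the average.
      have h1 : cosetAvg (congSubgroup (n + 1) (Ideal.span {f ^ M})) (fun κ => integrand w v χ
            (Units.mk0 (f : F) hf0) s (diagGL (n + 1) F a * intGL _ κ)) =
          cosetAvg (congSubgroup (n + 1) (Ideal.span {f ^ M})) (fun κ => integrand w v χ
            (Units.mk0 (f : F) hf0) s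
              (embedHom n F (diagGL n F fun i => a i.castSucc) * intGL _ κ)) := by
        have hinv : IsRightInv (congSubgroup (n + 1) (Ideal.span {f ^ M})) (fun κ => integrand w v χ
            (Units.mk0 (f : F) hf0) s
              (embedHom n F (diagGL n F fun i => a i.castSucc) * intGL _ κ)) := by
          intro κ k hk
          simp only [map_mul, ← mul_assoc]
          exact hM₂ M (by omega) _ k hk
        rw [← cosetAvg_left hinv (diagGL (n + 1) 𝒪[F] (Pi.mulSingle (Fin.last n) u))]
        simp only [hdiag, map_mul, mul_assoc]
      rw [h1, cosetAvg_integrand_succ hψ1 s hw hwI hv hvI hf0 hf hf1 (by omega) (hM₂ M (by omega))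
        (hM₃ M (by omega)), birchConstant_succ]
      obtain ⟨h2, h3⟩ := hM₁ M (by omega)
      refine ⟨fun h => ?_, fun h => ?_⟩
      · rw [h2 fun i => h i.castSucc]
      · rw [h3, zero_mul]
        intro h4
        refine h fun i => ?_
        induction i using Fin.lastCases with
        | last => exact ⟨u, hu⟩
        | cast i => exact h4 i
    -- When the last entry is not a unit, no `κ` satisfies all row conditions, so the restricted
    -- average is zero termwise.
    · refine ⟨fun h => absurd (h _) hα, fun _ => ?_⟩
      have hz : (a (Fin.last n) : F) * (f : F) ^ M = (f : F) ^ (n + 1) *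
          ((⟨_, hM₄ M (by omega)⟩ : 𝒪[F]) : F) := by
        have := pow_ne_zero (n + 1) hf0
        change _ = (f : F) ^ (n + 1) * ((f : F) ^ M *
          ((a (Fin.last n) : F) * ((f : F) ^ (n + 1))⁻¹))
        field_simp
      rw [← cosetAvg_integrand_mul_rowInd hψ1 s hw hwI hvI hf0 hf hf1 hfin hz (hM₂ M (by omega))]
      · rw [← cosetAvg_const (congSubgroup (n + 1) (Ideal.span {f ^ M})) 0]
        congr 1
        ext κ
        have : ¬ ∀ i, RowCond f (a (Fin.last n) : F) i κ := fun h =>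
          hα (exists_unit_of_rowCond h)
        obtain ⟨i, hi⟩ := not_forall.mp this
        rw [Finset.prod_eq_zero (Finset.mem_univ i) (by rw [rowInd, if_neg hi]), zero_mul]
      · intro j
        rw [diagGL_apply]
        simp only [eq_comm]

/-! ### Support of Whittaker functions on the torus -/

section Support

variable {n : ℕ} {ψ : AddChar F ℂ}

/-- The elementary matrix `1 + c E_{ij}` as an element of `GL_n`. -/
def transvGL {A : Type*} [CommRing A] {i j : Fin n} (h : i ≠ j) (c : A) : GL (Fin n) A where
  val := transvection i j c
  inv := transvection i j (-c)
  val_inv := by rw [transvection_mul_transvection_same i j h, add_neg_cancel, transvection_zero]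
  inv_val := by rw [transvection_mul_transvection_same i j h, neg_add_cancel, transvection_zero]

lemma transvGL_apply {A : Type*} [CommRing A] {i j : Fin n} (h : i ≠ j) (c : A) (a b : Fin n) :
    transvGL h c a b = (1 : Matrix _ _ A) a b + if i = a ∧ j = b then c else 0 := by
  change (1 + Matrix.single i j c) a b = _
  rw [Matrix.add_apply, Matrix.single_apply]

lemma transvGL_mem_congSubgroup {A : Type*} [CommRing A] {i j : Fin n} (h : i ≠ j) {c : A}
    {I : Ideal A} (hc : c ∈ I) : transvGL h c ∈ congSubgroup n I := by
  refine mem_congSubgroup.mpr fun a b => ?_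
  rw [transvGL_apply, add_sub_cancel_left]
  split_ifs
  exacts [hc, zero_mem _]

lemma diagGL_mul_transvGL {i j : Fin n} (h : i ≠ j) (b : Fin n → Fˣ) (c : 𝒪[F]) :
    diagGL n F b * intGL n (transvGL h c) =
      transvGL h ((b i : F) * (b j : F)⁻¹ * c) * diagGL n F b := by
  ext k l
  rw [diagGL_mul_apply, mul_diagGL_apply, intGL_apply, transvGL_apply, transvGL_apply]
  by_cases hkl : k = l
  · subst hkl
    have : ¬ (i = k ∧ j = k) := fun h' => h (h'.1.trans h'.2.symm)
    simp [this]
  · by_cases hij : i = k ∧ j = l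
    · obtain ⟨rfl, rfl⟩ := hij
      simp [hkl]
      field_simp
    · simp [hkl, hij]

lemma transvGL_mem_unipotent {i j : Fin n} (h : i < j) (c : F) :
    transvGL h.ne c ∈ unipotent n F := by
  refine ⟨fun a b hab => ?_, fun a => ?_⟩
  · rw [transvGL_apply, Matrix.one_apply_ne hab.ne', if_neg, add_zero]
    rintro ⟨rfl, rfl⟩
    exact absurd h hab.not_gt
  · rw [transvGL_apply, Matrix.one_apply_eq, if_neg, add_zero]
    rintro ⟨rfl, rfl⟩
    exact lt_irrefl _ h

lemma unipotentChar_transvGL (ψ : AddChar F ℂ) (i : Fin n) (hi : (i : ℕ) + 1 < n)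
    (h : i ≠ ⟨i + 1, hi⟩) (c : F) : unipotentChar ψ (transvGL h c) = ψ c := by
  rw [unipotentChar, Finset.prod_eq_single i]
  · rw [dif_pos hi, transvGL_apply, if_pos ⟨rfl, rfl⟩, Matrix.one_apply_ne h, zero_add]
  · intro a _ ha
    split_ifs with h'
    · rw [transvGL_apply, if_neg fun h'' => ha h''.1.symm, add_zero, Matrix.one_apply_ne,
        AddChar.map_zero_eq_one]
      intro h''
      have := congrArg Fin.val h''
      simp at this
    · rfl
  · simp

/-- A Whittaker function that is invariant under a congruence subgroup is supported on a cone. -/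
lemma mem_integer_of_whittaker_ne_zero (hψ1 : AddCharConductorOne ψ) {W : GL (Fin n) F → ℂ}
    (hW : IsWhittaker ψ W) {c : 𝒪[F]}
    (hWc : ∀ g, ∀ k ∈ congSubgroup n (Ideal.span {c}), W (g * intGL n k) = W g)
    (b : Fin n → Fˣ) (κ : GL (Fin n) 𝒪[F]) (hne : W (diagGL n F b * intGL n κ) ≠ 0)
    (i : Fin n) (hi : (i : ℕ) + 1 < n) :
    (b i : F) * (b ⟨i + 1, hi⟩ : F)⁻¹ * c ∈ 𝒪[F] := by
  have hlt : i < ⟨i + 1, hi⟩ := Fin.lt_def.mpr (Nat.lt_succ_self _)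
  refine (hψ1 _).mp fun y hy => ?_
  have h1 : transvGL hlt.ne (c * ⟨y, hy⟩) ∈ congSubgroup n (Ideal.span {c}) :=
    transvGL_mem_congSubgroup _ (Ideal.mul_mem_right _ _ (Ideal.mem_span_singleton_self c))
  -- Normality lets the elementary matrix pass `κ`. Moved on through the torus to the left, it
  -- multiplies the nonzero value by `ψ(b_i b_{i+1}⁻¹ c y)`, which is therefore `1` for all integral
  -- `y`.
  have h2 : κ⁻¹ * transvGL hlt.ne (c * ⟨y, hy⟩) * κ ∈ congSubgroup n (Ideal.span {c}) := by
    have := (inferInstance : (congSubgroup n (Ideal.span {c})).Normal).conj_mem _ h1 κ⁻¹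
    rwa [inv_inv] at this
  have h3 := hWc (diagGL n F b * intGL n κ) _ h2
  rw [mul_assoc, ← map_mul, mul_assoc, mul_inv_cancel_left, map_mul, ← mul_assoc,
    diagGL_mul_transvGL, mul_assoc, hW _ (transvGL_mem_unipotent hlt _),
    unipotentChar_transvGL] at h3
  have h4 := mul_right_cancel₀ hne (h3.trans (one_mul _).symm)
  rw [← h4]
  congr 1
  push_cast
  ring

/-- The support of the integrand on the torus lies in a cone. -/
lemma exists_mem_integer_of_integrand_ne_zero (hψ1 : AddCharConductorOne ψ) (s : ℂ)
    {w : GL (Fin (n + 1)) F → ℂ} {v : GL (Fin n) F → ℂ} {χ : Fˣ →* ℂˣ} {f : 𝒪[F]}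
    (hw : IsWhittaker ψ w) (hwI : IsIwahoriInvariant w) (hf0 : (f : F) ≠ 0) (hf1 : ¬ IsUnit f) :
    ∃ N : ℕ, ∀ (a : Fin n → Fˣ) (κ : GL (Fin n) 𝒪[F]),
      integrand w v χ (Units.mk0 (f : F) hf0) s (diagGL n F a * intGL n κ) ≠ 0 →
      ∀ i : Fin n, ((Fin.snoc a 1 : Fin (n + 1) → Fˣ) i.castSucc : F) *
        ((Fin.snoc a 1 : Fin (n + 1) → Fˣ) i.succ : F)⁻¹ * (f : F) ^ N ∈ 𝒪[F] := by
  obtain ⟨N, hN⟩ := exists_conj_mem hf1 (hConj n (Units.mk0 (f : F) hf0))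
  refine ⟨N, fun a κ hne i => ?_⟩
  have hW : IsWhittaker ψ fun g => w (g * hConj n (Units.mk0 (f : F) hf0)) := fun u hu g => by
    simp only [mul_assoc, hw u hu]
  have hWc : ∀ g, ∀ k ∈ congSubgroup (n + 1) (Ideal.span {f ^ N}),
      w (g * intGL _ k * hConj n (Units.mk0 (f : F) hf0)) =
        w (g * hConj n (Units.mk0 (f : F) hf0)) := by
    intro g k hk
    obtain ⟨k', hk', h⟩ := hN N le_rfl k hk
    have h1 : g * intGL _ k * hConj n (Units.mk0 (f : F) hf0) =
        g * hConj n (Units.mk0 (f : F) hf0) * intGL _ k' := by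
      rw [← h]; group
    rw [h1, hwI.mul_intGL _ (mem_maximalIdeal_of_mem_congSubgroup hf1 hk')]
  -- Using `w` on the larger group adds the ratio of the last entry of `a` to `1`. This bounds the
  -- entries themselves, not merely their successive ratios.
  have h2 : diagGL (n + 1) F (Fin.snoc a 1) = embedHom n F (diagGL n F a) := by
    apply gl_ext_succ <;> intros <;>
      simp [diagGL_apply, Fin.castSucc_ne_last, (Fin.castSucc_ne_last _).symm]
  have h3 := mem_integer_of_whittaker_ne_zero hψ1 hW hWc (Fin.snoc a 1) (embedHom n 𝒪[F] κ) ?_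
    i.castSucc (by simp)
  · push_cast at h3
    exact h3
  · intro h0
    apply hne
    have h4 : intGL _ (embedHom n 𝒪[F] κ) = embedHom n F (intGL n κ) := by
      rw [intGL, map_embedHom]
    rw [h2, h4, ← map_mul] at h0
    rw [integrand, embed_eq_embedHom, h0]
    simp

end Support

/-! ### The cells of the diagonal torus modulo units -/

section Cells

lemma normAbs_le_one {x : F} (hx : x ∈ 𝒪[F]) : normAbs x ≤ 1 := by
  by_cases h : IsUnit (⟨x, hx⟩ : 𝒪[F])
  · obtain ⟨u, hu⟩ := h
    have := normAbs_intUnits u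
    have h2 : ((intUnits u : Fˣ) : F) = x := congrArg Subtype.val hu
    rw [h2] at this
    exact this.le
  · exact (normAbs_lt_one (Valuation.Integer.not_isUnit_iff_valuation_lt_one.mp h)).le

lemma normAbs_zpow (x : Fˣ) (e : ℤ) : normAbs ((x ^ e : Fˣ) : F) = normAbs (x : F) ^ e := by
  let φ : F →*₀ ℝ :=
    { toFun := normAbs, map_zero' := by simp [normAbs], map_one' := normAbs_one,
      map_mul' := normAbs_mul }
  rw [Units.val_zpow_eq_zpow_val]
  exact map_zpow₀ φ _ _

/-- Every element of `Fˣ` is a power of a uniformizer times a unit. -/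
lemma exists_uniformizer (F : Type*) [Field F] [ValuativeRel F] [TopologicalSpace F]
    [IsNonarchimedeanLocalField F] : ∃ p : Fˣ, normAbs (p : F) < 1 ∧
      ∀ x : Fˣ, ∃ (e : ℤ) (u : 𝒪[F]ˣ), x = p ^ e * intUnits u := by
  obtain ⟨ϖ, hϖ⟩ := IsDiscreteValuationRing.exists_irreducible 𝒪[F]
  have h0 : (ϖ : F) ≠ 0 := fun h => hϖ.ne_zero (Subtype.val_injective h)
  have hint : ∀ x : Fˣ, (x : F) ∈ 𝒪[F] →
      ∃ (e : ℤ) (u : 𝒪[F]ˣ), x = Units.mk0 (ϖ : F) h0 ^ e * intUnits u := by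
    intro x hx
    have hx0 : (⟨x, hx⟩ : 𝒪[F]) ≠ 0 := fun h => x.ne_zero (congrArg Subtype.val h)
    obtain ⟨k, u, hk⟩ := IsDiscreteValuationRing.eq_unit_mul_pow_irreducible hx0 hϖ
    refine ⟨k, u, Units.ext ?_⟩
    have := congrArg Subtype.val hk
    rw [zpow_natCast, mul_comm]
    exact this
  refine ⟨Units.mk0 (ϖ : F) h0,
    normAbs_lt_one (Valuation.Integer.not_isUnit_iff_valuation_lt_one.mp hϖ.not_isUnit), ?_⟩
  intro x
  rcases mem_integer_or_inv (x : F) with hx | ⟨y, _, hy⟩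
  · exact hint x hx
  · obtain ⟨e, u, h⟩ := hint x⁻¹ (by rw [Units.val_inv_eq_inv_val, ← hy]; exact y.2)
    exact ⟨-e, u⁻¹, by rw [← inv_inv x, h, mul_inv, map_inv, _root_.zpow_neg]⟩

lemma prod_zpow_eq_zpow_sum {ι : Type*} (t : Finset ι) (p : Fˣ) (e : ι → ℤ) :
    ∏ i ∈ t, p ^ e i = p ^ ∑ i ∈ t, e i := by
  classical
  induction t using Finset.induction_on with
  | empty => simp
  | insert a t ha ih => rw [Finset.prod_insert ha, Finset.sum_insert ha, ih, _root_.zpow_add]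

variable {n : ℕ} (p : Fˣ)

/-- The diagonal matrix of powers of `p`. -/
def torusPow (e : Fin n → ℤ) : GL (Fin n) F := diagGL n F fun i => p ^ e i

/-- The set of all `p^e k` with `k` in `GL_n(𝒪)`. -/
def torusCell (e : Fin n → ℤ) : Set (GL (Fin n) F) :=
  {g | (torusPow p e)⁻¹ * g ∈ maxCompact n F}

lemma torusPow_zero : torusPow (n := n) p 0 = 1 := by
  have : (fun i : Fin n => p ^ (0 : Fin n → ℤ) i) = 1 := by ext; simp
  rw [torusPow, this, map_one]

lemma mem_torusCell {p : Fˣ} {e : Fin n → ℤ} {g : GL (Fin n) F} :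
    g ∈ torusCell p e ↔ ∃ κ, g = torusPow p e * intGL n κ := by
  constructor
  · rintro ⟨κ, hκ⟩
    exact ⟨κ, by rw [intGL, hκ, mul_inv_cancel_left]⟩
  · rintro ⟨κ, rfl⟩
    exact ⟨κ, by rw [inv_mul_cancel_left]⟩

lemma diagK_eq_iUnion {p : Fˣ} (hp : ∀ x : Fˣ, ∃ (e : ℤ) (u : 𝒪[F]ˣ), x = p ^ e * intUnits u) :
    diagK n F = ⋃ e : Fin n → ℤ, torusCell p e := by
  ext g
  rw [Set.mem_iUnion]
  constructor
  · rintro ⟨a, ha, k, ⟨κ, rfl⟩, rfl⟩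
    have ha0 : ∀ i, a i i ≠ 0 := by
      intro i hi
      apply GeneralLinearGroup.det_ne_zero a
      exact Matrix.det_eq_zero_of_row_eq_zero i fun j => by
        by_cases h : i = j
        · rw [← h, hi]
        · exact ha i j h
    choose e u heu using fun i => hp (Units.mk0 (a i i) (ha0 i))
    refine ⟨e, mem_torusCell.mpr ⟨diagGL n 𝒪[F] u * κ, ?_⟩⟩
    rw [map_mul, ← mul_assoc]
    congr 1
    rw [intGL, map_diagGL, torusPow, ← map_mul]
    ext i j
    rw [diagGL_apply]
    split_ifs with h
    · subst h
      exact congrArg Units.val (heu i)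
    · exact ha i j h
  · rintro ⟨e, he⟩
    obtain ⟨κ, rfl⟩ := mem_torusCell.mp he
    exact ⟨torusPow p e, fun i j h => by rw [torusPow, diagGL_apply, if_neg h], _, ⟨κ, rfl⟩, rfl⟩

lemma mul_intGL_mem_diagK_iff (g : GL (Fin n) F) (κ : GL (Fin n) 𝒪[F]) :
    g * intGL n κ ∈ diagK n F ↔ g ∈ diagK n F := by
  have h : ∀ (g : GL (Fin n) F) (κ : GL (Fin n) 𝒪[F]), g ∈ diagK n F →
      g * intGL n κ ∈ diagK n F := by
    rintro _ κ ⟨a, ha, k, hk, rfl⟩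
    exact ⟨a, ha, _, mul_mem hk ⟨κ, rfl⟩, mul_assoc _ _ _⟩
  refine ⟨fun hg => ?_, h g κ⟩
  have := h _ κ⁻¹ hg
  rwa [map_inv, mul_inv_cancel_right] at this

variable {p}

lemma zpow_eq_of_unit (hp1 : normAbs (p : F) < 1) {e : ℤ}
    (h : ∃ u : 𝒪[F]ˣ, ((p ^ e : Fˣ) : F) = u) : e = 0 := by
  obtain ⟨u, hu⟩ := h
  have h1 : normAbs (p : F) ^ e = 1 := by
    rw [← normAbs_zpow, hu]; exact normAbs_intUnits u
  exact (zpow_eq_one_iff_right₀ (normAbs_pos p.ne_zero).le hp1.ne).mp h1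

/-- A diagonal matrix in `GL_n(𝒪)` has unit entries. -/
lemma exists_unit_of_diagGL {b : Fin n → Fˣ} {κ : GL (Fin n) 𝒪[F]}
    (h : diagGL n F b = intGL n κ) (i : Fin n) : ∃ u : 𝒪[F]ˣ, (b i : F) = u := by
  have h1 : ∀ i, (b i : F) = (κ i i : F) := fun i => by
    rw [← intGL_apply, ← h, diagGL_apply, if_pos rfl]
  have h2 : diagGL n F b⁻¹ = intGL n κ⁻¹ := by rw [map_inv, map_inv, h]
  have h3 : ((b⁻¹ i : Fˣ) : F) = (κ⁻¹ i i : F) := by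
    rw [← intGL_apply, ← h2, diagGL_apply, if_pos rfl]
  have h4 : κ i i * κ⁻¹ i i = 1 := by
    apply Subtype.val_injective
    change (κ i i : F) * (κ⁻¹ i i : F) = 1
    rw [← h1, ← h3]; simp
  obtain ⟨u, hu⟩ := IsUnit.of_mul_eq_one _ h4
  exact ⟨u, by rw [h1, hu]⟩

lemma pairwise_disjoint_torusCell (hp1 : normAbs (p : F) < 1) :
    Pairwise (Function.onFun Disjoint (torusCell (n := n) p)) := by
  intro e e' hne
  rw [Function.onFun, Set.disjoint_left]
  intro g hg hg'
  apply hne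
  obtain ⟨κ, rfl⟩ := mem_torusCell.mp hg
  obtain ⟨κ', h⟩ := mem_torusCell.mp hg'
  have h1 : diagGL n F (fun i => p ^ (e i - e' i)) = intGL n (κ' * κ⁻¹) := by
    rw [map_mul, map_inv, eq_mul_inv_iff_mul_eq]
    apply mul_left_cancel (a := torusPow p e')
    rw [← h, ← mul_assoc]
    congr 1
    rw [torusPow, ← map_mul, torusPow]
    congr 1
    ext i
    simp [_root_.zpow_sub]
  ext i
  exact sub_eq_zero.mp (zpow_eq_of_unit hp1 (exists_unit_of_diagGL h1 i))

lemma normAbs_det_torusCell {e : Fin n → ℤ} {g : GL (Fin n) F} (hg : g ∈ torusCell p e) :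
    normAbs ((GeneralLinearGroup.det g : Fˣ) : F) = normAbs (p : F) ^ ∑ i, e i := by
  obtain ⟨κ, rfl⟩ := mem_torusCell.mp hg
  rw [map_mul, det_intGL, Units.val_mul, normAbs_mul, normAbs_intUnits, mul_one, torusPow,
    det_diagGL, ← normAbs_zpow, prod_zpow_eq_zpow_sum]

end Cells

/-! ### Finiteness of a cone within a determinant shell -/

section Cone

variable {n : ℕ} {p : Fˣ}

lemma exists_neg_le_of_zpow_mul_mem (hp1 : normAbs (p : F) < 1) {c : F} (hc : c ≠ 0) :
    ∃ L : ℕ, ∀ x : ℤ, ((p ^ x : Fˣ) : F) * c ∈ 𝒪[F] → -(L : ℤ) ≤ x := by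
  have hp0 := normAbs_pos p.ne_zero
  obtain ⟨L, hL⟩ := pow_unbounded_of_one_lt (normAbs c)⁻¹ ((one_lt_inv₀ hp0).mpr hp1)
  refine ⟨L, fun x hx => ?_⟩
  by_contra! hlt
  have h1 := normAbs_le_one hx
  rw [normAbs_mul, normAbs_zpow] at h1
  have h2 : (normAbs (p : F))⁻¹ ^ L ≤ normAbs (p : F) ^ x := by
    rw [inv_pow, ← zpow_natCast, ← _root_.zpow_neg]
    exact zpow_le_zpow_right_of_le_one₀ hp0 hp1.le hlt.le
  have h3 : normAbs (p : F) ^ x ≤ (normAbs c)⁻¹ := by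
    rwa [← one_div, le_div_iff₀ (normAbs_pos hc)]
  exact absurd (hL.trans_le (h2.trans h3)) (lt_irrefl _)

/-- A cone of the torus meets each determinant shell in finitely many cells. -/
lemma finite_cone (hp1 : normAbs (p : F) < 1) {c : F} (hc : c ≠ 0) (m : ℤ) :
    {e : Fin n → ℤ | ∑ i, e i = m ∧ ∀ i : Fin n,
      ((Fin.snoc (fun i => p ^ e i) 1 : Fin (n + 1) → Fˣ) i.castSucc : F) *
        ((Fin.snoc (fun i => p ^ e i) 1 : Fin (n + 1) → Fˣ) i.succ : F)⁻¹ * c ∈ 𝒪[F]}.Finite := by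
  obtain ⟨L, hL⟩ := exists_neg_le_of_zpow_mul_mem hp1 hc
  refine (Set.finite_Icc (fun _ : Fin n => -((n : ℤ) * L))
    (fun _ : Fin n => m + n * (n * L))).subset ?_
  rintro e ⟨hm, he⟩
  let E : Fin (n + 1) → ℤ := Fin.snoc e 0
  have hE : ∀ i, (Fin.snoc (fun i => p ^ e i) 1 : Fin (n + 1) → Fˣ) i = p ^ E i := by
    intro i
    induction i using Fin.lastCases with
    | last => simp [E]
    | cast i => simp [E]
  have hstep : ∀ i : Fin n, E i.succ - L ≤ E i.castSucc := by
    intro i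
    have h1 := he i
    rw [hE, hE, ← Units.val_inv_eq_inv_val, ← Units.val_mul, ← _root_.zpow_sub] at h1
    linarith [hL _ h1]
  -- Descending induction from the appended exponent `E n = 0`, losing at most `L` at each step.
  have hlow : ∀ i : Fin (n + 1), -(((n : ℤ) - (i : ℕ)) * L) ≤ E i := by
    intro i
    induction i using Fin.reverseInduction with
    | last => simp [E]
    | cast i ih =>
      have := hstep i
      rw [Fin.val_succ] at ih
      rw [Fin.val_castSucc]
      push_cast at ih
      linarith
  have hlow' : ∀ i : Fin n, -((n : ℤ) * L) ≤ e i := by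
    intro i
    have h1 := hlow i.castSucc
    have h2 : E i.castSucc = e i := by simp [E]
    rw [h2, Fin.val_castSucc] at h1
    nlinarith [mul_nonneg (Int.natCast_nonneg (i : ℕ)) (Int.natCast_nonneg L)]
  refine ⟨hlow', fun i => ?_⟩
  -- All shifted exponents are nonnegative, so each is at most their sum, which is fixed on the
  -- shell.
  have h1 : e i + n * L ≤ ∑ j, (e j + (n : ℤ) * L) :=
    Finset.single_le_sum (f := fun j => e j + (n : ℤ) * L)
      (fun j _ => by linarith [hlow' j]) (Finset.mem_univ i)
  rw [Finset.sum_add_distrib, hm, Finset.sum_const, Finset.card_univ, Fintype.card_fin,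
    nsmul_eq_mul] at h1
  change e i ≤ m + n * (n * L)
  nlinarith [mul_nonneg (Int.natCast_nonneg n) (Int.natCast_nonneg L)]

end Cone

/-! ### Topology -/

section Topology

lemma isOpen_integer : IsOpen (𝒪[F] : Set F) :=
  (valuation F).isOpen_integer

variable {n : ℕ}

lemma continuous_glEntry (i j : Fin n) : Continuous fun g : GL (Fin n) F => g i j :=
  Units.continuous_val.matrix_elem i j

lemma continuous_glEntry_inv (i j : Fin n) : Continuous fun g : GL (Fin n) F => g⁻¹ i j :=
  (continuous_glEntry i j).comp continuous_inv

lemma isOpen_maxCompact : IsOpen (maxCompact n F : Set (GL (Fin n) F)) := by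
  have : (maxCompact n F : Set (GL (Fin n) F)) =
      (⋂ i, ⋂ j, {g | g i j ∈ (𝒪[F] : Set F)}) ∩ ⋂ i, ⋂ j, {g | g⁻¹ i j ∈ (𝒪[F] : Set F)} := by
    ext g
    simp [mem_maxCompact_iff]
  rw [this]
  exact (isOpen_iInter_of_finite fun i => isOpen_iInter_of_finite fun j =>
    isOpen_integer.preimage (continuous_glEntry i j)).inter
    (isOpen_iInter_of_finite fun i => isOpen_iInter_of_finite fun j =>
    isOpen_integer.preimage (continuous_glEntry_inv i j))

lemma isOpen_map_congSubgroup {c : 𝒪[F]} (hc : c ≠ 0) :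
    IsOpen ((congSubgroup n (Ideal.span {c})).map (intGL n) : Set (GL (Fin n) F)) := by
  have hc' : (c : F) ≠ 0 := fun h => hc (Subtype.val_injective h)
  have : ((congSubgroup n (Ideal.span {c})).map (intGL n) : Set (GL (Fin n) F)) =
      (maxCompact n F : Set (GL (Fin n) F)) ∩
      ⋂ i, ⋂ j, {g | (c : F)⁻¹ * (g i j - (1 : Matrix (Fin n) (Fin n) F) i j) ∈ (𝒪[F] : Set F)} :=
          by
    ext g
    simp only [Set.mem_inter_iff, Set.mem_iInter, SetLike.mem_coe, Subgroup.mem_map,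
      Set.mem_ofPred_eq]
    have hone : ∀ i j, (1 : Matrix (Fin n) (Fin n) F) i j =
        ((1 : Matrix (Fin n) (Fin n) 𝒪[F]) i j : F) := by
      intro i j
      rw [Matrix.one_apply, Matrix.one_apply]
      split_ifs <;> rfl
    constructor
    · rintro ⟨k, hk, rfl⟩
      refine ⟨⟨k, rfl⟩, fun i j => ?_⟩
      obtain ⟨y, hy⟩ := Ideal.mem_span_singleton'.mp (mem_congSubgroup.mp hk i j)
      have h1 : (y : F) * c = intGL n k i j - (1 : Matrix (Fin n) (Fin n) F) i j := by
        rw [hone]; exact congrArg Subtype.val hy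
      rw [← h1, mul_comm (y : F), inv_mul_cancel_left₀ hc']
      exact y.2
    · rintro ⟨⟨k, rfl⟩, h⟩
      refine ⟨k, mem_congSubgroup.mpr fun i j => Ideal.mem_span_singleton'.mpr ⟨⟨_, h i j⟩, ?_⟩,
          rfl⟩
      apply Subtype.val_injective
      change (c : F)⁻¹ * ((k i j : F) - (1 : Matrix (Fin n) (Fin n) F) i j) * c =
        (k i j : F) - ((1 : Matrix (Fin n) (Fin n) 𝒪[F]) i j : F)
      rw [hone, mul_comm, mul_inv_cancel_left₀ hc']
  rw [this]
  exact isOpen_maxCompact.inter (isOpen_iInter_of_finite fun i => isOpen_iInter_of_finite fun j =>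
    isOpen_integer.preimage ((continuous_glEntry i j).sub continuous_const |>.const_mul _))

end Topology

/-! ### Integrals over cosets of a compact open subgroup -/

section CosetIntegral

/-- Every preimage is a union of cosets of the open subgroup `V`, hence open. -/
lemma measurable_of_rightInvariant {G E : Type*} [Group G] [TopologicalSpace G]
    [IsTopologicalGroup G] [MeasurableSpace G] [BorelSpace G] [MeasurableSpace E] {V : Subgroup G}
    (hV : IsOpen (V : Set G)) {Φ : G → E} (hΦ : ∀ g, ∀ k ∈ V, Φ (g * k) = Φ g) :
    Measurable Φ := by
  intro t _
  refine IsOpen.measurableSet (isOpen_iff_forall_mem_open.mpr fun g hg =>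
    ⟨(fun x => g⁻¹ * x) ⁻¹' V, fun x hx => ?_, hV.preimage (continuous_const_mul _), ?_⟩)
  · have h := hΦ g _ hx
    rw [mul_inv_cancel_left] at h
    exact (congrArg (· ∈ t) h).mpr hg
  · simp [one_mem]

variable {G Γ : Type*} [Group G] [Group Γ] [TopologicalSpace G] [IsTopologicalGroup G]
  [MeasurableSpace G] [BorelSpace G] {μ : Measure G} [μ.IsMulLeftInvariant]

/-- The integral of a right invariant function over a coset of the image of `Γ` is an average. -/
lemma integrableOn_and_integral_eq_cosetAvg {φ : Γ →* G} (hφ : Function.Injective φ)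
    {Λ : Subgroup Γ} [Λ.FiniteIndex] (hΛ : IsOpen (Λ.map φ : Set G))
    (hμ : μ (φ.range : Set G) = 1) {Φ : G → ℂ} (hΦ : ∀ g, ∀ k ∈ Λ, Φ (g * φ k) = Φ g) (a : G) :
    IntegrableOn Φ ((fun g => a⁻¹ * g) ⁻¹' (φ.range : Set G)) μ ∧
      ∫ g in (fun g => a⁻¹ * g) ⁻¹' (φ.range : Set G), Φ g ∂μ =
        cosetAvg Λ fun γ => Φ (a * φ γ) := by
  have := Fintype.ofFinite (Γ ⧸ Λ)
  -- The coset `a φ(Γ)` is the disjoint union of these translates of `φ(Λ)`. They have equal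
  -- measure, hence measure `1/[Γ : Λ]`, and `Φ` is constant on each.
  let S : G → Γ ⧸ Λ → Set G := fun a x => (fun g => (a * φ x.out)⁻¹ * g) ⁻¹' (Λ.map φ : Set G)
  have hmem : ∀ a x g, g ∈ S a x ↔ ∃ k ∈ Λ, g = a * φ (x.out * k) := by
    intro a x g
    constructor
    · rintro ⟨k, hk, h⟩
      exact ⟨k, hk, by rw [map_mul, h, ← mul_assoc, mul_inv_cancel_left]⟩
    · rintro ⟨k, hk, rfl⟩
      exact ⟨k, hk, by rw [map_mul]; group⟩
  have hUnion : ∀ a, (fun g => a⁻¹ * g) ⁻¹' (φ.range : Set G) = ⋃ x, S a x := by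
    intro a
    ext g
    rw [Set.mem_iUnion]
    constructor
    · rintro ⟨γ, hγ⟩
      refine ⟨γ, (hmem _ _ _).mpr ⟨(QuotientGroup.mk γ : Γ ⧸ Λ).out⁻¹ * γ, ?_, ?_⟩⟩
      · rw [← QuotientGroup.eq, QuotientGroup.out_eq']
      · rw [mul_inv_cancel_left, hγ, mul_inv_cancel_left]
    · rintro ⟨x, hx⟩
      obtain ⟨k, _, rfl⟩ := (hmem _ _ _).mp hx
      exact ⟨x.out * k, (inv_mul_cancel_left a _).symm⟩
  have hmeas : ∀ a x, MeasurableSet (S a x) := fun a x =>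
    (hΛ.preimage (continuous_const_mul _)).measurableSet
  have hdisj : ∀ a, Pairwise (Function.onFun Disjoint (S a)) := by
    intro a x y hxy
    rw [Function.onFun, Set.disjoint_left]
    intro g hg hg'
    obtain ⟨k, hk, rfl⟩ := (hmem _ _ _).mp hg
    obtain ⟨k', hk', h⟩ := (hmem _ _ _).mp hg'
    have h1 := hφ (mul_left_cancel h)
    apply hxy
    rw [← QuotientGroup.out_eq' x, ← QuotientGroup.out_eq' y, QuotientGroup.eq]
    have h2 : x.out⁻¹ * y.out = k * k'⁻¹ := by
      rw [inv_mul_eq_iff_eq_mul, ← mul_assoc, h1, mul_inv_cancel_right]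
    rw [h2]
    exact mul_mem hk (inv_mem hk')
  have hvol : ∀ a x, μ (S a x) = μ (Λ.map φ : Set G) := fun a x => measure_preimage_mul μ _ _
  have hcard : (Λ.index : ℝ≥0∞) * μ (Λ.map φ : Set G) = 1 := by
    have h1 : (φ.range : Set G) = ⋃ x, S 1 x := by
      rw [← hUnion]; simp
    rw [h1, measure_iUnion (hdisj 1) (hmeas 1)] at hμ
    simpa [hvol, tsum_fintype, Subgroup.index, Nat.card_eq_fintype_card] using hμ
  have hm : μ (Λ.map φ : Set G) = (Λ.index : ℝ≥0∞)⁻¹ := ENNReal.eq_inv_of_mul_eq_one_left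
    (by rw [mul_comm]; exact hcard)
  have hconst : ∀ x, ∀ g ∈ S a x, Φ g = Φ (a * φ x.out) := by
    intro x g hg
    obtain ⟨k, hk, rfl⟩ := (hmem _ _ _).mp hg
    rw [map_mul, ← mul_assoc, hΦ _ k hk]
  have hfin : ∀ x, μ (S a x) ≠ ∞ := by
    intro x
    rw [hvol, hm]
    simp [Subgroup.FiniteIndex.index_ne_zero]
  have hint : ∀ x, IntegrableOn Φ (S a x) μ := fun x =>
    (integrableOn_congr_fun (hconst x) (hmeas a x)).mpr
      (integrableOn_const (hfin x))
  rw [hUnion]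
  refine ⟨integrableOn_finite_iUnion.mpr hint, ?_⟩
  rw [integral_iUnion_fintype (hmeas a) (hdisj a) hint, cosetAvg_eq_sum, Finset.mul_sum]
  refine Finset.sum_congr rfl fun x _ => ?_
  rw [setIntegral_congr_fun (hmeas a x) (hconst x), setIntegral_const, Measure.real, hvol, hm,
    ENNReal.toReal_inv, ENNReal.toReal_natCast]
  simp

end CosetIntegral

/-! ### The quotient measure as a sum over cells -/

section QuotientMeasure

variable {n : ℕ} {p : Fˣ} [MeasurableSpace (GL (Fin n) F)] [BorelSpace (GL (Fin n) F)]

lemma isOpen_torusCell (e : Fin n → ℤ) : IsOpen (torusCell p e) :=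
  isOpen_maxCompact.preimage (continuous_const_mul _)

/-- The weight of a cell in the quotient measure. -/
def cellWeight (p : Fˣ) (ν : Measure (unipotent n F)) (e : Fin n → ℤ) : ℝ≥0∞ :=
  (ν {u | (u : GL (Fin n) F) * torusPow p e ∈ diagK n F})⁻¹

/-- The set in question is open and contains `1`. For `e ≠ 0` finiteness of the weight suffices,
since the cell integral vanishes; the exact value matters only at `e = 0`. -/
lemma cellWeight_ne_top (hp : ∀ x : Fˣ, ∃ (e : ℤ) (u : 𝒪[F]ˣ), x = p ^ e * intUnits u)
    (ν : Measure (unipotent n F)) [ν.IsHaarMeasure] (e : Fin n → ℤ) : cellWeight p ν e ≠ ∞ := by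
  rw [cellWeight, ENNReal.inv_ne_top]
  have hopen : IsOpen {u : unipotent n F | (u : GL (Fin n) F) * torusPow p e ∈ diagK n F} := by
    have h : IsOpen (diagK n F) := by
      rw [diagK_eq_iUnion hp]
      exact isOpen_iUnion isOpen_torusCell
    exact h.preimage (continuous_subtype_val.mul continuous_const)
  refine (hopen.measure_pos ν ⟨1, ?_⟩).ne'
  change (1 : GL (Fin n) F) * torusPow p e ∈ diagK n F
  rw [one_mul, diagK_eq_iUnion hp, Set.mem_iUnion]
  exact ⟨e, mem_torusCell.mpr ⟨1, by rw [map_one, mul_one]⟩⟩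

/-- If `u = aκ`, the diagonals of `κ` and `κ⁻¹ = u⁻¹a` are those of `a⁻¹` and `a`, so the entries of
`a` are units. -/
lemma unipotent_mem_diagK_iff {u : GL (Fin n) F} (hu : u ∈ unipotent n F) :
    u ∈ diagK n F ↔ u ∈ maxCompact n F := by
  constructor
  · rintro ⟨a, ha, k, ⟨κ, rfl⟩, h⟩
    have h1 : ∀ i j, u i j = a i i * (κ i j : F) := fun i j => by
      rw [h, Units.val_mul, Matrix.mul_apply, Finset.sum_eq_single i]
      · rfl
      · intro l _ hl; rw [ha i l hl.symm, zero_mul]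
      · simp
    have h2 : ∀ i j, u⁻¹ i j * a j j = (κ⁻¹ i j : F) := fun i j => by
      have h3 : u⁻¹ * a = intGL n κ⁻¹ := by rw [h, map_inv]; group
      rw [← intGL_apply, ← h3, Units.val_mul, Matrix.mul_apply, Finset.sum_eq_single j]
      · intro l _ hl; rw [ha l j hl, mul_zero]
      · simp
    have h4 : ∀ j, a j j * (κ j j : F) = 1 := fun j => by rw [← h1, hu.2]
    have h5 : ∀ j, a j j = (κ⁻¹ j j : F) := fun j => by
      rw [← h2, (inv_mem hu).2, one_mul]
    refine (mem_maxCompact_iff u).mpr ⟨fun i j => ?_, fun i j => ?_⟩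
    · rw [h1, h5]
      exact mul_mem (SetLike.coe_mem _) (SetLike.coe_mem _)
    · rw [← mul_one (u⁻¹ i j), ← h4 j, ← mul_assoc, h2]
      exact mul_mem (SetLike.coe_mem _) (SetLike.coe_mem _)
  · intro h
    exact ⟨1, fun i j hij => Matrix.one_apply_ne hij, u, h, (one_mul u).symm⟩

lemma cellWeight_zero (ν : Measure (unipotent n F))
    (hν : ν {u | (u : GL (Fin n) F) ∈ maxCompact n F} = 1) : cellWeight p ν 0 = 1 := by
  have : {u : unipotent n F | (u : GL (Fin n) F) * torusPow p 0 ∈ diagK n F} =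
      {u : unipotent n F | (u : GL (Fin n) F) ∈ maxCompact n F} := by
    ext u
    change (u : GL (Fin n) F) * torusPow p 0 ∈ diagK n F ↔ (u : GL (Fin n) F) ∈ maxCompact n F
    rw [torusPow_zero, mul_one, unipotent_mem_diagK_iff u.2]
  rw [cellWeight, this, hν, inv_one]

/-- The cells partition `A K`, and the weight is constant on each because `A K` is stable under
right translation by `K`. -/
lemma quotMeasure_eq (hp1 : normAbs (p : F) < 1)
    (hp : ∀ x : Fˣ, ∃ (e : ℤ) (u : 𝒪[F]ˣ), x = p ^ e * intUnits u)
    (μ : Measure (GL (Fin n) F)) (ν : Measure (unipotent n F)) :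
    quotMeasure μ ν = (Measure.sum fun e => cellWeight p ν e • μ.restrict (torusCell p e)).map
      (Quotient.mk (QuotientGroup.rightRel (unipotent n F))) := by
  have hmeas : ∀ e, MeasurableSet (torusCell (n := n) p e) := fun e =>
    (isOpen_torusCell e).measurableSet
  have h1 : (fun g : GL (Fin n) F => (diagK n F).indicator (1 : GL (Fin n) F → ℝ≥0∞) g /
      ν {u : unipotent n F | (u : GL (Fin n) F) * g ∈ diagK n F}) =
      ∑' e, (torusCell p e).indicator fun _ => cellWeight p ν e := by
    ext g
    rw [tsum_apply (Pi.summable.mpr fun _ => ENNReal.summable)]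
    by_cases hg : g ∈ diagK n F
    · obtain ⟨e, he⟩ := Set.mem_iUnion.mp (diagK_eq_iUnion hp ▸ hg)
      rw [tsum_eq_single e, Set.indicator_of_mem hg, Set.indicator_of_mem he, cellWeight,
        Pi.one_apply, one_div]
      · obtain ⟨κ, rfl⟩ := mem_torusCell.mp he
        simp only [← mul_assoc, mul_intGL_mem_diagK_iff]
      · intro e' he'
        exact Set.indicator_of_notMem
          (Set.disjoint_left.mp (pairwise_disjoint_torusCell hp1 he'.symm) he) _
    · rw [Set.indicator_of_notMem hg, ENNReal.zero_div, eq_comm, ENNReal.tsum_eq_zero]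
      intro e
      refine Set.indicator_of_notMem (fun he => hg ?_) _
      rw [diagK_eq_iUnion hp]
      exact Set.mem_iUnion.mpr ⟨e, he⟩
  rw [quotMeasure, h1, withDensity_tsum fun e => measurable_const.indicator (hmeas e)]
  congr 2
  ext1 e
  rw [withDensity_indicator (hmeas e), withDensity_const]

end QuotientMeasure

/-! ### The integral -/

section Integral

variable {n : ℕ} {ψ : AddChar F ℂ} {χ : Fˣ →* ℂˣ} {f : 𝒪[F]}
  {w : GL (Fin (n + 1)) F → ℂ} {v : GL (Fin n) F → ℂ}

lemma out_mk_eq (g : GL (Fin n) F) : ∃ u ∈ unipotent n F,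
    (Quotient.mk (QuotientGroup.rightRel (unipotent n F)) g).out = u * g := by
  have h : QuotientGroup.rightRel (unipotent n F) _ _ :=
    Quotient.mk_out (s := QuotientGroup.rightRel (unipotent n F)) g
  rw [QuotientGroup.rightRel_apply] at h
  refine ⟨_, inv_mem h, ?_⟩
  group

lemma quotIntegrand_mk (s : ℂ) (hw : IsWhittaker ψ w) (hv : IsWhittaker ψ⁻¹ v) (f : Fˣ)
    (g : GL (Fin n) F) : quotIntegrand w v χ f s (Quotient.mk _ g) = integrand w v χ f s g := by
  obtain ⟨u, hu, h⟩ := out_mk_eq g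
  rw [quotIntegrand, h, integrand_unipotent_mul s hw hv f hu]

/-- The matrices with determinant of absolute value `N(𝔭)^{-k}`. -/
def glShell (n : ℕ) (F : Type*) [Field F] [ValuativeRel F] [TopologicalSpace F]
    [IsNonarchimedeanLocalField F] (k : ℤ) : Set (GL (Fin n) F) :=
  {g | normAbs ((GeneralLinearGroup.det g : Fˣ) : F) = (residueCard F : ℝ) ^ (-k)}

lemma mk_preimage_detShell (k : ℤ) :
    Quotient.mk (QuotientGroup.rightRel (unipotent n F)) ⁻¹' detShell n F k = glShell n F k := by
  ext g
  obtain ⟨u, hu, h⟩ := out_mk_eq g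
  change normAbs ((GeneralLinearGroup.det (Quotient.mk (QuotientGroup.rightRel (unipotent n F)) g).out :
    Fˣ) : F) = _ ↔
    normAbs ((GeneralLinearGroup.det g : Fˣ) : F) = _
  rw [h, map_mul, det_unipotent hu, one_mul]

lemma zpow_neg_injective : Function.Injective fun k : ℤ => (residueCard F : ℝ) ^ (-k) := by
  have h : (1 : ℝ) < residueCard F := by exact_mod_cast one_lt_residueCard
  intro k l hkl
  exact neg_injective (zpow_right_injective₀ (by linarith) h.ne' hkl)

lemma iUnion_detShell : ⋃ k, detShell n F k = Set.univ := by
  refine Set.eq_univ_of_forall fun x => Set.mem_iUnion.mpr ?_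
  exact exists_normAbs_eq (GeneralLinearGroup.det x.out).ne_zero

lemma pairwise_disjoint_detShell : Pairwise (Function.onFun Disjoint (detShell n F)) := by
  intro k l hkl
  rw [Function.onFun, Set.disjoint_left]
  intro x hx hx'
  exact hkl (zpow_neg_injective (F := F) (Eq.trans (Eq.symm hx) hx'))

variable [MeasurableSpace (GL (Fin n) F)] [BorelSpace (GL (Fin n) F)]

lemma measurableSet_glShell (k : ℤ) : MeasurableSet (glShell n F k) := by
  have h : Measurable fun g : GL (Fin n) F => normAbs ((GeneralLinearGroup.det g : Fˣ) : F) := by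
    refine measurable_of_rightInvariant isOpen_maxCompact ?_
    rintro g _ ⟨κ, rfl⟩
    change normAbs ((GeneralLinearGroup.det (g * intGL n κ) : Fˣ) : F) = _
    rw [map_mul, det_intGL, Units.val_mul, normAbs_mul, normAbs_intUnits, mul_one]
  exact h (measurableSet_singleton _)

lemma measurable_mk :
    Measurable (Quotient.mk (QuotientGroup.rightRel (unipotent n F))) :=
  measurable_from_quotient.mp measurable_id

lemma measurableSet_detShell (k : ℤ) : MeasurableSet (detShell n F k) := by
  rw [measurableSet_quotient]
  have := measurableSet_glShell (F := F) (n := n) k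
  rw [← mk_preimage_detShell] at this
  exact this

variable (s : ℂ)

lemma measurable_integrand (hwI : IsIwahoriInvariant w) (hvI : IsIwahoriInvariant v)
    (hf0 : (f : F) ≠ 0) (hf : IsCondOf χ (Ideal.span {f})) (hf1 : ¬ IsUnit f) :
    Measurable (integrand w v χ (Units.mk0 (f : F) hf0) s) := by
  obtain ⟨M, hM⟩ := exists_integrand_mul_intGL s hwI hvI hf0 hf hf1
  have hf0' : f ≠ 0 := fun h => hf0 (by rw [h]; rfl)
  refine measurable_of_rightInvariant
    (isOpen_map_congSubgroup (n := n) (pow_ne_zero M hf0')) ?_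
  rintro g _ ⟨k, hk, rfl⟩
  exact hM M le_rfl g k hk

lemma measurable_quotIntegrand (hw : IsWhittaker ψ w) (hv : IsWhittaker ψ⁻¹ v)
    (hwI : IsIwahoriInvariant w) (hvI : IsIwahoriInvariant v)
    (hf0 : (f : F) ≠ 0) (hf : IsCondOf χ (Ideal.span {f})) (hf1 : ¬ IsUnit f) :
    Measurable (quotIntegrand w v χ (Units.mk0 (f : F) hf0) s) := by
  rw [measurable_from_quotient]
  have : quotIntegrand w v χ (Units.mk0 (f : F) hf0) s ∘ Quotient.mk'' =
      integrand w v χ (Units.mk0 (f : F) hf0) s := by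
    ext g
    exact quotIntegrand_mk s hw hv _ g
  rw [this]
  exact measurable_integrand s hwI hvI hf0 hf hf1

/-- The integral of the integrand over a cell vanishes unless the cell is `GL_n(𝒪)`. -/
lemma integral_torusCell (hψ1 : AddCharConductorOne ψ)
    (hw : IsWhittaker ψ w) (hwI : IsIwahoriInvariant w)
    (hv : IsWhittaker ψ⁻¹ v) (hvI : IsIwahoriInvariant v)
    (hf0 : (f : F) ≠ 0) (hf : IsCondOf χ (Ideal.span {f})) (hf1 : ¬ IsUnit f)
    {μ : Measure (GL (Fin n) F)} [μ.IsMulLeftInvariant]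
    (hμ : μ (maxCompact n F : Set (GL (Fin n) F)) = 1)
    {p : Fˣ} (hp1 : normAbs (p : F) < 1) (e : Fin n → ℤ) :
    IntegrableOn (integrand w v χ (Units.mk0 (f : F) hf0) s) (torusCell p e) μ ∧
      ∫ g in torusCell p e, integrand w v χ (Units.mk0 (f : F) hf0) s g ∂μ =
        if e = 0 then birchConstant w v χ ψ f else 0 := by
  have hf0' : f ≠ 0 := fun h => hf0 (by rw [h]; rfl)
  obtain ⟨M₁, h1⟩ := exists_integrand_mul_intGL s hwI hvI hf0 hf hf1
  obtain ⟨M₂, h2⟩ := exists_cosetAvg_integrand hψ1 s hf0 hf hf1 n hw hwI hv hvI (fun i => p ^ e i)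
  have := finite_quotient_span (pow_ne_zero (M₁ + M₂) hf0')
  obtain ⟨h3, h4⟩ := integrableOn_and_integral_eq_cosetAvg (μ := μ) (intGL_injective (F := F) n)
    (isOpen_map_congSubgroup (n := n) (pow_ne_zero (M₁ + M₂) hf0')) hμ
    (h1 (M₁ + M₂) (Nat.le_add_right _ _)) (torusPow p e)
  refine ⟨h3, h4.trans ?_⟩
  obtain ⟨h5, h6⟩ := h2 (M₁ + M₂) (Nat.le_add_left _ _)
  split_ifs with he
  · exact h5 fun i => ⟨1, by simp [he]⟩
  · refine h6 fun h => he (funext fun i => zpow_eq_of_unit hp1 (h i))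

/-- Absolute convergence of the integral over a shell, and its value. -/
theorem integral_detShell (hψ1 : AddCharConductorOne ψ)
    (hw : IsWhittaker ψ w) (hwI : IsIwahoriInvariant w)
    (hv : IsWhittaker ψ⁻¹ v) (hvI : IsIwahoriInvariant v)
    (hf0 : (f : F) ≠ 0) (hf : IsCondOf χ (Ideal.span {f})) (hf1 : ¬ IsUnit f)
    {μ : Measure (GL (Fin n) F)} [μ.IsMulLeftInvariant]
    (hμ : μ (maxCompact n F : Set (GL (Fin n) F)) = 1)
    {ν : Measure (unipotent n F)} [ν.IsHaarMeasure]
    (hν : ν {u | (u : GL (Fin n) F) ∈ maxCompact n F} = 1) (k : ℤ) :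
    IntegrableOn (quotIntegrand w v χ (Units.mk0 (f : F) hf0) s) (detShell n F k)
        (quotMeasure μ ν) ∧
      ∫ x in detShell n F k, quotIntegrand w v χ (Units.mk0 (f : F) hf0) s x ∂(quotMeasure μ ν) =
        if k = 0 then birchConstant w v χ ψ f else 0 := by
  obtain ⟨p, hp1, hp⟩ := exists_uniformizer F
  set I := integrand w v χ (Units.mk0 (f : F) hf0) s with hI
  have hIm : Measurable I := measurable_integrand s hwI hvI hf0 hf hf1
  have hqm := measurable_quotIntegrand s hw hv hwI hvI hf0 hf hf1
  have hcell := fun e => integral_torusCell s hψ1 hw hwI hv hvI hf0 hf hf1 hμ hp1 e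
  let m : (Fin n → ℤ) → Measure (GL (Fin n) F) := fun e =>
    cellWeight p ν e • (μ.restrict (torusCell p e)).restrict (glShell n F k)
  have hcomp : quotIntegrand w v χ (Units.mk0 (f : F) hf0) s ∘
      Quotient.mk (QuotientGroup.rightRel (unipotent n F)) = I := by
    ext g
    exact quotIntegrand_mk s hw hv _ g
  have hrestr : (quotMeasure μ ν).restrict (detShell n F k) = (Measure.sum m).map
      (Quotient.mk (QuotientGroup.rightRel (unipotent n F))) := by
    rw [quotMeasure_eq hp1 hp, Measure.restrict_map measurable_mk (measurableSet_detShell k),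
      mk_preimage_detShell, Measure.restrict_sum _ (measurableSet_glShell k)]
    simp only [m, Measure.restrict_smul]
  -- The absolute value of the determinant is constant on a cell, so each cell lies inside the shell
  -- or is disjoint from it.
  have hmem : ∀ e, ∀ g ∈ torusCell p e, (g ∈ glShell n F k ↔
      normAbs (p : F) ^ ∑ i, e i = (residueCard F : ℝ) ^ (-k)) := by
    intro e g hg
    rw [← normAbs_det_torusCell hg]
    rfl
  have hcellm : ∀ e, MeasurableSet (torusCell (n := n) p e) := fun e =>
    (isOpen_torusCell e).measurableSet
  have hm_in : ∀ e : Fin n → ℤ, normAbs (p : F) ^ ∑ i, e i = (residueCard F : ℝ) ^ (-k) →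
      m e = cellWeight p ν e • μ.restrict (torusCell p e) := by
    intro e he
    simp only [m]
    rw [Measure.restrict_restrict (measurableSet_glShell k), Set.inter_eq_right.mpr]
    exact fun g hg => (hmem e g hg).mpr he
  have hm_out : ∀ e : Fin n → ℤ, normAbs (p : F) ^ ∑ i, e i ≠ (residueCard F : ℝ) ^ (-k) →
      m e = 0 := by
    intro e he
    simp only [m]
    rw [Measure.restrict_restrict (measurableSet_glShell k), (Set.disjoint_iff_inter_eq_empty).mp]
    · simp
    · exact Set.disjoint_left.mpr fun g hg hg' => he ((hmem e g hg').mp hg)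
  have hint_m : ∀ e, Integrable I (m e) := by
    intro e
    by_cases he : normAbs (p : F) ^ ∑ i, e i = (residueCard F : ℝ) ^ (-k)
    · rw [hm_in e he]
      exact (hcell e).1.smul_measure (cellWeight_ne_top hp ν e)
    · rw [hm_out e he]
      exact integrable_zero_measure
  have hfinite : {e | ¬ ∫⁻ g, ‖I g‖ₑ ∂(m e) = 0}.Finite := by
    obtain ⟨N, hN⟩ := exists_mem_integer_of_integrand_ne_zero (v := v) (χ := χ) hψ1 s hw hwI hf0 hf1
    -- The exact value of `|p|` is not needed: if `N(𝔭)^{-k}` is not a power of `|p|`, no cell meets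
    -- the shell.
    by_cases hex : ∃ j : ℤ, normAbs (p : F) ^ j = (residueCard F : ℝ) ^ (-k)
    · obtain ⟨j, hj⟩ := hex
      refine (finite_cone hp1 (pow_ne_zero N hf0) j).subset fun e he => ?_
      have he1 : normAbs (p : F) ^ ∑ i, e i = (residueCard F : ℝ) ^ (-k) := by
        by_contra h
        exact he (by rw [hm_out e h, lintegral_zero_measure])
      refine ⟨zpow_right_injective₀ (normAbs_pos p.ne_zero) hp1.ne (he1.trans hj.symm), ?_⟩
      by_contra h
      apply he
      rw [hm_in e he1, lintegral_smul_measure, setLIntegral_eq_zero (hcellm e), smul_zero]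
      intro g hg
      obtain ⟨κ, rfl⟩ := mem_torusCell.mp hg
      have : I (torusPow p e * intGL n κ) = 0 := by
        by_contra h0
        exact h (hN _ κ h0)
      simp [this]
    · convert Set.finite_empty (α := Fin n → ℤ)
      refine Set.eq_empty_of_forall_notMem fun e he => he ?_
      rw [hm_out e fun h => hex ⟨_, h⟩, lintegral_zero_measure]
  -- Only finitely many cells carry a nonzero integrand, so integrability on single cells is enough.
  have hint : Integrable I (Measure.sum m) := by
    refine ⟨hIm.aestronglyMeasurable, ?_⟩
    rw [HasFiniteIntegral, lintegral_sum_measure,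
      tsum_eq_sum (s := hfinite.toFinset) fun e he => by simpa using he]
    exact ENNReal.sum_lt_top.mpr fun e _ => (hint_m e).2
  have hval : ∀ e, ∫ g, I g ∂(m e) =
      if e = 0 then (if k = 0 then birchConstant w v χ ψ f else 0) else 0 := by
    intro e
    by_cases he : normAbs (p : F) ^ ∑ i, e i = (residueCard F : ℝ) ^ (-k)
    · rw [hm_in e he, integral_smul_measure, (hcell e).2]
      split_ifs with h1 h2
      · rw [h1, cellWeight_zero ν hν]; simp
      · exfalso
        apply h2
        apply zpow_neg_injective (F := F)
        simp only
        rw [← he, h1]; simp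
      · exact smul_zero _
    · rw [hm_out e he, integral_zero_measure]
      split_ifs with h1 h2
      · exact absurd (by simp [h1, h2]) he
      · rfl
      · rfl
  constructor
  · rw [IntegrableOn, hrestr, integrable_map_measure hqm.aestronglyMeasurable
      measurable_mk.aemeasurable, hcomp]
    exact hint
  · rw [hrestr, integral_map measurable_mk.aemeasurable hqm.aestronglyMeasurable]
    have h1 := hasSum_integral_measure hint
    simp only [hval] at h1
    have h2 := h1.unique (hasSum_ite_eq (0 : Fin n → ℤ) _)
    rw [← h2]
    exact integral_congr_ae (Filter.Eventually.of_forall fun g => congrFun hcomp g)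

end Integral

end BirchLemma

end

/-! ### The theorem: assembly of the shells -/

theorem corollary2p7
    {F : Type*} [Field F] [ValuativeRel F] [TopologicalSpace F] [IsNonarchimedeanLocalField F]
    (ψ : AddChar F ℂ) (hψ : Continuous ψ) (hψ1 : BirchLemma.AddCharConductorOne ψ)
    (n : ℕ) [MeasurableSpace (GL (Fin n) F)] [BorelSpace (GL (Fin n) F)]
    (μ : Measure (GL (Fin n) F)) [μ.IsHaarMeasure]
    (hμ : μ (BirchLemma.maxCompact n F : Set (GL (Fin n) F)) = 1)
    (ν : Measure (BirchLemma.unipotent n F)) [ν.IsHaarMeasure]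
    (hν : ν {u | (u : GL (Fin n) F) ∈ BirchLemma.maxCompact n F} = 1)
    (w : GL (Fin (n + 1)) F → ℂ) (hw : BirchLemma.IsWhittaker ψ w)
    (hwI : BirchLemma.IsIwahoriInvariant w)
    (v : GL (Fin n) F → ℂ) (hv : BirchLemma.IsWhittaker ψ⁻¹ v)
    (hvI : BirchLemma.IsIwahoriInvariant v)
    (χ : Fˣ →* ℂˣ) (hχ : Continuous χ)
    (f : 𝒪[F]) (hf0 : (f : F) ≠ 0)
    (hf : BirchLemma.IsCondOf χ (Ideal.span {f})) (hf1 : Ideal.span {f} ≠ ⊤) (s : ℂ) :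
    (∀ k : ℤ, IntegrableOn (BirchLemma.quotIntegrand w v χ (Units.mk0 (f : F) hf0) s)
        (BirchLemma.detShell n F k) (BirchLemma.quotMeasure μ ν)) ∧
      HasSum (fun k : ℤ => ∫ x in BirchLemma.detShell n F k,
          BirchLemma.quotIntegrand w v χ (Units.mk0 (f : F) hf0) s x
            ∂(BirchLemma.quotMeasure μ ν))
        (BirchLemma.birchConstant w v χ ψ f) ∧
      (Integrable (BirchLemma.quotIntegrand w v χ (Units.mk0 (f : F) hf0) s)
          (BirchLemma.quotMeasure μ ν) →
        ∫ x, BirchLemma.quotIntegrand w v χ (Units.mk0 (f : F) hf0) s x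
            ∂(BirchLemma.quotMeasure μ ν) =
          BirchLemma.birchConstant w v χ ψ f) := by
  rw [Ne, Ideal.span_singleton_eq_top] at hf1
  have hshell := BirchLemma.integral_detShell s hψ1 hw hwI hv hvI hf0 hf hf1 hμ hν
  have hsum : HasSum (fun k : ℤ => ∫ x in BirchLemma.detShell n F k,
      BirchLemma.quotIntegrand w v χ (Units.mk0 (f : F) hf0) s x ∂(BirchLemma.quotMeasure μ ν))
      (BirchLemma.birchConstant w v χ ψ f) := by
    simp only [fun k => (hshell k).2]
    exact hasSum_ite_eq 0 _
  refine ⟨fun k => (hshell k).1, hsum, fun hint => ?_⟩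
  -- Under global integrability, countable additivity over the shells expresses the full integral as
  -- the same sum.
  have h1 := hasSum_integral_iUnion (fun k => BirchLemma.measurableSet_detShell k)
    BirchLemma.pairwise_disjoint_detShell hint.integrableOn
  rw [BirchLemma.iUnion_detShell, setIntegral_univ] at h1
  exact h1.unique hsum
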